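/- Let $(M,g)$ be a smooth connected $d$-dimensional Riemannian manifold without boundary (Hausdorff, second countable), with Riemannian measure $\nu$. **Sobolev spaces.** For $r\in\{0,1,2,\dots\}$ and $1\le p<\infty$, let $W^r_p(M)$ be the completion of $\{f\in C^\infty(M):\|f\|_{W^r_p}<\infty\}$ with respect to the norm $\|f\|_{W^r_p}=\sum_{k=0}^r\big(\int_M|\nabla^kf|^p\,d\nu\big)^{1/p}$, where $\nabla$ is the Levi-Civita connection; it is regarded as a subspace of $L^p(M)$. Let $W^r_{p,loc}(M)$ be the space of all $f\in L^1_{loc}(M)$ such that $\eta f\in W^r_p(M)$ for all $\eta\in C_c^\infty(M)$, with the locally convex topology given by the seminorms $\varrho_\eta(f)=\|\eta f\|_{W^r_p(M)}$, $\eta\in C_c^\infty(M)$. **Operators.** A simple $H$-operator is given by a $C^\infty$ diffeomorphism $\Phi:V\to V'$ between open subsets of $M$ and a compactly supported $\varphi\in C^\infty(M)$ with $\operatorname{supp}\varphi\subset V$: it maps $f\in C_0(M)$ to the function equal to $\varphi(x)f(\Phi(x))$ for $x\in V$ and to $0$ for $x\notin V$. An operator $T$ on $C_0(M)$ is an $H$-operator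 localized on an open set $U$ if it is a finite combination of simple $H$-operators with $V\subset U$ and $\Phi(V)\subset U$. If $U$ is precompact, $T$ extends by density from $C_c(M)$ to a bounded operator on each $L^q(M)$, $1\le q<\infty$, and it acts on $f\in L^1_{loc}(M)$ by $Tf:=T(f\mathbf 1_U)$, using the extension to $L^1(M)$. **Decompositions.** Let $\mathcal U$ be a cover of $M$ by open precompact sets and $1\le q<\infty$. A family $\{P_U\}_{U\in\mathcal U}$ of operators on $C_0(M)$ is a smooth decomposition of identity in $L^q(M)$ subordinate to $\mathcal U$ if: (i) for every compact $K\subset M$, only finitely many $U\in\mathcal U$ satisfy both $U\cap K\neq\emptyset$ and $P_U\ne0$; (ii) each $P_U$ is an $H$-operator localized on $U$; (iii) each extension $P_U:L^q(M)\to L^q(M)$ is a projection; (iv) $P_U\circ P_{U'}=0$ for $U\neq U'$; (v) $\sum_{U\in\mathcal U}P_Uf=f$ unconditionally in $L^q(M)$ for all $f\in L^q(M)$; (vi) there is $C>0$ with $\frac1C\|f\|_q\le\big(\sum_{U\in\mathcal U}\|P_Uf\|_q^q\big)^{1/q}\le C\|f\|_q$ for all $f\in L^q(M)$. **Theorem.**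 Let $\{P_U\}_{U\in\mathcal U}$ be a smooth decomposition of identity in $L^q(M)$, $1\le q<\infty$, subordinate to a cover $\mathcal U$ of $M$ by open precompact sets. Let $1\le p<\infty$ and $r\in\{0,1,2,\dots\}$. Then for every $f\in L^1_{loc}(M)$, $$f\in W^r_{p,loc}(M)\iff P_Uf\in W^r_p(M)\ \text{ for all } U\in\mathcal U.$$ Moreover, the functions $\kappa_U(f)=\|P_Uf\|_{W^r_p(M)}$, $U\in\mathcal U$, are seminorms on $W^r_{p,loc}(M)$, and the family $\{\kappa_U\}_{U\in\mathcal U}$ defines the same locally convex topology on $W^r_{p,loc}(M)$ as the family $\{\varrho_\eta\}_{\eta\in C_c^\infty(M)}$. -/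

import Mathlib

open Set Filter Topology MeasureTheory Manifold
open scoped ContDiff ENNReal NNReal ZeroAtInfty

noncomputable section

namespace HestenesSobolev

/-- The model space `ℝ^d` with its Euclidean norm. -/
abbrev Eu (d : ℕ) : Type := EuclideanSpace ℝ (Fin d)

/-- A smooth Riemannian metric on a `d`-dimensional smooth manifold `M` without boundary. -/
abbrev SmoothMetric (d : ℕ) (M : Type*) [TopologicalSpace M] [ChartedSpace (Eu d) M]
    [IsManifold (𝓡 d) ∞ M] : Type _ :=
  Bundle.ContMDiffRiemannianMetric (𝓡 d) ∞ (Eu d) (fun x : M => TangentSpace (𝓡 d) x)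

/-- The partial derivative `∂_i u` of a function on `ℝ^d`. -/
def partialDeriv {d : ℕ} (i : Fin d) (u : Eu d → ℝ) (y : Eu d) : ℝ :=
  fderiv ℝ u y (EuclideanSpace.single i 1)

section Riemannian

variable {d : ℕ} {M : Type*} [TopologicalSpace M] [ChartedSpace (Eu d) M]
  [IsManifold (𝓡 d) ∞ M]

/-- The coordinate vector field `∂/∂x_i` of the chart `e`, at the point with coordinates `y`. -/
def coordVector (e : OpenPartialHomeomorph M (Eu d)) (y : Eu d) (i : Fin d) :
    TangentSpace (𝓡 d) (e.symm y) :=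
  mfderiv (𝓡 d) (𝓡 d) e.symm y (EuclideanSpace.single i (1 : ℝ) : Eu d)

/-- The matrix `(g_{ij})` of the metric in the chart `e`, at the point with coordinates `y`. -/
def gram (g : SmoothMetric d M) (e : OpenPartialHomeomorph M (Eu d)) (y : Eu d) :
    Matrix (Fin d) (Fin d) ℝ :=
  Matrix.of fun i j => g.inner (e.symm y) (coordVector e y i) (coordVector e y j)

/-- The Christoffel symbols `Γ^a_{ij}` of the Levi-Civita connection in the chart `e`. -/
def christoffel (g : SmoothMetric d M) (e : OpenPartialHomeomorph M (Eu d)) (a i j : Fin d)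
    (y : Eu d) : ℝ :=
  (1 / 2) * ∑ l, (gram g e y)⁻¹ a l *
    (partialDeriv i (fun z => gram g e z j l) y + partialDeriv j (fun z => gram g e z i l) y
      - partialDeriv l (fun z => gram g e z i j) y)

/-- The coordinates `(∇^k f)_{i_1 … i_k}` of the `k`-th covariant derivative of `f` in the
chart `e`, as functions of the coordinates `y`:
`(∇^{k+1} f)_{i_0 i_1 … i_k} = ∂_{i_0} (∇^k f)_{i_1 … i_k}
  - ∑_a ∑_l Γ^a_{i_0 i_l} (∇^k f)_{i_1 … i_{l-1} a i_{l+1} … i_k}`. -/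
def covDeriv (g : SmoothMetric d M) (e : OpenPartialHomeomorph M (Eu d)) (f : M → ℝ) :
    (k : ℕ) → (Fin k → Fin d) → Eu d → ℝ
  | 0, _, y => f (e.symm y)
  | k + 1, I, y =>
      partialDeriv (I 0) (covDeriv g e f k (Fin.tail I)) y
        - ∑ a : Fin d, ∑ l : Fin k, christoffel g e a (I 0) (Fin.tail I l) y *
            covDeriv g e f k (Function.update (Fin.tail I) l a) y

/-- The pointwise norm `|∇^k f|(x)`, computed in the preferred chart at `x` (for smooth `f` any
other chart around `x` gives the same value). -/
def covNorm (g : SmoothMetric d M) (k : ℕ) (f : M → ℝ) (x : M) : ℝ :=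
  Real.sqrt (∑ I : Fin k → Fin d, ∑ J : Fin k → Fin d,
    (∏ m, (gram g (chartAt (Eu d) x) (chartAt (Eu d) x x))⁻¹ (I m) (J m)) *
      covDeriv g (chartAt (Eu d) x) f k I (chartAt (Eu d) x x) *
      covDeriv g (chartAt (Eu d) x) f k J (chartAt (Eu d) x x))

variable [MeasurableSpace M]

/-- The measure `√(det g_{ij}) dy` of the domain of the chart `e`, as a measure on `M` which
vanishes off that domain. -/
def chartMeasure (g : SmoothMetric d M) (e : OpenPartialHomeomorph M (Eu d)) : Measure M :=
  ((volume.restrict e.target).withDensity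
    fun y => ENNReal.ofReal (Real.sqrt (gram g e y).det)).map e.symm

/-- The Riemannian measure. The chart measures of two charts agree on the intersection of the
domains, so their supremum is the measure which equals `√(det g_{ij}) dy` in every chart. -/
def riemannianMeasure (g : SmoothMetric d M) : Measure M :=
  ⨆ e ∈ atlas (Eu d) M, chartMeasure g e

/-- The expression `‖f‖_{W^r_p} = ∑_{k ≤ r} (∫ |∇^k f|^p dν)^{1/p}`, for smooth `f`. -/
def smoothSobolevNorm (g : SmoothMetric d M) (r : ℕ) (p : ℝ≥0∞) (f : M → ℝ) : ℝ≥0∞ :=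
  ∑ k ∈ Finset.range (r + 1), eLpNorm (covNorm g k f) p (riemannianMeasure g)

/-- The smooth functions with finite `W^r_p` norm. -/
def smoothSobolev (g : SmoothMetric d M) (r : ℕ) (p : ℝ≥0∞) : Set (M → ℝ) :=
  {f | ContMDiff (𝓡 d) 𝓘(ℝ) ∞ f ∧ smoothSobolevNorm g r p f < ⊤}

/-- `u` is a sequence of smooth functions with finite `W^r_p` norm which is a Cauchy sequence for
this norm and which converges to `f` in `L^p`. -/
structure IsSobolevApprox (g : SmoothMetric d M) (r : ℕ) (p : ℝ≥0∞) (u : ℕ → M → ℝ) (f : M → ℝ) :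
    Prop where
  mem : ∀ n, u n ∈ smoothSobolev g r p
  cauchy : ∀ ε : ℝ≥0∞, 0 < ε → ∃ N, ∀ m, N ≤ m → ∀ n, N ≤ n →
    smoothSobolevNorm g r p (u m - u n) < ε
  tendsto : Tendsto (fun n => eLpNorm (u n - f) p (riemannianMeasure g)) atTop (𝓝 0)

/-- Membership in `W^r_p(M)`, the completion of `smoothSobolev g r p`, realized as a space of
(classes of) functions in `L^p`. -/
def MemSobolev (g : SmoothMetric d M) (r : ℕ) (p : ℝ≥0∞) (f : M → ℝ) : Prop :=
  AEStronglyMeasurable f (riemannianMeasure g) ∧ ∃ u, IsSobolevApprox g r p u f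

/-- The norm of the completion `W^r_p(M)`: the limit of the norms along an approximating sequence
(it is the same for all of them). It is `⊤` if there is no such sequence. -/
def sobolevNorm (g : SmoothMetric d M) (r : ℕ) (p : ℝ≥0∞) (f : M → ℝ) : ℝ≥0∞ :=
  ⨅ (u : ℕ → M → ℝ) (_ : IsSobolevApprox g r p u f),
    limsup (fun n => smoothSobolevNorm g r p (u n)) atTop

variable (d M) in
/-- The space `C^∞_c(M)` of test functions. -/
abbrev TestFun : Type _ :=
  {η : M → ℝ // ContMDiff (𝓡 d) 𝓘(ℝ) ∞ η ∧ HasCompactSupport η}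

/-- Membership in the local Sobolev space `W^r_{p,loc}(M)`. -/
def MemSobolevLoc (g : SmoothMetric d M) (r : ℕ) (p : ℝ≥0∞) (f : M → ℝ) : Prop :=
  LocallyIntegrable f (riemannianMeasure g) ∧
    ∀ η : TestFun d M, MemSobolev g r p (fun x => η.1 x * f x)

end Riemannian

section Hestenes

variable (d : ℕ) {M : Type*} [TopologicalSpace M] [ChartedSpace (Eu d) M]

/-- The data `(φ, Φ, V)` of a simple `H`-operator: a `C^∞` diffeomorphism `Φ : V → V'` between open
subsets of `M` and a compactly supported `C^∞` function `φ` on `M` with `supp φ ⊆ V`.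
Here `V = Φ.source` and `V' = Φ.target`. -/
structure SimpleH (M : Type*) [TopologicalSpace M] [ChartedSpace (Eu d) M] where
  φ : M → ℝ
  Φ : OpenPartialHomeomorph M M
  smooth_φ : ContMDiff (𝓡 d) 𝓘(ℝ) ∞ φ
  compact_φ : HasCompactSupport φ
  supp_φ : tsupport φ ⊆ Φ.source
  smooth_Φ : ContMDiffOn (𝓡 d) (𝓡 d) ∞ Φ Φ.source
  smooth_symm : ContMDiffOn (𝓡 d) (𝓡 d) ∞ Φ.symm Φ.target

variable {d}

open Classical in
/-- `H f (x) = φ(x) f(Φ(x))` for `x ∈ V`, and `H f (x) = 0` otherwise. -/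
def SimpleH.apply (H : SimpleH d M) (f : M → ℝ) (x : M) : ℝ :=
  if x ∈ H.Φ.source then H.φ x * f (H.Φ x) else 0

variable (d) in
/-- `T` is an `H`-operator localized on `U`: a finite combination of simple `H`-operators with
`V ⊆ U` and `Φ(V) ⊆ U` (coefficients are absorbed by the functions `φ`). For `U = univ` this says
that `T` is an `H`-operator. -/
def IsLocalizedH (U : Set M) (T : C₀(M, ℝ) →L[ℝ] C₀(M, ℝ)) : Prop :=
  ∃ (n : ℕ) (H : Fin n → SimpleH d M),
    (∀ i, (H i).Φ.source ⊆ U ∧ (H i).Φ.target ⊆ U) ∧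
    ∀ (f : C₀(M, ℝ)) (x : M), T f x = ∑ i, (H i).apply f x

variable [MeasurableSpace M]

/-- `A` is a bounded operator on `L^q(μ)` which agrees with `T` on `C_c(M)`. -/
def IsLpExtension (μ : Measure M) (q : ℝ≥0∞) [Fact (1 ≤ q)]
    (T : C₀(M, ℝ) →L[ℝ] C₀(M, ℝ)) (A : Lp ℝ q μ →L[ℝ] Lp ℝ q μ) : Prop :=
  ∀ (f : C₀(M, ℝ)) (u : Lp ℝ q μ), HasCompactSupport f → u =ᵐ[μ] f → A u =ᵐ[μ] T f

open Classical in
/-- The bounded extension of `T` to `L^q(μ)`. For a localized `H`-operator `T`, the Riemannian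
measure and `q < ∞` it exists, and it is unique because `C_c(M)` is dense in `L^q`. -/
def lpExtension (μ : Measure M) (q : ℝ≥0∞) [Fact (1 ≤ q)]
    (T : C₀(M, ℝ) →L[ℝ] C₀(M, ℝ)) : Lp ℝ q μ →L[ℝ] Lp ℝ q μ :=
  if h : ∃ A, IsLpExtension μ q T A then h.choose else 0

open Classical in
/-- The action on `L^1_loc` of an `H`-operator `T` localized on an open precompact set `U`: the
`L^1` extension of `T` applied to the integrable function `f 1_U`. -/
def applyLoc (μ : Measure M) (U : Set M) (T : C₀(M, ℝ) →L[ℝ] C₀(M, ℝ)) (f : M → ℝ) : M → ℝ :=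
  if h : MemLp (U.indicator f) 1 μ then lpExtension μ 1 T (h.toLp (U.indicator f)) else 0

end Hestenes

section Decomposition

variable {M : Type*} [TopologicalSpace M]

/-- `𝒰` is a cover of `M` by open precompact sets. -/
structure IsOpenPrecompactCover (𝒰 : Set (Set M)) : Prop where
  isOpen : ∀ U ∈ 𝒰, IsOpen U
  precompact : ∀ U ∈ 𝒰, IsCompact (closure U)
  cover : ⋃₀ 𝒰 = univ

variable {d : ℕ} [ChartedSpace (Eu d) M] [IsManifold (𝓡 d) ∞ M] [MeasurableSpace M]

/-- `P` is a smooth decomposition of identity in `L^q(M)` subordinate to the cover `𝒰`. -/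
structure IsSmoothDecomposition (g : SmoothMetric d M) (𝒰 : Set (Set M)) (q : ℝ≥0∞) [Fact (1 ≤ q)]
    (P : 𝒰 → C₀(M, ℝ) →L[ℝ] C₀(M, ℝ)) : Prop where
  locallyFinite : ∀ K : Set M, IsCompact K → {U : 𝒰 | (U.1 ∩ K).Nonempty ∧ P U ≠ 0}.Finite
  localized : ∀ U : 𝒰, IsLocalizedH d U.1 (P U)
  projection : ∀ (U : 𝒰) (f : Lp ℝ q (riemannianMeasure g)),
    lpExtension (riemannianMeasure g) q (P U) (lpExtension (riemannianMeasure g) q (P U) f) =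
      lpExtension (riemannianMeasure g) q (P U) f
  comp_eq_zero : ∀ U V : 𝒰, U ≠ V → ∀ f : Lp ℝ q (riemannianMeasure g),
    lpExtension (riemannianMeasure g) q (P U) (lpExtension (riemannianMeasure g) q (P V) f) = 0
  hasSum : ∀ f : Lp ℝ q (riemannianMeasure g),
    HasSum (fun U : 𝒰 => lpExtension (riemannianMeasure g) q (P U) f) f
  norm_equiv : ∃ C : ℝ≥0, 0 < C ∧ ∀ f : Lp ℝ q (riemannianMeasure g),
    (C : ℝ≥0∞)⁻¹ * ‖f‖ₑ ≤
        (∑' U : 𝒰, ‖lpExtension (riemannianMeasure g) q (P U) f‖ₑ ^ q.toReal) ^ (1 / q.toReal) ∧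
      (∑' U : 𝒰, ‖lpExtension (riemannianMeasure g) q (P U) f‖ₑ ^ q.toReal) ^ (1 / q.toReal) ≤
        C * ‖f‖ₑ

end Decomposition

end HestenesSobolev

end

open HestenesSobolev

noncomputable section

namespace HestenesSobolev

/-! ### Calculus on open subsets of `ℝ^d`: partial and covariant derivatives in coordinates. -/

section Euclidean

variable {d : ℕ}

/-! ### Partial derivatives -/

/-! The theorem rests on two facts.

(1) Every simple `H`-operator is bounded on `W^r_p(M)` (`SimpleH.exists_sobolevNorm_apply_le`); this
covers both the operators `P_U` and multiplication by a test function.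

(2) On a compact set `K`, every locally integrable `f` equals almost everywhere the finite sum of
those `P_U f` with `P_U ≠ 0` and `U` meeting `K` (`IsSmoothDecomposition.ae_eq_sum`).

Given these, choose a test function `η` equal to `1` on the closure of `U`. Since `P_U` only sees
the values of `f` on `U`, `P_U f = P_U (η f)`, and (1) bounds `κ_U` by a multiple of `ϱ_η`.
Conversely, (2) on the support of `η` gives `η f = ∑ η P_U f`, a finite sum, and (1) for
multiplication by `η` bounds `ϱ_η` by a multiple of `∑ κ_U`. The same two identities give the
equivalence of memberships.

For (1), take a chart `e'` around `Φ x` and use `e = Φ ≫ₕ e'` as a chart around `x`. In these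
coordinates `Φ` is the identity, so `H u` is just `φ u`, and no higher order chain rule is needed.
What remains is to compare covariant derivatives for two connections on one open set: those of `φ u`
for the first are combinations of those of `u` for the second with smooth coefficients
(`exists_isDiffExpr_covD_mul`). Likewise the change of the Riemannian measure under `Φ` is a
quotient of two densities. This requires that `|∇^k u|` and the measure do not depend on the chart,
that is, the transformation laws of the Christoffel symbols and of tensors
(`christoffel_transition`, `covD_transform`, `covNormAt_indep`,
`riemannianMeasure_apply_of_subset`). Local bounds become global because `φ` has compact support,
and they pass to the completion because `H` maps approximating sequences to approximating sequences.

For (2), the unconditional sum in `L^q`, restricted to `K`, has finitely many nonzero terms. This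
gives the identity on `C_c(M) ⊆ L^q`; both sides are continuous from `L^1(M)` to `L^1(K)`, so it
extends to `L^1`, and then to `L^1_loc` by a cutoff. -/

theorem contDiffOn_partialDeriv {Ω : Set (Eu d)} (hΩ : IsOpen Ω) {u : Eu d → ℝ}
    (hu : ContDiffOn ℝ ∞ u Ω) (i : Fin d) : ContDiffOn ℝ ∞ (partialDeriv i u) Ω :=
  (hu.fderiv_of_isOpen hΩ (m := ∞) (by norm_num)).clm_apply contDiffOn_const

theorem partialDeriv_congr {Ω : Set (Eu d)} (hΩ : IsOpen Ω) {u v : Eu d → ℝ} (h : EqOn u v Ω)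
    {y : Eu d} (hy : y ∈ Ω) (i : Fin d) : partialDeriv i u y = partialDeriv i v y := by
  unfold partialDeriv
  rw [(h.eventuallyEq_of_mem (hΩ.mem_nhds hy)).fderiv_eq]

theorem differentiableAt_of_contDiffOn {F : Type*} [NormedAddCommGroup F] [NormedSpace ℝ F]
    {Ω : Set (Eu d)} (hΩ : IsOpen Ω) {u : Eu d → F}
    (hu : ContDiffOn ℝ ∞ u Ω) {y : Eu d} (hy : y ∈ Ω) : DifferentiableAt ℝ u y :=
  (hu.contDiffAt (hΩ.mem_nhds hy)).differentiableAt (by norm_num)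

theorem partialDeriv_mul {u v : Eu d → ℝ} {y : Eu d} (hu : DifferentiableAt ℝ u y)
    (hv : DifferentiableAt ℝ v y) (i : Fin d) :
    partialDeriv i (fun z => u z * v z) y = partialDeriv i u y * v y + u y * partialDeriv i v y := by
  unfold partialDeriv
  rw [fderiv_fun_mul hu hv]
  simp
  ring

theorem partialDeriv_add {u v : Eu d → ℝ} {y : Eu d} (hu : DifferentiableAt ℝ u y)
    (hv : DifferentiableAt ℝ v y) (i : Fin d) :
    partialDeriv i (fun z => u z + v z) y = partialDeriv i u y + partialDeriv i v y := by
  unfold partialDeriv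
  rw [fderiv_fun_add hu hv]
  simp

theorem partialDeriv_sub {u v : Eu d → ℝ} {y : Eu d} (hu : DifferentiableAt ℝ u y)
    (hv : DifferentiableAt ℝ v y) (i : Fin d) :
    partialDeriv i (fun z => u z - v z) y = partialDeriv i u y - partialDeriv i v y := by
  unfold partialDeriv
  rw [fderiv_fun_sub hu hv]
  simp

theorem partialDeriv_sum {ι : Type*} (s : Finset ι) {u : ι → Eu d → ℝ} {y : Eu d}
    (hu : ∀ j ∈ s, DifferentiableAt ℝ (u j) y) (i : Fin d) :
    partialDeriv i (fun z => ∑ j ∈ s, u j z) y = ∑ j ∈ s, partialDeriv i (u j) y := by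
  unfold partialDeriv
  rw [fderiv_fun_sum hu]
  simp

theorem partialDeriv_prod {ι : Type*} [DecidableEq ι] (s : Finset ι) {u : ι → Eu d → ℝ} {y : Eu d}
    (hu : ∀ j ∈ s, DifferentiableAt ℝ (u j) y) (i : Fin d) :
    partialDeriv i (fun z => ∏ j ∈ s, u j z) y =
      ∑ j ∈ s, (∏ m ∈ s.erase j, u m y) * partialDeriv i (u j) y := by
  unfold partialDeriv
  rw [fderiv_finsetProd hu]
  simp

theorem fderiv_eq_sum_partialDeriv (u : Eu d → ℝ) (y v : Eu d) :
    fderiv ℝ u y v = ∑ i, v i * partialDeriv i u y := by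
  have hv : v = ∑ i, v i • EuclideanSpace.single i (1 : ℝ) := by
    ext j
    simp [Finset.sum_apply, Pi.single_apply]
  conv_lhs => rw [hv]
  simp [partialDeriv]

theorem partialDeriv_apply {ψ : Eu d → Eu d} {y : Eu d} (hψ : DifferentiableAt ℝ ψ y)
    (i b : Fin d) :
    partialDeriv i (fun z => ψ z b) y = fderiv ℝ ψ y (EuclideanSpace.single i 1) b := by
  have h : HasFDerivAt (fun z => ψ z b) _ y :=
    (PiLp.hasFDerivAt_apply (𝕜 := ℝ) 2 (ψ y) b).comp y hψ.hasFDerivAt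
  unfold partialDeriv
  rw [h.fderiv]
  rfl

theorem partialDeriv_comp {ψ : Eu d → Eu d} {u : Eu d → ℝ} {y : Eu d}
    (hψ : DifferentiableAt ℝ ψ y) (hu : DifferentiableAt ℝ u (ψ y)) (i : Fin d) :
    partialDeriv i (fun z => u (ψ z)) y =
      ∑ b, partialDeriv i (fun z => ψ z b) y * partialDeriv b u (ψ y) := by
  have h1 : partialDeriv i (fun z => u (ψ z)) y =
      fderiv ℝ u (ψ y) (fderiv ℝ ψ y (EuclideanSpace.single i 1)) := by
    unfold partialDeriv
    rw [show (fun z => u (ψ z)) = u ∘ ψ from rfl, fderiv_comp y hu hψ]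
    rfl
  rw [h1, fderiv_eq_sum_partialDeriv]
  exact Finset.sum_congr rfl fun b _ => by rw [partialDeriv_apply hψ]

/-! ### Covariant derivatives for an arbitrary family of connection coefficients -/

/-- Components of the iterated covariant derivative of `h` for the connection with
coefficients `Γ`. -/
def covD (Γ : Fin d → Fin d → Fin d → Eu d → ℝ) (h : Eu d → ℝ) :
    (k : ℕ) → (Fin k → Fin d) → Eu d → ℝ
  | 0, _, y => h y
  | k + 1, I, y =>
      partialDeriv (I 0) (covD Γ h k (Fin.tail I)) y
        - ∑ a : Fin d, ∑ l : Fin k, Γ a (I 0) (Fin.tail I l) y *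
            covD Γ h k (Function.update (Fin.tail I) l a) y

variable {Ω : Set (Eu d)} {Γ Γ' : Fin d → Fin d → Fin d → Eu d → ℝ}

theorem contDiffOn_covD (hΩ : IsOpen Ω) (hΓ : ∀ a i j, ContDiffOn ℝ ∞ (Γ a i j) Ω) {h : Eu d → ℝ}
    (hh : ContDiffOn ℝ ∞ h Ω) (k : ℕ) (I : Fin k → Fin d) : ContDiffOn ℝ ∞ (covD Γ h k I) Ω := by
  induction k with
  | zero => exact hh
  | succ k ih =>
    refine (contDiffOn_partialDeriv hΩ (ih _) _).sub ?_
    exact ContDiffOn.sum fun a _ => ContDiffOn.sum fun l _ => (hΓ _ _ _).mul (ih _)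

theorem covD_congr (hΩ : IsOpen Ω) {h h' : Eu d → ℝ} (hh : EqOn h h' Ω) (k : ℕ)
    (I : Fin k → Fin d) : EqOn (covD Γ h k I) (covD Γ h' k I) Ω := by
  induction k with
  | zero => exact hh
  | succ k ih =>
    intro y hy
    simp only [covD]
    rw [partialDeriv_congr hΩ (ih _) hy]
    congr 1
    exact Finset.sum_congr rfl fun a _ => Finset.sum_congr rfl fun l _ => by rw [ih _ hy]

theorem covD_add (hΩ : IsOpen Ω) (hΓ : ∀ a i j, ContDiffOn ℝ ∞ (Γ a i j) Ω) {h h' : Eu d → ℝ}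
    (hh : ContDiffOn ℝ ∞ h Ω) (hh' : ContDiffOn ℝ ∞ h' Ω) (k : ℕ) (I : Fin k → Fin d) :
    EqOn (covD Γ (fun y => h y + h' y) k I) (fun y => covD Γ h k I y + covD Γ h' k I y) Ω := by
  induction k with
  | zero => exact fun y _ => rfl
  | succ k ih =>
    intro y hy
    simp only [covD]
    rw [partialDeriv_congr hΩ (ih _) hy,
      partialDeriv_add (differentiableAt_of_contDiffOn hΩ (contDiffOn_covD hΩ hΓ hh _ _) hy)
        (differentiableAt_of_contDiffOn hΩ (contDiffOn_covD hΩ hΓ hh' _ _) hy)]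
    have : ∑ a : Fin d, ∑ l : Fin k, Γ a (I 0) (Fin.tail I l) y *
          covD Γ (fun y => h y + h' y) k (Function.update (Fin.tail I) l a) y =
        ∑ a : Fin d, ∑ l : Fin k, Γ a (I 0) (Fin.tail I l) y *
          covD Γ h k (Function.update (Fin.tail I) l a) y +
        ∑ a : Fin d, ∑ l : Fin k, Γ a (I 0) (Fin.tail I l) y *
          covD Γ h' k (Function.update (Fin.tail I) l a) y := by
      simp only [← Finset.sum_add_distrib]
      exact Finset.sum_congr rfl fun a _ => Finset.sum_congr rfl fun l _ => by
        rw [ih _ hy]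
        ring
    rw [this]
    ring

theorem covD_const_mul (hΩ : IsOpen Ω) (hΓ : ∀ a i j, ContDiffOn ℝ ∞ (Γ a i j) Ω) {h : Eu d → ℝ}
    (hh : ContDiffOn ℝ ∞ h Ω) (c : ℝ) (k : ℕ) (I : Fin k → Fin d) :
    EqOn (covD Γ (fun y => c * h y) k I) (fun y => c * covD Γ h k I y) Ω := by
  induction k with
  | zero => exact fun y _ => rfl
  | succ k ih =>
    intro y hy
    simp only [covD]
    rw [partialDeriv_congr hΩ (ih _) hy,
      partialDeriv_mul (differentiableAt_const c)
        (differentiableAt_of_contDiffOn hΩ (contDiffOn_covD hΩ hΓ hh _ _) hy)]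
    have h0 : partialDeriv (I 0) (fun _ : Eu d => c) y = 0 := by simp [partialDeriv]
    rw [h0, mul_sub, Finset.mul_sum]
    simp only [Finset.mul_sum, zero_mul, zero_add]
    congr 1
    exact Finset.sum_congr rfl fun a _ => Finset.sum_congr rfl fun l _ => by
      rw [ih _ hy]
      ring

/-- Operators of the form `h ↦ ∑ c_{j J} (∇^j h)_J` with `j ≤ k` and coefficients smooth
on `Ω`. -/
inductive IsDiffExpr (Ω : Set (Eu d)) (Γ : Fin d → Fin d → Fin d → Eu d → ℝ) :
    ℕ → ((Eu d → ℝ) → Eu d → ℝ) → Prop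
  | covD (j : ℕ) (J : Fin j → Fin d) : IsDiffExpr Ω Γ j fun h => covD Γ h j J
  | zero (k : ℕ) : IsDiffExpr Ω Γ k fun _ _ => 0
  | smul {k : ℕ} {a : Eu d → ℝ} {F : (Eu d → ℝ) → Eu d → ℝ} (ha : ContDiffOn ℝ ∞ a Ω)
      (hF : IsDiffExpr Ω Γ k F) : IsDiffExpr Ω Γ k fun h y => a y * F h y
  | add {k : ℕ} {F G : (Eu d → ℝ) → Eu d → ℝ} (hF : IsDiffExpr Ω Γ k F)
      (hG : IsDiffExpr Ω Γ k G) : IsDiffExpr Ω Γ k fun h y => F h y + G h y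
  | mono {j k : ℕ} {F : (Eu d → ℝ) → Eu d → ℝ} (hjk : j ≤ k)
      (hF : IsDiffExpr Ω Γ j F) : IsDiffExpr Ω Γ k F

namespace IsDiffExpr

variable {k : ℕ} {F : (Eu d → ℝ) → Eu d → ℝ}

theorem sum {ι : Type*} (s : Finset ι) {G : ι → (Eu d → ℝ) → Eu d → ℝ}
    (hG : ∀ i, IsDiffExpr Ω Γ k (G i)) : IsDiffExpr Ω Γ k fun h y => ∑ i ∈ s, G i h y := by
  classical
  induction s using Finset.induction_on with
  | empty => simpa using zero k
  | insert i s hi ih =>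
    simp only [Finset.sum_insert hi]
    exact (hG i).add ih

theorem contDiffOn (hF : IsDiffExpr Ω Γ k F) (hΩ : IsOpen Ω)
    (hΓ : ∀ a i j, ContDiffOn ℝ ∞ (Γ a i j) Ω) {h : Eu d → ℝ} (hh : ContDiffOn ℝ ∞ h Ω) :
    ContDiffOn ℝ ∞ (F h) Ω := by
  induction hF with
  | covD j J => exact contDiffOn_covD hΩ hΓ hh j J
  | zero k => exact contDiffOn_const
  | smul ha _ ih => exact ha.mul ih
  | add _ _ ih1 ih2 => exact ih1.add ih2
  | mono _ _ ih => exact ih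

/-- Differentiation costs one order: the recursion for `covD`, solved for the partial derivative,
gives the component with index `Fin.cons i J` plus connection terms of the old order. The Leibniz
rule handles the coefficients. -/
theorem exists_partialDeriv (hF : IsDiffExpr Ω Γ k F) (hΩ : IsOpen Ω)
    (hΓ : ∀ a i j, ContDiffOn ℝ ∞ (Γ a i j) Ω) (i : Fin d) :
    ∃ G, IsDiffExpr Ω Γ (k + 1) G ∧
      ∀ h, ContDiffOn ℝ ∞ h Ω → ∀ y ∈ Ω, partialDeriv i (F h) y = G h y := by
  induction hF with
  | covD j J =>
    refine ⟨_, (IsDiffExpr.covD (Ω := Ω) (Γ := Γ) (j + 1) (Fin.cons i J)).add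
      ((sum Finset.univ fun a : Fin d => sum Finset.univ fun l : Fin j =>
        smul (hΓ a i (J l)) (covD j (Function.update J l a))).mono (Nat.le_succ j)), ?_⟩
    intro h _ y _
    simp [HestenesSobolev.covD]
  | zero k => exact ⟨_, zero _, fun h _ y _ => by simp [partialDeriv]⟩
  | smul ha hF ih =>
    obtain ⟨G, hG, hG'⟩ := ih
    refine ⟨_, ((smul (contDiffOn_partialDeriv hΩ ha i) hF).mono (Nat.le_succ _)).add
      (smul ha hG), fun h hh y hy => ?_⟩
    rw [partialDeriv_mul (differentiableAt_of_contDiffOn hΩ ha hy)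
      (differentiableAt_of_contDiffOn hΩ (hF.contDiffOn hΩ hΓ hh) hy), hG' h hh y hy]
  | add hF1 hF2 ih1 ih2 =>
    obtain ⟨G1, hG1, hG1'⟩ := ih1
    obtain ⟨G2, hG2, hG2'⟩ := ih2
    refine ⟨_, hG1.add hG2, fun h hh y hy => ?_⟩
    rw [partialDeriv_add (differentiableAt_of_contDiffOn hΩ (hF1.contDiffOn hΩ hΓ hh) hy)
      (differentiableAt_of_contDiffOn hΩ (hF2.contDiffOn hΩ hΓ hh) hy), hG1' h hh y hy,
      hG2' h hh y hy]
  | mono hjk _ ih =>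
    obtain ⟨G, hG, hG'⟩ := ih
    exact ⟨G, hG.mono (by omega), hG'⟩

/-- The coefficients are continuous, hence bounded near `y₀`. The order of quantifiers matters: both
the constant and the neighbourhood serve all `h` at once. -/
theorem exists_bound (hF : IsDiffExpr Ω Γ k F) (hΩ : IsOpen Ω) {y₀ : Eu d} (hy₀ : y₀ ∈ Ω) :
    ∃ C : ℝ, 0 ≤ C ∧ ∀ᶠ y in 𝓝 y₀, ∀ h,
      |F h y| ≤ C * ∑ j ∈ Finset.range (k + 1), ∑ J : Fin j → Fin d, |HestenesSobolev.covD Γ h j J y| := by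
  induction hF with
  | covD j J =>
    refine ⟨1, zero_le_one, Eventually.of_forall fun y h => ?_⟩
    rw [one_mul]
    refine le_trans ?_ (Finset.single_le_sum (f := fun j => ∑ J : Fin j → Fin d,
      |HestenesSobolev.covD Γ h j J y|) (fun _ _ => Finset.sum_nonneg fun _ _ => abs_nonneg _)
      (Finset.mem_range.2 (Nat.lt_succ_self j)))
    exact Finset.single_le_sum (f := fun J => |HestenesSobolev.covD Γ h j J y|)
      (fun _ _ => abs_nonneg _) (Finset.mem_univ J)
  | zero k => exact ⟨0, le_rfl, Eventually.of_forall fun y h => by simp⟩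
  | @smul k a F ha _ ih =>
    obtain ⟨C, hC, hb⟩ := ih
    refine ⟨(|a y₀| + 1) * C, by positivity, ?_⟩
    have hcont : ∀ᶠ y in 𝓝 y₀, |a y| < |a y₀| + 1 :=
      ((ha.continuousOn.continuousAt (hΩ.mem_nhds hy₀)).abs).eventually_lt continuousAt_const
        (by simp)
    filter_upwards [hb, hcont] with y hy ha' h
    rw [abs_mul, mul_assoc]
    exact mul_le_mul ha'.le (hy h) (abs_nonneg _) (by positivity)
  | add _ _ ih1 ih2 =>
    obtain ⟨C1, hC1, hb1⟩ := ih1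
    obtain ⟨C2, hC2, hb2⟩ := ih2
    refine ⟨C1 + C2, by positivity, ?_⟩
    filter_upwards [hb1, hb2] with y hy1 hy2 h
    rw [add_mul]
    exact (abs_add_le _ _).trans (add_le_add (hy1 h) (hy2 h))
  | mono hjk _ ih =>
    obtain ⟨C, hC, hb⟩ := ih
    refine ⟨C, hC, ?_⟩
    filter_upwards [hb] with y hy h
    refine (hy h).trans (mul_le_mul_of_nonneg_left ?_ hC)
    exact Finset.sum_le_sum_of_subset_of_nonneg
      (Finset.range_mono (by omega)) fun _ _ _ => Finset.sum_nonneg fun _ _ => abs_nonneg _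

end IsDiffExpr

/-- The covariant derivatives of `φ h` for one connection are combinations of those of `h` for
another one. -/
theorem exists_isDiffExpr_covD_mul (hΩ : IsOpen Ω) (hΓ : ∀ a i j, ContDiffOn ℝ ∞ (Γ a i j) Ω)
    (hΓ' : ∀ a i j, ContDiffOn ℝ ∞ (Γ' a i j) Ω) {φ : Eu d → ℝ} (hφ : ContDiffOn ℝ ∞ φ Ω)
    (k : ℕ) (I : Fin k → Fin d) :
    ∃ G, IsDiffExpr Ω Γ' k G ∧
      ∀ h, ContDiffOn ℝ ∞ h Ω → EqOn (covD Γ (fun y => φ y * h y) k I) (G h) Ω := by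
  induction k with
  | zero =>
    exact ⟨_, .smul hφ (.covD 0 Fin.elim0), fun h _ y _ => rfl⟩
  | succ k ih =>
    choose G hG hG' using ih
    -- The partial derivative is expressed through the connection `Γ'`, while the correction terms
    -- of the recursion carry `Γ` as smooth coefficients.
    obtain ⟨D, hD, hD'⟩ := (hG (Fin.tail I)).exists_partialDeriv hΩ hΓ' (I 0)
    refine ⟨_, hD.add ((IsDiffExpr.smul (a := fun _ => -1) contDiffOn_const
      (.sum Finset.univ fun a : Fin d => .sum Finset.univ fun l : Fin k =>
        .smul (hΓ a (I 0) (Fin.tail I l)) (hG (Function.update (Fin.tail I) l a)))).mono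
          (Nat.le_succ k)), fun h hh y hy => ?_⟩
    simp only [covD]
    rw [partialDeriv_congr hΩ (hG' _ h hh) hy, hD' h hh y hy, sub_eq_add_neg, neg_one_mul]
    congr 2
    exact Finset.sum_congr rfl fun a _ => Finset.sum_congr rfl fun l _ => by rw [hG' _ h hh hy]

theorem exists_bound_covD_mul (hΩ : IsOpen Ω) (hΓ : ∀ a i j, ContDiffOn ℝ ∞ (Γ a i j) Ω)
    (hΓ' : ∀ a i j, ContDiffOn ℝ ∞ (Γ' a i j) Ω) {φ : Eu d → ℝ} (hφ : ContDiffOn ℝ ∞ φ Ω)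
    (k : ℕ) (I : Fin k → Fin d) {y₀ : Eu d} (hy₀ : y₀ ∈ Ω) :
    ∃ C : ℝ, 0 ≤ C ∧ ∀ᶠ y in 𝓝 y₀, ∀ h, ContDiffOn ℝ ∞ h Ω →
      |covD Γ (fun y => φ y * h y) k I y| ≤
        C * ∑ j ∈ Finset.range (k + 1), ∑ J : Fin j → Fin d, |covD Γ' h j J y| := by
  obtain ⟨G, hG, hG'⟩ := exists_isDiffExpr_covD_mul hΩ hΓ hΓ' hφ k I
  obtain ⟨C, hC, hb⟩ := hG.exists_bound hΩ hy₀
  refine ⟨C, hC, ?_⟩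
  filter_upwards [hb, hΩ.mem_nhds hy₀] with y hy hyΩ h hh
  rw [hG' h hh hyΩ]
  exact hy h

/-! ### The transformation law -/

/-- Exchanging `a` with the `l`-th entry of `A` is an involution of the pairs `(A, a)`. It renames
the indices in contractions with the connection coefficients. -/
theorem sum_update_swap {k : ℕ} (l : Fin k) (f : (Fin k → Fin d) → Fin d → ℝ) :
    ∑ A : Fin k → Fin d, ∑ a, f (Function.update A l a) (A l) = ∑ A, ∑ a, f A a := by
  rw [← Finset.sum_product', ← Finset.sum_product']
  refine Finset.sum_nbij' (fun x => (Function.update x.1 l x.2, x.1 l))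
    (fun x => (Function.update x.1 l x.2, x.1 l)) ?_ ?_ ?_ ?_ ?_ <;> simp

/-- Induction on `k`. Differentiating the formula for `k` produces terms in which a Jacobian factor
is differentiated; the inhomogeneous term in the transformation law of the connection cancels
exactly these. -/
theorem covD_transform {Ω' : Set (Eu d)} (hΩ : IsOpen Ω) (hΩ' : IsOpen Ω') {ψ : Eu d → Eu d}
    (hψ : ContDiffOn ℝ ∞ ψ Ω) (hm : MapsTo ψ Ω Ω')
    (hΓ' : ∀ a i j, ContDiffOn ℝ ∞ (Γ' a i j) Ω')
    (hΓΓ' : ∀ y ∈ Ω, ∀ b i j, ∑ a, partialDeriv a (fun z => ψ z b) y * Γ a i j y =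
      ∑ m, ∑ n, Γ' b m n (ψ y) * partialDeriv i (fun z => ψ z m) y *
        partialDeriv j (fun z => ψ z n) y +
      partialDeriv i (partialDeriv j fun z => ψ z b) y)
    {h h' : Eu d → ℝ} (hh' : ContDiffOn ℝ ∞ h' Ω') (hhh' : EqOn h (fun y => h' (ψ y)) Ω)
    (k : ℕ) (I : Fin k → Fin d) :
    EqOn (covD Γ h k I) (fun y => ∑ A : Fin k → Fin d,
      (∏ m, partialDeriv (I m) (fun z => ψ z (A m)) y) * covD Γ' h' k A (ψ y)) Ω := by
  induction k with
  | zero =>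
    intro y hy
    simp only [covD, Finset.univ_eq_empty, Finset.prod_empty, one_mul, Finset.sum_const,
      Finset.card_univ, Fintype.card_unique, one_smul]
    exact hhh' hy
  | succ k ih =>
    intro y hy
    have hJ : ∀ (a b : Fin d), ContDiffOn ℝ ∞ (partialDeriv a fun z => ψ z b) Ω := fun a b =>
      contDiffOn_partialDeriv hΩ ((contDiffOn_piLp 2).1 hψ b) a
    have hJd : ∀ (a b : Fin d), DifferentiableAt ℝ (partialDeriv a fun z => ψ z b) y := fun a b =>
      differentiableAt_of_contDiffOn hΩ (hJ a b) hy
    have hT : ∀ A, DifferentiableAt ℝ (covD Γ' h' k A) (ψ y) := fun A =>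
      differentiableAt_of_contDiffOn hΩ' (contDiffOn_covD hΩ' hΓ' hh' k A) (hm hy)
    have hψd : DifferentiableAt ℝ ψ y := differentiableAt_of_contDiffOn hΩ hψ hy
    have hTψ : ∀ A, DifferentiableAt ℝ (fun z => covD Γ' h' k A (ψ z)) y := fun A =>
      (hT A).comp y hψd
    have hP : ∀ A : Fin k → Fin d, DifferentiableAt ℝ
        (fun z => ∏ m, partialDeriv (Fin.tail I m) (fun z => ψ z (A m)) z) y := fun A =>
      (HasFDerivAt.finsetProd fun m _ => (hJd _ _).hasFDerivAt).differentiableAt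
    set i₀ := I 0
    set I' := Fin.tail I
    set J : Fin d → Fin d → ℝ := fun b i => partialDeriv i (fun z => ψ z b) y with hJdef
    set T : (Fin k → Fin d) → ℝ := fun A => covD Γ' h' k A (ψ y)
    -- the derivative of the right-hand side
    have e1 : partialDeriv i₀ (covD Γ h k I') y =
        ∑ A : Fin k → Fin d, ((∑ l, (∏ m ∈ Finset.univ.erase l, J (A m) (I' m)) *
          partialDeriv i₀ (partialDeriv (I' l) fun z => ψ z (A l)) y) * T A +
          (∏ m, J (A m) (I' m)) * ∑ b, J b i₀ * partialDeriv b (covD Γ' h' k A) (ψ y)) := by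
      rw [partialDeriv_congr hΩ (ih I') hy, partialDeriv_sum]
      · refine Finset.sum_congr rfl fun A _ => ?_
        rw [partialDeriv_mul (hP A) (hTψ A),
          partialDeriv_prod _ (fun m _ => hJd _ _), partialDeriv_comp hψd (hT A)]
      · exact fun A _ => (hP A).mul (hTψ A)
    -- the connection terms
    have hG : ∀ b i j, ∑ a, J b a * Γ a i j y = ∑ m, ∑ n, Γ' b m n (ψ y) * J m i * J n j +
        partialDeriv i (partialDeriv j fun z => ψ z b) y := hΓΓ' y hy
    have e2 : ∑ a : Fin d, ∑ l : Fin k, Γ a i₀ (I' l) y *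
        covD Γ h k (Function.update I' l a) y =
        ∑ l, ∑ A : Fin k → Fin d, (∏ m ∈ Finset.univ.erase l, J (A m) (I' m)) *
          (∑ m, ∑ n, Γ' (A l) m n (ψ y) * J m i₀ * J n (I' l) +
            partialDeriv i₀ (partialDeriv (I' l) fun z => ψ z (A l)) y) * T A := by
      rw [Finset.sum_comm]
      refine Finset.sum_congr rfl fun l _ => ?_
      simp only [← hG]
      calc ∑ a : Fin d, Γ a i₀ (I' l) y * covD Γ h k (Function.update I' l a) y
          = ∑ a : Fin d, ∑ A : Fin k → Fin d, Γ a i₀ (I' l) y *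
            ((J (A l) a * ∏ m ∈ Finset.univ.erase l, J (A m) (I' m)) * T A) := by
            refine Finset.sum_congr rfl fun a _ => ?_
            rw [ih _ hy, Finset.mul_sum]
            refine Finset.sum_congr rfl fun A _ => ?_
            rw [← Finset.mul_prod_erase Finset.univ _ (Finset.mem_univ l)]
            congr 3
            · simp [hJdef]
            · refine Finset.prod_congr rfl fun m hm' => ?_
              rw [Function.update_of_ne (Finset.ne_of_mem_erase hm')]
        _ = _ := by
            rw [Finset.sum_comm]
            refine Finset.sum_congr rfl fun A _ => ?_
            rw [Finset.mul_sum, Finset.sum_mul]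
            exact Finset.sum_congr rfl fun a _ => by ring
    -- the right-hand side
    have e3 : (∑ A : Fin (k + 1) → Fin d,
        (∏ m, partialDeriv (I m) (fun z => ψ z (A m)) y) * covD Γ' h' (k + 1) A (ψ y)) =
        ∑ A : Fin k → Fin d, ∑ b, J b i₀ * (∏ m, J (A m) (I' m)) *
          (partialDeriv b (covD Γ' h' k A) (ψ y) - ∑ a : Fin d, ∑ l : Fin k, Γ' a b (A l) (ψ y) *
            T (Function.update A l a)) := by
      -- The multi-index of length `k + 1` splits into `b` for the new slot and `A` for the old
      -- ones.
      rw [← (Fin.consEquiv fun _ => Fin d).sum_comp, Fintype.sum_prod_type, Finset.sum_comm]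
      refine Finset.sum_congr rfl fun A _ => Finset.sum_congr rfl fun b _ => ?_
      rw [Fin.prod_univ_succ]
      simp only [Fin.consEquiv_apply, Fin.cons_zero, Fin.cons_succ, covD]
      rfl
    have e4 : ∑ A : Fin k → Fin d, ∑ b, J b i₀ * (∏ m, J (A m) (I' m)) *
          (∑ a : Fin d, ∑ l : Fin k, Γ' a b (A l) (ψ y) * T (Function.update A l a)) =
        ∑ l, ∑ A : Fin k → Fin d, (∏ m ∈ Finset.univ.erase l, J (A m) (I' m)) *
          (∑ m, ∑ n, Γ' (A l) m n (ψ y) * J m i₀ * J n (I' l)) * T A := by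
      have key : ∀ (l : Fin k) (b : Fin d), ∑ A : Fin k → Fin d, ∑ a : Fin d,
          J b i₀ * (∏ m, J (A m) (I' m)) * (Γ' a b (A l) (ψ y) * T (Function.update A l a)) =
          ∑ A : Fin k → Fin d, ∑ n, (∏ m ∈ Finset.univ.erase l, J (A m) (I' m)) *
            (Γ' (A l) b n (ψ y) * J b i₀ * J n (I' l)) * T A := by
        intro l b
        -- The renaming turns `T (Function.update A l a)` into `T A`, so that both sides are
        -- expansions in the same components; the Jacobian factor in slot `l` has to be singled out
        -- first.
        rw [← sum_update_swap l fun A n => (∏ m ∈ Finset.univ.erase l, J (A m) (I' m)) *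
            (Γ' (A l) b n (ψ y) * J b i₀ * J n (I' l)) * T A]
        refine Finset.sum_congr rfl fun A _ => Finset.sum_congr rfl fun a _ => ?_
        have : ∏ m ∈ Finset.univ.erase l, J (Function.update A l a m) (I' m) =
            ∏ m ∈ Finset.univ.erase l, J (A m) (I' m) :=
          Finset.prod_congr rfl fun m hm' => by
            rw [Function.update_of_ne (Finset.ne_of_mem_erase hm')]
        rw [this, ← Finset.mul_prod_erase Finset.univ _ (Finset.mem_univ l),
          Function.update_self]
        ring
      simp only [Finset.mul_sum, Finset.sum_mul] at key ⊢
      calc _ = ∑ l, ∑ b, ∑ A : Fin k → Fin d, ∑ a : Fin d,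
          J b i₀ * (∏ m, J (A m) (I' m)) * (Γ' a b (A l) (ψ y) * T (Function.update A l a)) := by
            have s1 : ∀ A : Fin k → Fin d, (∑ b, ∑ a, ∑ l,
                J b i₀ * (∏ m, J (A m) (I' m)) *
                  (Γ' a b (A l) (ψ y) * T (Function.update A l a))) =
                ∑ l, ∑ b, ∑ a, J b i₀ * (∏ m, J (A m) (I' m)) *
                  (Γ' a b (A l) (ψ y) * T (Function.update A l a)) := by
              intro A
              rw [Finset.sum_comm (s := (Finset.univ : Finset (Fin k)))]
              exact Finset.sum_congr rfl fun b _ => Finset.sum_comm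
            rw [Finset.sum_congr rfl fun A _ => s1 A, Finset.sum_comm]
            exact Finset.sum_congr rfl fun l _ => Finset.sum_comm
        _ = _ := by
            refine Finset.sum_congr rfl fun l _ => ?_
            rw [Finset.sum_congr rfl fun b _ => key l b, Finset.sum_comm]
    refine Eq.trans ?_ e3.symm
    simp only [covD]
    rw [e1, e2]
    simp only [mul_sub, Finset.sum_sub_distrib]
    rw [e4]
    -- After full expansion, the second derivatives of `ψ` coming from `e1` and from `e2` are
    -- identical sums and cancel.
    simp only [mul_add, add_mul, Finset.sum_add_distrib, Finset.mul_sum, Finset.sum_mul]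
    rw [Finset.sum_comm (s := (Finset.univ : Finset (Fin k → Fin d)))
      (t := (Finset.univ : Finset (Fin k)))]
    have e5 : ∀ (A : Fin k → Fin d) (b : Fin d), (∏ m, J (A m) (I' m)) *
        (J b i₀ * partialDeriv b (covD Γ' h' k A) (ψ y)) =
        J b i₀ * (∏ m, J (A m) (I' m)) * partialDeriv b (covD Γ' h' k A) (ψ y) :=
      fun A b => by ring
    simp only [e5]
    ring

end Euclidean

end HestenesSobolev

end

noncomputable section

namespace HestenesSobolev

/-! ### Algebra of the change of coordinates for metrics and Christoffel symbols. -/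

section ChristoffelAlgebra

variable {d : ℕ}

/-- The Jacobian matrix of `ψ`. -/
def jacobian (ψ : Eu d → Eu d) (y : Eu d) : Matrix (Fin d) (Fin d) ℝ :=
  Matrix.of fun b i => partialDeriv i (fun z => ψ z b) y

theorem partialDeriv_comm {Ω : Set (Eu d)} (hΩ : IsOpen Ω) {u : Eu d → ℝ}
    (hu : ContDiffOn ℝ ∞ u Ω) {y : Eu d} (hy : y ∈ Ω) (i j : Fin d) :
    partialDeriv i (partialDeriv j u) y = partialDeriv j (partialDeriv i u) y := by
  have hs : IsSymmSndFDerivAt ℝ u y :=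
    (hu.contDiffAt (hΩ.mem_nhds hy)).isSymmSndFDerivAt (by simpa using ENat.LEInfty.out)
  have hd : DifferentiableAt ℝ (fderiv ℝ u) y :=
    differentiableAt_of_contDiffOn hΩ (hu.fderiv_of_isOpen hΩ (m := ∞) (by norm_num)) hy
  have key : ∀ v w : Eu d, fderiv ℝ (fun z => fderiv ℝ u z v) y w = fderiv ℝ (fderiv ℝ u) y w v := by
    intro v w
    rw [fderiv_clm_apply hd (differentiableAt_const v)]
    simp
  unfold partialDeriv
  rw [key, key]
  exact hs _ _

/-- Here `D m i j` and `D' m i j` stand for `∂_m g_{ij}` in the two charts, `J` for the Jacobian and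
`H a i j` for `∂_i ∂_j ψ^a`. Of the six Hessian terms in the alternating sum, four cancel by
symmetry of `H` and `G'`, and the other two coincide. -/
theorem christoffelFirst_transform {ι : Type*} [Fintype ι] {J : ι → ι → ℝ} {H D D' : ι → ι → ι → ℝ}
    {G' : ι → ι → ℝ} (hG' : ∀ a b, G' a b = G' b a) (hH : ∀ a i j, H a i j = H a j i)
    (hD : ∀ m i j, D m i j = (∑ a, ∑ b, (H a m i * J b j * G' a b + J a i * H b m j * G' a b)) +
      ∑ a, ∑ b, ∑ c, J a i * J b j * J c m * D' c a b) (i j l : ι) :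
    D i j l + D j i l - D l i j = 2 * (∑ a, ∑ b, H a i j * J b l * G' a b) +
      ∑ a, ∑ b, ∑ c, J a i * J b j * J c l * (D' a b c + D' b a c - D' c a b) := by
  have s1 : ∀ m i j : ι, ∑ a, ∑ b, J a i * H b m j * G' a b = ∑ a, ∑ b, H a m j * J b i * G' a b := by
    intro m i j
    rw [Finset.sum_comm]
    exact Finset.sum_congr rfl fun a _ => Finset.sum_congr rfl fun b _ => by
      rw [hG' b a]
      ring
  have s2 : ∑ a, ∑ b, ∑ c, J a j * J b l * J c i * D' c a b =
      ∑ a, ∑ b, ∑ c, J a i * J b j * J c l * D' a b c := by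
    rw [Finset.sum_congr rfl fun a _ => Finset.sum_comm, Finset.sum_comm]
    exact Finset.sum_congr rfl fun a _ => Finset.sum_congr rfl fun b _ =>
      Finset.sum_congr rfl fun c _ => by ring
  have s3 : ∑ a, ∑ b, ∑ c, J a i * J b l * J c j * D' c a b =
      ∑ a, ∑ b, ∑ c, J a i * J b j * J c l * D' b a c := by
    refine Finset.sum_congr rfl fun a _ => ?_
    rw [Finset.sum_comm]
    exact Finset.sum_congr rfl fun b _ => Finset.sum_congr rfl fun c _ => by ring
  rw [hD i j l, hD j i l, hD l i j, s2, s3]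
  simp only [Finset.sum_add_distrib, s1, mul_add, mul_sub, Finset.sum_sub_distrib]
  rw [show (fun a => ∑ b, H a j i * J b l * G' a b) = fun a => ∑ b, H a i j * J b l * G' a b from
    funext fun a => Finset.sum_congr rfl fun b _ => by rw [hH a j i]]
  simp only [hH _ l]
  ring

/-- Invertibility of `J` need not be assumed: `det G = (det J)^2 det G'` forces it. -/
theorem jacobian_mul_inv {ι : Type*} [Fintype ι] [DecidableEq ι] {G G' J : Matrix ι ι ℝ}
    (hG : IsUnit G.det) (h : G = J.transpose * G' * J) :
    J * G⁻¹ * J.transpose = G'⁻¹ := by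
  have hdet : G.det = J.det * G'.det * J.det := by
    rw [h, Matrix.det_mul, Matrix.det_mul, Matrix.det_transpose]
  have hJ : IsUnit J.det := by
    rw [hdet] at hG
    exact isUnit_of_mul_isUnit_right hG
  have hJt : IsUnit J.transpose.det := by rwa [Matrix.det_transpose]
  rw [h, Matrix.mul_inv_rev, Matrix.mul_inv_rev, ← Matrix.mul_assoc, ← Matrix.mul_assoc,
    Matrix.mul_nonsing_inv _ hJ, Matrix.one_mul, Matrix.mul_assoc,
    Matrix.nonsing_inv_mul _ hJt, Matrix.mul_one]

/-- The lowered symbols transform by `christoffelFirst_transform`; raising the index with `J * G⁻¹ *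
Jᵀ = G'⁻¹` turns the Hessian term `2 H^p_{ij} G'_{pc}` into `H^b_{ij}`, because `G'⁻¹` contracts
with `G'` to the identity. -/
theorem christoffel_transform_aux {ι : Type*} [Fintype ι] [DecidableEq ι] {G G' J : Matrix ι ι ℝ}
    (hG : IsUnit G.det) (hG'u : IsUnit G'.det) (h : G = J.transpose * G' * J)
    {H D D' : ι → ι → ι → ℝ}
    (hG' : ∀ a b, G' a b = G' b a) (hH : ∀ a i j, H a i j = H a j i)
    (hD : ∀ m i j, D m i j = (∑ a, ∑ b, (H a m i * J b j * G' a b + J a i * H b m j * G' a b)) +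
      ∑ a, ∑ b, ∑ c, J a i * J b j * J c m * D' c a b) (b i j : ι) :
    ∑ a, J b a * ((1 / 2) * ∑ l, G⁻¹ a l * (D i j l + D j i l - D l i j)) =
      ∑ m, ∑ n, ((1 / 2) * ∑ l, G'⁻¹ b l * (D' m n l + D' n m l - D' l m n)) * J m i * J n j +
        H b i j := by
  have hJ : ∀ b c, ∑ a, ∑ l, J b a * G⁻¹ a l * J c l = G'⁻¹ b c := by
    intro b c
    rw [← jacobian_mul_inv hG h, Matrix.mul_apply]
    simp only [Matrix.mul_apply, Matrix.transpose_apply, Finset.sum_mul]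
    exact Finset.sum_comm
  have hI : ∀ b c, ∑ q, G'⁻¹ b q * G' c q = if b = c then 1 else 0 := by
    intro b c
    have := congrFun (congrFun (Matrix.nonsing_inv_mul _ hG'u) b) c
    rw [Matrix.mul_apply, Matrix.one_apply] at this
    rw [← this]
    exact Finset.sum_congr rfl fun q _ => by rw [hG' c q]
  have hF : ∀ l, D i j l + D j i l - D l i j =
      ∑ c, J c l * (2 * (∑ p, H p i j * G' p c) +
        ∑ m, ∑ n, J m i * J n j * (D' m n c + D' n m c - D' c m n)) := by
    intro l
    rw [christoffelFirst_transform hG' hH hD]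
    simp only [mul_add, Finset.sum_add_distrib, Finset.mul_sum]
    congr 1
    · rw [Finset.sum_comm]
      exact Finset.sum_congr rfl fun a _ => Finset.sum_congr rfl fun b _ => by ring
    · rw [Finset.sum_congr rfl fun a _ => Finset.sum_comm, Finset.sum_comm]
      exact Finset.sum_congr rfl fun a _ => Finset.sum_congr rfl fun b _ =>
        Finset.sum_congr rfl fun c _ => by ring
  have e1 : ∀ X : ι → ℝ, ∑ a, J b a * ((1 / 2) * ∑ l, G⁻¹ a l * ∑ c, J c l * X c) =
      (1 / 2) * ∑ c, G'⁻¹ b c * X c := by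
    intro X
    simp only [← hJ b, Finset.mul_sum, Finset.sum_mul]
    rw [Finset.sum_congr rfl fun a _ => Finset.sum_comm, Finset.sum_comm]
    exact Finset.sum_congr rfl fun a _ => Finset.sum_congr rfl fun b _ =>
      Finset.sum_congr rfl fun c _ => by ring
  simp only [hF]
  rw [e1]
  simp only [mul_add, Finset.sum_add_distrib]
  rw [add_comm]
  congr 1
  · simp only [Finset.mul_sum, Finset.sum_mul]
    rw [Finset.sum_comm]
    refine Finset.sum_congr rfl fun m _ => ?_
    rw [Finset.sum_comm]
    exact Finset.sum_congr rfl fun b _ => Finset.sum_congr rfl fun c _ => by ring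
  · have : ∑ c, G'⁻¹ b c * (2 * ∑ p, H p i j * G' p c) =
        2 * ∑ p, H p i j * ∑ c, G'⁻¹ b c * G' p c := by
      simp only [Finset.mul_sum]
      rw [Finset.sum_comm]
      exact Finset.sum_congr rfl fun b _ => Finset.sum_congr rfl fun c _ => by ring
    rw [this]
    simp [hI]

theorem contDiffOn_det {Ω : Set (Eu d)} {n : ℕ} {A : Eu d → Matrix (Fin n) (Fin n) ℝ}
    (hA : ∀ i j, ContDiffOn ℝ ∞ (fun y => A y i j) Ω) : ContDiffOn ℝ ∞ (fun y => (A y).det) Ω := by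
  simp only [Matrix.det_apply']
  exact ContDiffOn.sum fun σ _ => contDiffOn_const.mul (contDiffOn_prod fun i _ => hA _ _)

/-- Cramer's rule: the entries of the adjugate are determinants of matrices with smooth entries. -/
theorem contDiffOn_inv {Ω : Set (Eu d)} {n : ℕ} {A : Eu d → Matrix (Fin n) (Fin n) ℝ}
    (hA : ∀ i j, ContDiffOn ℝ ∞ (fun y => A y i j) Ω) (hdet : ∀ y ∈ Ω, (A y).det ≠ 0)
    (i j : Fin n) : ContDiffOn ℝ ∞ (fun y => (A y)⁻¹ i j) Ω := by
  simp only [Matrix.inv_def, Matrix.smul_apply, Ring.inverse_eq_inv', smul_eq_mul,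
    Matrix.adjugate_apply]
  refine ((contDiffOn_det hA).inv hdet).mul (contDiffOn_det fun a b => ?_)
  by_cases h : a = j
  · subst h
    simp only [Matrix.updateRow_self]
    exact contDiffOn_const
  · simp only [Matrix.updateRow_ne h]
    exact hA a b

end ChristoffelAlgebra

/-! ### The metric and its Christoffel symbols under transition maps. -/

section Riemannian

variable {d : ℕ} {M : Type*} [TopologicalSpace M] {e e' : OpenPartialHomeomorph M (Eu d)}

/-- The coordinates in the chart `e` of the overlap of the charts `e` and `e'`. -/
def overlap (e e' : OpenPartialHomeomorph M (Eu d)) : Set (Eu d) := (e.symm ≫ₕ e').source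

theorem mem_overlap {y : Eu d} : y ∈ overlap e e' ↔ y ∈ e.target ∧ e.symm y ∈ e'.source := by
  simp [overlap]

theorem isOpen_overlap : IsOpen (overlap e e') := (e.symm ≫ₕ e').open_source

/-- The transition map from the chart `e` to the chart `e'`. -/
def transition (e e' : OpenPartialHomeomorph M (Eu d)) (y : Eu d) : Eu d := e' (e.symm y)

theorem transition_mem_overlap {y : Eu d} (hy : y ∈ overlap e e') :
    transition e e' y ∈ overlap e' e := by
  obtain ⟨h1, h2⟩ := mem_overlap.1 hy
  refine mem_overlap.2 ⟨e'.map_source h2, ?_⟩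
  rw [transition, e'.left_inv h2]
  exact e.map_target h1

theorem symm_transition {y : Eu d} (hy : y ∈ overlap e e') :
    e'.symm (transition e e' y) = e.symm y :=
  e'.left_inv (mem_overlap.1 hy).2

variable [ChartedSpace (Eu d) M]

variable (d M) in
/-- The smooth charts of `M`. -/
abbrev smoothCharts : Set (OpenPartialHomeomorph M (Eu d)) := IsManifold.maximalAtlas (𝓡 d) ∞ M

theorem mdifferentiable_of_mem_smoothCharts (he : e ∈ smoothCharts d M) :
    e.MDifferentiable (𝓡 d) (𝓡 d) :=
  ⟨(contMDiffOn_of_mem_maximalAtlas he).mdifferentiableOn (by norm_num),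
    (contMDiffOn_symm_of_mem_maximalAtlas he).mdifferentiableOn (by norm_num)⟩

theorem contDiffOn_transition (he : e ∈ smoothCharts d M) (he' : e' ∈ smoothCharts d M) :
    ContDiffOn ℝ ∞ (transition e e') (overlap e e') := by
  rw [← contMDiffOn_iff_contDiffOn]
  exact (contMDiffOn_of_mem_maximalAtlas he').comp
    ((contMDiffOn_symm_of_mem_maximalAtlas he).mono fun y hy => (mem_overlap.1 hy).1)
    fun y hy => (mem_overlap.1 hy).2

/-- Chain rule for `e.symm = e'.symm ∘ transition e e'`, which holds near `y`. -/
theorem coordVector_transition (he : e ∈ smoothCharts d M) (he' : e' ∈ smoothCharts d M) {y : Eu d}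
    (hy : y ∈ overlap e e') (i : Fin d) :
    (coordVector e y i : Eu d) = ∑ a, jacobian (transition e e') y a i •
      (coordVector e' (transition e e' y) a : Eu d) := by
  have hψ : DifferentiableAt ℝ (transition e e') y :=
    differentiableAt_of_contDiffOn isOpen_overlap (contDiffOn_transition he he') hy
  have h1 : mfderiv (𝓡 d) (𝓡 d) e.symm y =
      mfderiv (𝓡 d) (𝓡 d) (e'.symm ∘ transition e e') y := by
    refine Filter.EventuallyEq.mfderiv_eq ?_
    filter_upwards [isOpen_overlap.mem_nhds hy] with z hz
    exact (symm_transition hz).symm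
  have h2 := mfderiv_comp (I := 𝓡 d) (I' := 𝓡 d) (I'' := 𝓡 d) y (g := e'.symm)
    (f := transition e e')
    ((mdifferentiable_of_mem_smoothCharts he').symm.mdifferentiableAt
      (mem_overlap.1 (transition_mem_overlap hy)).1)
    hψ.mdifferentiableAt
  have h3 : (coordVector e y i : Eu d) =
      (mfderiv (𝓡 d) (𝓡 d) e'.symm (transition e e' y) : Eu d →L[ℝ] Eu d)
        (fderiv ℝ (transition e e') y (EuclideanSpace.single i 1)) := by
    rw [← mfderiv_eq_fderiv]
    exact (congrArg (fun L : Eu d →L[ℝ] Eu d => L (EuclideanSpace.single i 1)) (h1.trans h2))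
  have h4 : fderiv ℝ (transition e e') y (EuclideanSpace.single i 1) =
      ∑ a, jacobian (transition e e') y a i • EuclideanSpace.single a (1 : ℝ) := by
    ext b
    simp [jacobian, partialDeriv_apply hψ, Pi.single_apply]
  have h5 : ∀ (L : Eu d →L[ℝ] Eu d) (c : Fin d → ℝ),
      L (∑ a, c a • EuclideanSpace.single a (1 : ℝ)) =
        ∑ a, c a • L (EuclideanSpace.single a 1) := fun L c => by
    simp only [map_sum, map_smul]
  exact h3.trans ((congrArg _ h4).trans (h5 _ _))

variable [IsManifold (𝓡 d) ∞ M]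

theorem gram_transition (g : SmoothMetric d M) (he : e ∈ smoothCharts d M)
    (he' : e' ∈ smoothCharts d M) {y : Eu d} (hy : y ∈ overlap e e') :
    gram g e y = (jacobian (transition e e') y).transpose * gram g e' (transition e e' y) *
      jacobian (transition e e') y := by
  -- Every tangent space is `Eu d` by definition. Forgetting the base point in the types allows it
  -- to be rewritten and the bilinear form to be expanded.
  let b : M → Eu d →L[ℝ] Eu d →L[ℝ] ℝ := fun x => g.inner x
  let v : OpenPartialHomeomorph M (Eu d) → Eu d → Fin d → Eu d := fun e y i => coordVector e y i
  have hb : ∀ (e : OpenPartialHomeomorph M (Eu d)) (y : Eu d) i j, gram g e y i j =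
    b (e.symm y) (v e y i) (v e y j) := fun e y i j => rfl
  have hv : ∀ i, v e y i = ∑ a, jacobian (transition e e') y a i • v e' (transition e e' y) a :=
    coordVector_transition he he' hy
  ext i j
  rw [hb, hv i, hv j, Matrix.mul_apply, ← symm_transition hy]
  simp only [Matrix.mul_apply, hb, map_sum, map_smul, sum_apply, smul_apply, Finset.sum_mul,
    Matrix.transpose_apply, smul_eq_mul, Finset.mul_sum]
  exact Finset.sum_congr rfl fun x _ => Finset.sum_congr rfl fun z _ => by ring

theorem gram_symm (g : SmoothMetric d M) (e : OpenPartialHomeomorph M (Eu d)) (y : Eu d)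
    (i j : Fin d) : gram g e y i j = gram g e y j i :=
  g.symm _ _ _

/-- The quadratic form of the Gram matrix is the metric pulled back by the differential of `e.symm`,
which is injective. -/
theorem gram_posDef (g : SmoothMetric d M) (he : e ∈ smoothCharts d M) {y : Eu d}
    (hy : y ∈ e.target) : (gram g e y).PosDef := by
  refine Matrix.PosDef.of_dotProduct_mulVec_pos (by ext i j; exact gram_symm g e y j i) ?_
  intro x hx
  let b : Eu d →L[ℝ] Eu d →L[ℝ] ℝ := g.inner (e.symm y)
  let L : Eu d →L[ℝ] Eu d := mfderiv (𝓡 d) (𝓡 d) e.symm y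
  have hL : Function.Injective L :=
    (mdifferentiable_of_mem_smoothCharts he).symm.mfderiv_injective hy
  let v : Eu d := WithLp.toLp 2 x
  have hv : v ≠ 0 := by
    intro h
    apply hx
    ext i
    exact congrArg (fun w : Eu d => w i) h
  have hv' : v = ∑ i, x i • EuclideanSpace.single i (1 : ℝ) := by
    ext j
    simp [v, Pi.single_apply]
  have hpos : 0 < b (L v) (L v) := g.pos _ _ fun h => hv (hL (h.trans (map_zero L).symm))
  have hgram : ∀ i j, gram g e y i j =
    b (L (EuclideanSpace.single i 1)) (L (EuclideanSpace.single j 1)) := fun i j => rfl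
  refine hpos.trans_eq ?_
  rw [hv']
  simp only [map_sum, map_smul, sum_apply, smul_apply,
    smul_eq_mul, dotProduct, Matrix.mulVec, hgram, Finset.mul_sum, star_trivial]
  exact Finset.sum_congr rfl fun i _ => Finset.sum_congr rfl fun j _ => by
    rw [← hgram, ← hgram, gram_symm g e y j i]
    ring

theorem gram_det_ne_zero (g : SmoothMetric d M) (he : e ∈ smoothCharts d M) {y : Eu d}
    (hy : y ∈ e.target) : (gram g e y).det ≠ 0 :=
  (gram_posDef g he hy).det_pos.ne'

/-- The coordinate fields are the tangent map of `e.symm` applied to constant fields, hence smooth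
into the tangent bundle; the metric is a smooth section of bilinear forms. -/
theorem contDiffOn_gram (g : SmoothMetric d M) (he : e ∈ smoothCharts d M) (i j : Fin d) :
    ContDiffOn ℝ ∞ (fun y => gram g e y i j) e.target := by
  have : IsManifold (𝓡 d) 1 M := IsManifold.of_le (n := ∞) (by norm_num)
  have hsymm := contMDiffOn_symm_of_mem_maximalAtlas he
  have hv : ∀ i : Fin d, ContMDiffOn (𝓡 d) (𝓡 d).tangent ∞
      (fun y => (⟨e.symm y, coordVector e y i⟩ : TangentBundle (𝓡 d) M)) e.target := by
    intro i
    have h1 := hsymm.contMDiffOn_tangentMapWithin (m := ∞) (by norm_num)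
      e.open_target.uniqueMDiffOn
    have h2 : ContMDiff (𝓡 d) (𝓡 d).tangent ∞
        (fun y => (⟨y, (EuclideanSpace.single i (1 : ℝ) : Eu d)⟩ : TangentBundle (𝓡 d) (Eu d))) :=
      contMDiff_vectorSpace_iff_contDiff.2 contDiff_const
    refine (h1.comp h2.contMDiffOn fun y hy => hy).congr fun y hy => ?_
    simp only [Function.comp, tangentMapWithin]
    rw [mfderivWithin_of_isOpen e.open_target hy]
    rfl
  rw [← contMDiffOn_iff_contDiffOn]
  have h3 : ContMDiffOn (𝓡 d) ((𝓡 d).prod 𝓘(ℝ)) ∞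
      (fun y => Bundle.TotalSpace.mk' ℝ (E := Bundle.Trivial M ℝ) (e.symm y)
        (g.inner (e.symm y) (coordVector e y i) (coordVector e y j))) e.target := by
    apply ContMDiffOn.clm_bundle_apply₂ (F₁ := Eu d) (F₂ := Eu d)
    · exact g.contMDiff.comp_contMDiffOn hsymm
    · exact hv i
    · exact hv j
  intro y hy
  have := h3 y hy
  simp only [Bundle.contMDiffWithinAt_totalSpace] at this
  exact this.2

theorem contDiffOn_gram_inv (g : SmoothMetric d M) (he : e ∈ smoothCharts d M) (i j : Fin d) :
    ContDiffOn ℝ ∞ (fun y => (gram g e y)⁻¹ i j) e.target :=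
  contDiffOn_inv (contDiffOn_gram g he) (fun _ hy => gram_det_ne_zero g he hy) i j

theorem contDiffOn_christoffel (g : SmoothMetric d M) (he : e ∈ smoothCharts d M) (a i j : Fin d) :
    ContDiffOn ℝ ∞ (christoffel g e a i j) e.target := by
  have hD : ∀ i j l : Fin d,
      ContDiffOn ℝ ∞ (partialDeriv i fun z => gram g e z j l) e.target := fun i j l =>
    contDiffOn_partialDeriv e.open_target (contDiffOn_gram g he j l) i
  exact contDiffOn_const.mul (ContDiffOn.sum fun l _ => (contDiffOn_gram_inv g he a l).mul
    (((hD i j l).add (hD j i l)).sub (hD l i j)))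

/-- The derivative of `gram_transition` has exactly the shape that `christoffel_transform_aux` asks
for, and the second derivatives of the transition map commute. -/
theorem christoffel_transition (g : SmoothMetric d M) (he : e ∈ smoothCharts d M)
    (he' : e' ∈ smoothCharts d M) {y : Eu d} (hy : y ∈ overlap e e') (b i j : Fin d) :
    ∑ a, partialDeriv a (fun z => transition e e' z b) y * christoffel g e a i j y =
      ∑ m, ∑ n, christoffel g e' b m n (transition e e' y) *
        partialDeriv i (fun z => transition e e' z m) y *
        partialDeriv j (fun z => transition e e' z n) y +
      partialDeriv i (partialDeriv j fun z => transition e e' z b) y := by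
  set ψ := transition e e'
  have hψ := contDiffOn_transition he he'
  have hψb : ∀ b, ContDiffOn ℝ ∞ (fun z => ψ z b) (overlap e e') := fun b =>
    (contDiffOn_piLp 2).1 hψ b
  have hψy : ψ y ∈ e'.target := (mem_overlap.1 (transition_mem_overlap hy)).1
  have hψd : DifferentiableAt ℝ ψ y := differentiableAt_of_contDiffOn isOpen_overlap hψ hy
  have hJd : ∀ a i, DifferentiableAt ℝ (partialDeriv i fun z => ψ z a) y := fun a i =>
    differentiableAt_of_contDiffOn isOpen_overlap
      (contDiffOn_partialDeriv isOpen_overlap (hψb a) i) hy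
  have hGd : ∀ a b, DifferentiableAt ℝ (fun z => gram g e' z a b) (ψ y) := fun a b =>
    differentiableAt_of_contDiffOn e'.open_target (contDiffOn_gram g he' a b) hψy
  have hJJ : ∀ a i b j, DifferentiableAt ℝ (fun z => partialDeriv i (fun z => ψ z a) z *
      partialDeriv j (fun z => ψ z b) z) y := fun a i b j => (hJd a i).mul (hJd b j)
  have hGψ : ∀ a b, DifferentiableAt ℝ (fun z => gram g e' (ψ z) a b) y := fun a b =>
    (hGd a b).comp y hψd
  refine christoffel_transform_aux (G := gram g e y) (G' := gram g e' (ψ y)) (J := jacobian ψ y)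
    (H := fun a i j => partialDeriv i (partialDeriv j fun z => ψ z a) y)
    (D := fun m i j => partialDeriv m (fun z => gram g e z i j) y)
    (D' := fun m i j => partialDeriv m (fun z => gram g e' z i j) (ψ y))
    (isUnit_iff_ne_zero.2 (gram_det_ne_zero g he (mem_overlap.1 hy).1))
    (isUnit_iff_ne_zero.2 (gram_det_ne_zero g he' hψy))
    (gram_transition g he he' hy) (gram_symm g e' _)
    (fun a i j => partialDeriv_comm isOpen_overlap (hψb a) hy i j) (fun m i j => ?_) b i j
  have hG : EqOn (fun z => gram g e z i j) (fun z => ∑ a, ∑ b,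
      (partialDeriv i (fun z => ψ z a) z * partialDeriv j (fun z => ψ z b) z) *
        gram g e' (ψ z) a b) (overlap e e') := by
    intro z hz
    simp only [gram_transition g he he' hz, Matrix.mul_apply, Finset.sum_mul,
      Matrix.transpose_apply]
    rw [Finset.sum_comm]
    exact Finset.sum_congr rfl fun a _ => Finset.sum_congr rfl fun b _ => by
      simp only [jacobian, Matrix.of_apply, ψ]
      ring
  rw [partialDeriv_congr isOpen_overlap hG hy, partialDeriv_sum _ (fun a _ =>
    DifferentiableAt.fun_sum fun b _ => (hJJ a i b j).fun_mul (hGψ a b)),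
    ← Finset.sum_add_distrib]
  refine Finset.sum_congr rfl fun a _ => ?_
  rw [partialDeriv_sum _ (fun b _ => (hJJ a i b j).fun_mul (hGψ a b)),
    ← Finset.sum_add_distrib]
  refine Finset.sum_congr rfl fun b _ => ?_
  rw [partialDeriv_mul (hJJ a i b j) (hGψ a b), partialDeriv_mul (hJd a i) (hJd b j),
    partialDeriv_comp hψd (hGd a b), Finset.mul_sum, add_mul]
  simp only [jacobian, Matrix.of_apply]
  congr 1
  exact Finset.sum_congr rfl fun c _ => by ring

end Riemannian

end HestenesSobolev

end

noncomputable section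

namespace HestenesSobolev

/-! ### Norms of covariant tensors. -/

section TensorNorm

variable {d k : ℕ}

/-- The square of the norm of a covariant `k`-tensor `T` for the inverse metric `S`. -/
def tensorSq (S : Matrix (Fin d) (Fin d) ℝ) (T : (Fin k → Fin d) → ℝ) : ℝ :=
  ∑ I : Fin k → Fin d, ∑ J : Fin k → Fin d, (∏ m, S (I m) (J m)) * T I * T J

theorem sum_sum_prod (f : Fin k → Fin d → Fin d → ℝ) :
    ∑ I : Fin k → Fin d, ∑ J : Fin k → Fin d, ∏ m, f m (I m) (J m) = ∏ m, ∑ i, ∑ j, f m i j := by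
  rw [Finset.prod_univ_sum, Fintype.piFinset_univ]
  refine Finset.sum_congr rfl fun I _ => ?_
  rw [Finset.prod_univ_sum, Fintype.piFinset_univ]

theorem sum_prod (f : Fin k → Fin d → ℝ) :
    ∑ I : Fin k → Fin d, ∏ m, f m (I m) = ∏ m, ∑ i, f m i := by
  rw [Finset.prod_univ_sum, Fintype.piFinset_univ]

/-- The components of `T` in another basis. -/
def tensorMap (B : Matrix (Fin d) (Fin d) ℝ) (T : (Fin k → Fin d) → ℝ) (C : Fin k → Fin d) : ℝ :=
  ∑ I : Fin k → Fin d, (∏ m, B (C m) (I m)) * T I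

/-- Changing the inverse metric by `J` amounts to changing the tensor by the transpose of `J`; this
is what makes the norm independent of the chart. -/
theorem tensorSq_mul_mul_transpose (S J : Matrix (Fin d) (Fin d) ℝ) (T : (Fin k → Fin d) → ℝ) :
    tensorSq (J * S * J.transpose) T = tensorSq S (tensorMap J.transpose T) := by
  have h1 : ∀ A B : Fin k → Fin d, ∏ m, (J * S * J.transpose) (A m) (B m) =
      ∑ I : Fin k → Fin d, ∑ I' : Fin k → Fin d,
        ∏ m, (J (A m) (I m) * S (I m) (I' m) * J (B m) (I' m)) := by
    intro A B
    rw [sum_sum_prod fun m i j => J (A m) i * S i j * J (B m) j]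
    refine Finset.prod_congr rfl fun m _ => ?_
    simp only [Matrix.mul_apply, Matrix.transpose_apply, Finset.sum_mul]
    exact Finset.sum_comm
  unfold tensorSq tensorMap
  simp only [h1, Finset.prod_mul_distrib, Finset.sum_mul, Finset.mul_sum, Matrix.transpose_apply]
  rw [Finset.sum_congr rfl fun A _ => Finset.sum_comm]
  rw [Finset.sum_comm]
  refine Finset.sum_congr rfl fun I _ => ?_
  rw [Finset.sum_congr rfl fun A _ => Finset.sum_comm]
  rw [Finset.sum_comm]
  refine Finset.sum_congr rfl fun I' _ => ?_
  rw [Finset.sum_comm]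
  refine Finset.sum_congr rfl fun A _ => Finset.sum_congr rfl fun B _ => ?_
  ring

theorem tensorSq_one (T : (Fin k → Fin d) → ℝ) : tensorSq 1 T = ∑ I, T I ^ 2 := by
  unfold tensorSq
  refine Finset.sum_congr rfl fun I _ => ?_
  rw [Finset.sum_eq_single I]
  · simp [sq]
  · intro J _ hJ
    obtain ⟨m, hm⟩ := Function.ne_iff.1 hJ
    rw [Finset.prod_eq_zero (Finset.mem_univ m)]
    · ring
    · rw [Matrix.one_apply_ne hm.symm]
  · simp

theorem tensorSq_transpose_mul (B : Matrix (Fin d) (Fin d) ℝ) (T : (Fin k → Fin d) → ℝ) :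
    tensorSq (B.transpose * B) T = ∑ C, tensorMap B T C ^ 2 := by
  have := tensorSq_mul_mul_transpose 1 B.transpose T
  rw [Matrix.mul_one, Matrix.transpose_transpose, tensorSq_one] at this
  exact this

open scoped MatrixOrder in
-- With such a `B` the tensor norm becomes the Euclidean norm of `tensorMap B T`, so the triangle
-- inequality and Cauchy–Schwarz are available.
theorem exists_eq_transpose_mul {S : Matrix (Fin d) (Fin d) ℝ} (hS : S.PosDef) :
    ∃ B : Matrix (Fin d) (Fin d) ℝ, S = B.transpose * B := by
  obtain ⟨B, hB⟩ := CStarAlgebra.nonneg_iff_eq_star_mul_self.1 hS.posSemidef.nonneg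
  exact ⟨B, by rw [hB, Matrix.star_eq_conjTranspose, Matrix.conjTranspose_eq_transpose_of_trivial]⟩

theorem sqrt_tensorSq_eq_norm (B : Matrix (Fin d) (Fin d) ℝ) (T : (Fin k → Fin d) → ℝ) :
    Real.sqrt (tensorSq (B.transpose * B) T) =
      ‖(WithLp.toLp 2 (tensorMap B T) : EuclideanSpace ℝ (Fin k → Fin d))‖ := by
  rw [tensorSq_transpose_mul, EuclideanSpace.norm_eq]
  simp

theorem tensorMap_add (B : Matrix (Fin d) (Fin d) ℝ) (T T' : (Fin k → Fin d) → ℝ) :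
    tensorMap B (T + T') = tensorMap B T + tensorMap B T' := by
  ext C
  simp [tensorMap, mul_add, Finset.sum_add_distrib]

theorem sqrt_tensorSq_add_le {S : Matrix (Fin d) (Fin d) ℝ} (hS : S.PosDef)
    (T T' : (Fin k → Fin d) → ℝ) :
    Real.sqrt (tensorSq S (T + T')) ≤ Real.sqrt (tensorSq S T) + Real.sqrt (tensorSq S T') := by
  obtain ⟨B, rfl⟩ := exists_eq_transpose_mul hS
  simp only [sqrt_tensorSq_eq_norm, tensorMap_add, WithLp.toLp_add]
  exact norm_add_le _ _

theorem sqrt_tensorSq_const_mul (S : Matrix (Fin d) (Fin d) ℝ) (c : ℝ)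
    (T : (Fin k → Fin d) → ℝ) :
    Real.sqrt (tensorSq S fun I => c * T I) = |c| * Real.sqrt (tensorSq S T) := by
  have : tensorSq S (fun I => c * T I) = c ^ 2 * tensorSq S T := by
    unfold tensorSq
    simp only [Finset.mul_sum]
    exact Finset.sum_congr rfl fun I _ => Finset.sum_congr rfl fun J _ => by ring
  rw [this, Real.sqrt_mul (sq_nonneg c), Real.sqrt_sq_eq_abs]

/-- Write `G⁻¹ = Bᵀ B`. Inverting `B` in each slot recovers `T I` from `tensorMap B T`, and
Cauchy–Schwarz applies; the squared coefficients sum to the product of the diagonal entries of `G`,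
since `G = B⁻¹ (B⁻¹)ᵀ`. -/
theorem abs_le_sqrt_tensorSq_inv {G : Matrix (Fin d) (Fin d) ℝ} (hG : G.PosDef)
    (T : (Fin k → Fin d) → ℝ) (I : Fin k → Fin d) :
    |T I| ≤ Real.sqrt (∏ m, G (I m) (I m)) * Real.sqrt (tensorSq G⁻¹ T) := by
  obtain ⟨B, hB⟩ := exists_eq_transpose_mul hG.inv
  have hu : IsUnit G.det := isUnit_iff_ne_zero.2 hG.det_pos.ne'
  have hE : G = B⁻¹ * B⁻¹.transpose := by
    rw [← Matrix.nonsing_inv_nonsing_inv G hu, hB, Matrix.mul_inv_rev, Matrix.transpose_nonsing_inv]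
  have hBu : IsUnit B.det := by
    have h1 : IsUnit (G⁻¹).det := Matrix.isUnit_nonsing_inv_det G hu
    rw [hB, Matrix.det_mul] at h1
    exact isUnit_of_mul_isUnit_right h1
  have hT : T I = ∑ C : Fin k → Fin d, (∏ m, B⁻¹ (I m) (C m)) * tensorMap B T C := by
    unfold tensorMap
    simp only [Finset.mul_sum]
    rw [Finset.sum_comm]
    have h2 : ∀ J : Fin k → Fin d, ∑ C : Fin k → Fin d, (∏ m, B⁻¹ (I m) (C m)) *
        ((∏ m, B (C m) (J m)) * T J) = if I = J then T J else 0 := by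
      intro J
      simp only [← mul_assoc, ← Finset.prod_mul_distrib]
      rw [← Finset.sum_mul, sum_prod fun m c => B⁻¹ (I m) c * B c (J m)]
      have h3 : ∀ m, ∑ c, B⁻¹ (I m) c * B c (J m) = if I m = J m then 1 else 0 := by
        intro m
        rw [← Matrix.mul_apply, Matrix.nonsing_inv_mul _ hBu, Matrix.one_apply]
      simp only [h3]
      by_cases hIJ : I = J
      · simp [hIJ]
      · obtain ⟨m, hm⟩ := Function.ne_iff.1 hIJ
        rw [Finset.prod_eq_zero (Finset.mem_univ m) (by simp [hm])]
        simp [hIJ]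
    simp [h2]
  have hsq : ∏ m, G (I m) (I m) = ∑ C : Fin k → Fin d, (∏ m, B⁻¹ (I m) (C m)) ^ 2 := by
    simp only [← Finset.prod_pow]
    rw [sum_prod fun m c => B⁻¹ (I m) c ^ 2]
    refine Finset.prod_congr rfl fun m _ => ?_
    conv_lhs => rw [hE, Matrix.mul_apply]
    exact Finset.sum_congr rfl fun c _ => by rw [Matrix.transpose_apply, sq]
  rw [hT, hB, tensorSq_transpose_mul, hsq, ← Real.sqrt_mul (by positivity)]
  exact Real.abs_le_sqrt (Finset.sum_mul_sq_le_sq_mul_sq _ _ _)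

theorem sqrt_tensorSq_le {S : Matrix (Fin d) (Fin d) ℝ} {K : ℝ} (hK : 0 ≤ K)
    (hS : ∀ i j, |S i j| ≤ K) (T : (Fin k → Fin d) → ℝ) :
    Real.sqrt (tensorSq S T) ≤ Real.sqrt (K ^ k) * ∑ I, |T I| := by
  have h1 : tensorSq S T ≤ K ^ k * (∑ I, |T I|) ^ 2 := by
    unfold tensorSq
    rw [sq, Finset.sum_mul_sum, Finset.mul_sum]
    refine Finset.sum_le_sum fun I _ => ?_
    rw [Finset.mul_sum]
    refine Finset.sum_le_sum fun J _ => ?_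
    refine (le_abs_self _).trans ?_
    rw [abs_mul, abs_mul, mul_assoc, Finset.abs_prod]
    refine mul_le_mul_of_nonneg_right ?_ (by positivity)
    refine (Finset.prod_le_prod (fun _ _ => abs_nonneg _) fun m _ => hS (I m) (J m)).trans ?_
    simp
  calc Real.sqrt (tensorSq S T) ≤ Real.sqrt (K ^ k * (∑ I, |T I|) ^ 2) := Real.sqrt_le_sqrt h1
    _ = _ := by
      rw [Real.sqrt_mul (by positivity), Real.sqrt_sq (by positivity)]

end TensorNorm

/-! ### The pointwise norm of the covariant derivatives of a function. -/

section Riemannian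

variable {d : ℕ} {M : Type*} [TopologicalSpace M] [ChartedSpace (Eu d) M]
  {e e' : OpenPartialHomeomorph M (Eu d)}

theorem contDiffOn_comp_symm (he : e ∈ smoothCharts d M) {f : M → ℝ}
    (hf : ContMDiff (𝓡 d) 𝓘(ℝ) ∞ f) : ContDiffOn ℝ ∞ (fun y => f (e.symm y)) e.target := by
  rw [← contMDiffOn_iff_contDiffOn]
  exact hf.comp_contMDiffOn (contMDiffOn_symm_of_mem_maximalAtlas he)

variable [IsManifold (𝓡 d) ∞ M]

theorem covDeriv_eq_covD (g : SmoothMetric d M) (e : OpenPartialHomeomorph M (Eu d)) (f : M → ℝ)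
    (k : ℕ) (I : Fin k → Fin d) :
    covDeriv g e f k I = covD (christoffel g e) (fun y => f (e.symm y)) k I := by
  induction k with
  | zero => rfl
  | succ k ih =>
    ext y
    simp only [covDeriv, covD, ih]

/-- The pointwise norm of the `k`-th covariant derivative, computed in the chart `e`. -/
def covNormAt (g : SmoothMetric d M) (e : OpenPartialHomeomorph M (Eu d)) (k : ℕ) (f : M → ℝ)
    (x : M) : ℝ :=
  Real.sqrt (tensorSq (gram g e (e x))⁻¹ fun I : Fin k → Fin d => covDeriv g e f k I (e x))

theorem covNorm_eq_covNormAt (g : SmoothMetric d M) (k : ℕ) (f : M → ℝ) (x : M) :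
    covNorm g k f x = covNormAt g (chartAt (Eu d) x) k f x :=
  rfl

/-- The components transform by the Jacobian (`covD_transform` with `christoffel_transition`) and
the inverse metric by its inverse law, so the contraction is unchanged. -/
theorem covNormAt_indep (g : SmoothMetric d M) (he : e ∈ smoothCharts d M)
    (he' : e' ∈ smoothCharts d M) {x : M} (hx : x ∈ e.source) (hx' : x ∈ e'.source) {f : M → ℝ}
    (hf : ContMDiff (𝓡 d) 𝓘(ℝ) ∞ f) (k : ℕ) :
    covNormAt g e k f x = covNormAt g e' k f x := by
  have hy : e x ∈ overlap e e' := mem_overlap.2 ⟨e.map_source hx, by rwa [e.left_inv hx]⟩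
  have hψ : transition e e' (e x) = e' x := by rw [transition, e.left_inv hx]
  have hT := covD_transform (k := k) isOpen_overlap e'.open_target
    (contDiffOn_transition he he')
    (fun y hy => (mem_overlap.1 (transition_mem_overlap hy)).1) (contDiffOn_christoffel g he')
    (fun y hy => christoffel_transition g he he' hy) (contDiffOn_comp_symm he' hf)
    (h := fun y => f (e.symm y)) (fun y hy => congrArg f (symm_transition hy).symm)
  unfold covNormAt
  congr 1
  have h1 := jacobian_mul_inv (isUnit_iff_ne_zero.2 (gram_det_ne_zero g he (e.map_source hx)))
    (gram_transition g he he' hy)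
  rw [← hψ, ← h1, tensorSq_mul_mul_transpose]
  congr 1
  ext I
  rw [covDeriv_eq_covD, hT I hy]
  simp only [tensorMap, covDeriv_eq_covD, jacobian, Matrix.transpose_apply, Matrix.of_apply]

theorem covNorm_eq_of_mem (g : SmoothMetric d M) (he : e ∈ smoothCharts d M) {x : M}
    (hx : x ∈ e.source) {f : M → ℝ} (hf : ContMDiff (𝓡 d) 𝓘(ℝ) ∞ f) (k : ℕ) :
    covNorm g k f x = covNormAt g e k f x :=
  covNormAt_indep g (IsManifold.chart_mem_maximalAtlas x) he (mem_chart_source _ x) hx hf k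

/-- The definition uses a different chart at each point; independence of the chart allows a single
one near a given point. -/
theorem continuous_covNorm (g : SmoothMetric d M) {f : M → ℝ} (hf : ContMDiff (𝓡 d) 𝓘(ℝ) ∞ f)
    (k : ℕ) : Continuous (covNorm g k f) := by
  refine continuous_iff_continuousAt.2 fun x => ?_
  set e := chartAt (Eu d) x
  have he : e ∈ smoothCharts d M := IsManifold.chart_mem_maximalAtlas x
  have hx : x ∈ e.source := mem_chart_source _ x
  have h1 : covNorm g k f =ᶠ[𝓝 x] covNormAt g e k f := by
    filter_upwards [e.open_source.mem_nhds hx] with z hz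
    exact covNorm_eq_of_mem g he hz hf k
  refine ContinuousAt.congr ?_ h1.symm
  have hec : ContinuousAt e x := e.continuousAt hx
  have hcomp : ∀ u : Eu d → ℝ, ContDiffOn ℝ ∞ u e.target → ContinuousAt (fun z => u (e z)) x :=
    fun u hu => ContinuousAt.comp (f := e) (g := u)
      (hu.continuousOn.continuousAt (e.open_target.mem_nhds (e.map_source hx))) hec
  have hcov : ∀ I : Fin k → Fin d, ContinuousAt (fun z => covDeriv g e f k I (e z)) x := by
    intro I
    refine hcomp _ ?_
    rw [covDeriv_eq_covD]
    exact contDiffOn_covD e.open_target (contDiffOn_christoffel g he) (contDiffOn_comp_symm he hf) k I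
  refine ContinuousAt.comp (f := fun z => tensorSq (gram g e (e z))⁻¹
    fun I : Fin k → Fin d => covDeriv g e f k I (e z)) Real.continuous_sqrt.continuousAt ?_
  unfold tensorSq
  refine tendsto_finsetSum _ fun I _ => tendsto_finsetSum _ fun J _ => ?_
  exact ((tendsto_finsetProd _ fun m _ =>
    hcomp (fun y => (gram g e y)⁻¹ (I m) (J m)) (contDiffOn_gram_inv g he _ _)).mul (hcov I)).mul
      (hcov J)

theorem covNorm_nonneg (g : SmoothMetric d M) (k : ℕ) (f : M → ℝ) (x : M) : 0 ≤ covNorm g k f x :=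
  Real.sqrt_nonneg _

theorem covNorm_add_le (g : SmoothMetric d M) {f f' : M → ℝ} (hf : ContMDiff (𝓡 d) 𝓘(ℝ) ∞ f)
    (hf' : ContMDiff (𝓡 d) 𝓘(ℝ) ∞ f') (k : ℕ) (x : M) :
    covNorm g k (f + f') x ≤ covNorm g k f x + covNorm g k f' x := by
  have he : chartAt (Eu d) x ∈ smoothCharts d M := IsManifold.chart_mem_maximalAtlas x
  have hx := mem_chart_target (Eu d) x
  simp only [covNorm_eq_covNormAt, covNormAt]
  refine le_trans (le_of_eq ?_) (sqrt_tensorSq_add_le (gram_posDef g he hx).inv _ _)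
  congr 2
  ext I
  simp only [covDeriv_eq_covD, Pi.add_apply]
  exact covD_add (chartAt (Eu d) x).open_target (contDiffOn_christoffel g he)
    (contDiffOn_comp_symm he hf) (contDiffOn_comp_symm he hf') k I hx

theorem covNorm_const_smul (g : SmoothMetric d M) {f : M → ℝ} (hf : ContMDiff (𝓡 d) 𝓘(ℝ) ∞ f)
    (c : ℝ) (k : ℕ) (x : M) : covNorm g k (c • f) x = |c| * covNorm g k f x := by
  have he : chartAt (Eu d) x ∈ smoothCharts d M := IsManifold.chart_mem_maximalAtlas x
  simp only [covNorm_eq_covNormAt, covNormAt]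
  rw [← sqrt_tensorSq_const_mul]
  congr 2
  ext I
  simp only [covDeriv_eq_covD, Pi.smul_apply, smul_eq_mul]
  exact covD_const_mul (chartAt (Eu d) x).open_target (contDiffOn_christoffel g he)
    (contDiffOn_comp_symm he hf) c k I (mem_chart_target _ x)

theorem covNorm_zero (g : SmoothMetric d M) (k : ℕ) (x : M) : covNorm g k 0 x = 0 := by
  have := covNorm_const_smul g (f := (0 : M → ℝ)) contMDiff_const 0 k x
  simpa using this

theorem covDeriv_congr (g : SmoothMetric d M) {O : Set M} (hO : IsOpen O) {f f' : M → ℝ}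
    (h : EqOn f f' O) {x : M} (hxO : x ∈ O) (hx : x ∈ e.source) (k : ℕ) (I : Fin k → Fin d) :
    covDeriv g e f k I (e x) = covDeriv g e f' k I (e x) := by
  simp only [covDeriv_eq_covD]
  refine covD_congr (Ω := e.target ∩ e.symm ⁻¹' O) (e.isOpen_inter_preimage_symm hO)
    (fun y hy => h hy.2) k I ⟨e.map_source hx, ?_⟩
  rwa [mem_preimage, e.left_inv hx]

theorem covNorm_congr (g : SmoothMetric d M) {f f' : M → ℝ} {x : M} (h : f =ᶠ[𝓝 x] f') (k : ℕ) :
    covNorm g k f x = covNorm g k f' x := by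
  obtain ⟨O, hO, hOo, hxO⟩ := eventually_nhds_iff.1 h
  simp only [covNorm_eq_covNormAt, covNormAt]
  congr 2
  ext I
  exact covDeriv_congr g hOo (fun z hz => hO z hz) hxO (mem_chart_source _ x) k I

theorem eventually_covNormAt_le (g : SmoothMetric d M) (he : e ∈ smoothCharts d M) {x : M}
    (hx : x ∈ e.source) (k : ℕ) :
    ∃ C : ℝ, 0 ≤ C ∧ ∀ᶠ z in 𝓝 x, ∀ f : M → ℝ,
      covNormAt g e k f z ≤ C * ∑ I : Fin k → Fin d, |covDeriv g e f k I (e z)| := by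
  -- The summand `1` makes the bound at `x` strict, so that it persists in a neighbourhood.
  set K : ℝ := 1 + ∑ i, ∑ j, |(gram g e (e x))⁻¹ i j|
  have hK : ∀ i j, |(gram g e (e x))⁻¹ i j| < K := fun i j => by
    have h1 : |(gram g e (e x))⁻¹ i j| ≤ ∑ j, |(gram g e (e x))⁻¹ i j| :=
      Finset.single_le_sum (f := fun j => |(gram g e (e x))⁻¹ i j|)
        (fun _ _ => abs_nonneg _) (Finset.mem_univ j)
    have h2 : ∑ j, |(gram g e (e x))⁻¹ i j| ≤ ∑ i, ∑ j, |(gram g e (e x))⁻¹ i j| :=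
      Finset.single_le_sum (f := fun i => ∑ j, |(gram g e (e x))⁻¹ i j|)
        (fun _ _ => Finset.sum_nonneg fun _ _ => abs_nonneg _) (Finset.mem_univ i)
    linarith
  have hK0 : 0 ≤ K := by positivity
  refine ⟨Real.sqrt (K ^ k), Real.sqrt_nonneg _, ?_⟩
  have hev : ∀ᶠ z in 𝓝 x, ∀ i j, |(gram g e (e z))⁻¹ i j| < K := by
    refine eventually_all.2 fun i => eventually_all.2 fun j => ?_
    have : ContinuousAt (fun z => (gram g e (e z))⁻¹ i j) x :=
      ContinuousAt.comp (f := e) (g := fun y => (gram g e y)⁻¹ i j)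
        ((contDiffOn_gram_inv g he i j).continuousOn.continuousAt
          (e.open_target.mem_nhds (e.map_source hx))) (e.continuousAt hx)
    exact this.abs.eventually_lt continuousAt_const (hK i j)
  filter_upwards [hev] with z hz f
  exact sqrt_tensorSq_le hK0 (fun i j => (hz i j).le) _

/-- Together with `eventually_covNormAt_le`, this makes the invariant norm locally equivalent to the
sum of the absolute values of the components, uniformly in `f`. -/
theorem eventually_abs_covDeriv_le (g : SmoothMetric d M) (he : e ∈ smoothCharts d M) {x : M}
    (hx : x ∈ e.source) (k : ℕ) (I : Fin k → Fin d) :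
    ∃ C : ℝ, 0 ≤ C ∧ ∀ᶠ z in 𝓝 x, ∀ f : M → ℝ,
      |covDeriv g e f k I (e z)| ≤ C * covNormAt g e k f z := by
  refine ⟨Real.sqrt (∏ m, gram g e (e x) (I m) (I m) + 1), Real.sqrt_nonneg _, ?_⟩
  have hc : ContinuousAt (fun z => ∏ m, gram g e (e z) (I m) (I m)) x :=
    tendsto_finsetProd _ fun m _ => ContinuousAt.comp (f := e)
      (g := fun y => gram g e y (I m) (I m))
      ((contDiffOn_gram g he (I m) (I m)).continuousOn.continuousAt
        (e.open_target.mem_nhds (e.map_source hx))) (e.continuousAt hx)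
  filter_upwards [hc.eventually_lt continuousAt_const (lt_add_one _), e.open_source.mem_nhds hx]
    with z hz hze f
  refine (abs_le_sqrt_tensorSq_inv (gram_posDef g he (e.map_source hze))
    (fun I => covDeriv g e f k I (e z)) I).trans ?_
  exact mul_le_mul_of_nonneg_right (Real.sqrt_le_sqrt hz.le) (Real.sqrt_nonneg _)

end Riemannian

end HestenesSobolev

end

noncomputable section

namespace HestenesSobolev

/-! ### The Riemannian measure in charts and under diffeomorphisms. -/

section Measure

theorem measurableSet_inter_preimage {α β : Type*} [TopologicalSpace α] [MeasurableSpace α]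
    [OpensMeasurableSpace α] [TopologicalSpace β] [MeasurableSpace β] [BorelSpace β] {f : α → β}
    {s : Set α} (hf : ContinuousOn f s) (hs : MeasurableSet s) {A : Set β} (hA : MeasurableSet A) :
    MeasurableSet (s ∩ f ⁻¹' A) := by
  rw [← Subtype.image_preimage_coe]
  exact hs.subtype_image (hf.domRestrict.measurable hA)

variable {d : ℕ}

theorem det_fderiv_eq_det_jacobian {ψ : Eu d → Eu d} {y : Eu d} (hψ : DifferentiableAt ℝ ψ y) :
    (fderiv ℝ ψ y).det = (jacobian ψ y).det := by
  rw [ContinuousLinearMap.det, ← LinearMap.det_toMatrix (EuclideanSpace.basisFun (Fin d) ℝ).toBasis]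
  congr 1
  ext b i
  rw [LinearMap.toMatrix_apply]
  simp [jacobian, partialDeriv_apply hψ]

theorem measurableSet_target_inter {M : Type*} [TopologicalSpace M]
    [MeasurableSpace M] [BorelSpace M] (e : OpenPartialHomeomorph M (Eu d)) {A : Set M}
    (hA : MeasurableSet A) : MeasurableSet (e.target ∩ e.symm ⁻¹' A) :=
  measurableSet_inter_preimage e.continuousOn_symm e.open_target.measurableSet hA

theorem measure_eq_tsum_inter {M ι : Type*} [MeasurableSpace M] [Countable ι]
    {B : ι → Set M} (μ : Measure M)
    (hB : ∀ n, MeasurableSet (B n)) (hd : Pairwise (Function.onFun Disjoint B))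
    (hc : ⋃ n, B n = univ) {A : Set M} (hA : MeasurableSet A) : μ A = ∑' n, μ (A ∩ B n) := by
  rw [← measure_iUnion (fun i j hij => (hd hij).mono inter_subset_right inter_subset_right)
    fun n => hA.inter (hB n), ← inter_iUnion, hc, inter_univ]

variable {M : Type*} [TopologicalSpace M] [ChartedSpace (Eu d) M] [IsManifold (𝓡 d) ∞ M]
  {e e' : OpenPartialHomeomorph M (Eu d)}

/-- The density of the Riemannian measure in the chart `e`. -/
def chartDensity (g : SmoothMetric d M) (e : OpenPartialHomeomorph M (Eu d)) (y : Eu d) : ℝ :=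
  Real.sqrt (gram g e y).det

theorem continuousOn_chartDensity (g : SmoothMetric d M) (he : e ∈ smoothCharts d M) :
    ContinuousOn (chartDensity g e) e.target :=
  (contDiffOn_det (contDiffOn_gram g he)).continuousOn.sqrt

theorem chartDensity_pos (g : SmoothMetric d M) (he : e ∈ smoothCharts d M) {y : Eu d}
    (hy : y ∈ e.target) : 0 < chartDensity g e y :=
  Real.sqrt_pos.2 (gram_posDef g he hy).det_pos

theorem chartDensity_transition (g : SmoothMetric d M) (he : e ∈ smoothCharts d M)
    (he' : e' ∈ smoothCharts d M) {y : Eu d} (hy : y ∈ overlap e e') :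
    chartDensity g e y = |(fderiv ℝ (transition e e') y).det| *
      chartDensity g e' (transition e e' y) := by
  rw [det_fderiv_eq_det_jacobian (differentiableAt_of_contDiffOn isOpen_overlap
    (contDiffOn_transition he he') hy)]
  unfold chartDensity
  rw [gram_transition g he he' hy, Matrix.det_mul, Matrix.det_mul, Matrix.det_transpose,
    mul_right_comm, ← sq, Real.sqrt_mul (sq_nonneg _), Real.sqrt_sq_eq_abs]

/-- The chart in which `Φ` becomes the identity map; it lies in the maximal atlas, which is why
charts outside the given atlas are admitted throughout. -/
theorem trans_mem_smoothCharts {Φ : OpenPartialHomeomorph M M}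
    (hΦ : ContMDiffOn (𝓡 d) (𝓡 d) ∞ Φ Φ.source)
    (hΦ' : ContMDiffOn (𝓡 d) (𝓡 d) ∞ Φ.symm Φ.target) (he : e ∈ smoothCharts d M) :
    Φ ≫ₕ e ∈ smoothCharts d M := by
  refine OpenPartialHomeomorph.mem_maximalAtlas_of_contMDiffOn _ ?_ ?_
  · refine (contMDiffOn_of_mem_maximalAtlas he).comp (hΦ.mono ?_) ?_
    · simp
    · intro x hx
      simp at hx
      exact hx.2
  · refine hΦ'.comp ((contMDiffOn_symm_of_mem_maximalAtlas he).mono ?_) ?_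
    · simp
    · intro y hy
      simp at hy
      exact hy.2

variable [MeasurableSpace M]

theorem chartMeasure_le_riemannianMeasure_of_mem_atlas (g : SmoothMetric d M)
    (he : e ∈ atlas (Eu d) M) : chartMeasure g e ≤ riemannianMeasure g :=
  le_iSup₂ (f := fun e (_ : e ∈ atlas (Eu d) M) => chartMeasure g e) e he

variable [BorelSpace M]

theorem chartMeasure_apply (g : SmoothMetric d M) (e : OpenPartialHomeomorph M (Eu d))
    {A : Set M} (hA : MeasurableSet A) :
    chartMeasure g e A =
      ∫⁻ y in e.target ∩ e.symm ⁻¹' A, ENNReal.ofReal (chartDensity g e y) := by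
  have hm : AEMeasurable e.symm ((volume.restrict e.target).withDensity
      fun y => ENNReal.ofReal (Real.sqrt (gram g e y).det)) :=
    (e.continuousOn_symm.aemeasurable e.open_target.measurableSet).mono_ac
      (withDensity_absolutelyContinuous _ _)
  -- Off `e.target` nothing is known about `e.symm`, so the preimage is only null measurable for the
  -- restricted measure.
  have hnull : NullMeasurableSet (e.symm ⁻¹' A) (volume.restrict e.target) :=
    (e.continuousOn_symm.aemeasurable e.open_target.measurableSet).nullMeasurableSet_preimage hA
  rw [chartMeasure, Measure.map_apply_of_aemeasurable hm hA, withDensity_apply',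
    Measure.restrict_restrict₀ hnull, inter_comm]
  rfl

theorem chartMeasure_inter_source (g : SmoothMetric d M) (e : OpenPartialHomeomorph M (Eu d))
    {A : Set M} (hA : MeasurableSet A) :
    chartMeasure g e (A ∩ e.source) = chartMeasure g e A := by
  rw [chartMeasure_apply g e hA, chartMeasure_apply g e (hA.inter e.open_source.measurableSet)]
  congr 2
  ext y
  simp only [mem_inter_iff, mem_preimage]
  exact ⟨fun h => ⟨h.1, h.2.1⟩, fun h => ⟨h.1, h.2, e.map_target h.1⟩⟩

/-- Change of variables along the transition map; its Jacobian determinant is the quotient of the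
two densities. -/
theorem chartMeasure_eq_of_subset (g : SmoothMetric d M) (he : e ∈ smoothCharts d M)
    (he' : e' ∈ smoothCharts d M) {A : Set M} (hA : MeasurableSet A) (hAe : A ⊆ e.source)
    (hAe' : A ⊆ e'.source) : chartMeasure g e A = chartMeasure g e' A := by
  rw [chartMeasure_apply g e hA, chartMeasure_apply g e' hA]
  set S := e.target ∩ e.symm ⁻¹' A
  have hS : S ⊆ overlap e e' := fun y hy => mem_overlap.2 ⟨hy.1, hAe' hy.2⟩
  have himage : e'.target ∩ e'.symm ⁻¹' A = transition e e' '' S := by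
    ext z
    constructor
    · rintro ⟨hz, hzA⟩
      have hz' : z ∈ overlap e' e := mem_overlap.2 ⟨hz, hAe hzA⟩
      refine ⟨transition e' e z, ⟨(mem_overlap.1 (transition_mem_overlap hz')).1, ?_⟩, ?_⟩
      · rwa [mem_preimage, symm_transition hz']
      · rw [transition, symm_transition hz', e'.right_inv hz]
    · rintro ⟨y, hy, rfl⟩
      refine ⟨(mem_overlap.1 (transition_mem_overlap (hS hy))).1, ?_⟩
      rw [mem_preimage, symm_transition (hS hy)]
      exact hy.2
  have hinj : InjOn (transition e e') S := by
    intro y hy z hz h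
    have : e.symm y = e.symm z := by rw [← symm_transition (hS hy), h, symm_transition (hS hz)]
    rw [← e.right_inv hy.1, this, e.right_inv hz.1]
  rw [himage, lintegral_image_eq_lintegral_abs_det_fderiv_mul volume
    (measurableSet_target_inter e hA) (fun y hy => (differentiableAt_of_contDiffOn isOpen_overlap
      (contDiffOn_transition he he') (hS hy)).hasFDerivAt.hasFDerivWithinAt) hinj]
  refine setLIntegral_congr_fun (measurableSet_target_inter e hA) fun y hy => ?_
  rw [← ENNReal.ofReal_mul (abs_nonneg _), ← chartDensity_transition g he he' (hS hy)]

variable [SecondCountableTopology M]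

/-- By second countability, `M` is a countable disjoint union of measurable pieces of chart domains.
On each piece all chart measures agree where they are supported, so the supremum is neither larger
nor smaller than the measure glued from the pieces. -/
theorem riemannianMeasure_apply_of_subset (g : SmoothMetric d M) (he : e ∈ smoothCharts d M)
    {A : Set M} (hA : MeasurableSet A) (hAe : A ⊆ e.source) :
    riemannianMeasure g A = chartMeasure g e A := by
  rcases isEmpty_or_nonempty M with hM | hM
  · rw [Set.eq_empty_of_isEmpty A, measure_empty, measure_empty]
  obtain ⟨s, hs, hsu⟩ := TopologicalSpace.countable_cover_nhds
    (f := fun x : M => (chartAt (Eu d) x).source) fun x => chart_source_mem_nhds _ x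
  have hsn : s.Nonempty := by
    rw [nonempty_iff_ne_empty]
    rintro rfl
    rw [biUnion_empty] at hsu
    exact empty_ne_univ hsu
  obtain ⟨u, hu⟩ := hs.exists_eq_range hsn
  set E : ℕ → OpenPartialHomeomorph M (Eu d) := fun n => chartAt (Eu d) (u n)
  have hE : ∀ n, E n ∈ atlas (Eu d) M := fun n => chart_mem_atlas _ _
  have hE' : ∀ n, E n ∈ smoothCharts d M := fun n => IsManifold.chart_mem_maximalAtlas _
  set B : ℕ → Set M := disjointed fun n => (E n).source
  have hB : ∀ n, MeasurableSet (B n) := fun n =>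
    MeasurableSet.disjointed (fun n => (E n).open_source.measurableSet) n
  have hBE : ∀ n, B n ⊆ (E n).source := fun n => disjointed_subset _ n
  have hBd : Pairwise (Function.onFun Disjoint B) := disjoint_disjointed _
  have hBu : ⋃ n, B n = univ := by
    rw [iUnion_disjointed, ← hsu, hu, biUnion_range]
  -- The glued measure dominates every chart measure of the atlas, hence their supremum.
  set m : Measure M := Measure.sum fun n => (chartMeasure g (E n)).restrict (B n)
  have hm : ∀ {A}, MeasurableSet A → m A = ∑' n, chartMeasure g (E n) (A ∩ B n) := by
    intro A hA
    rw [Measure.sum_apply _ hA]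
    exact tsum_congr fun n => Measure.restrict_apply hA
  have hle : riemannianMeasure g ≤ m := by
    refine iSup₂_le fun e he => Measure.le_iff.2 fun A hA => ?_
    rw [hm hA, measure_eq_tsum_inter _ hB hBd hBu hA]
    refine ENNReal.tsum_le_tsum fun n => ?_
    rw [← chartMeasure_inter_source g e (hA.inter (hB n)), chartMeasure_eq_of_subset g
      (IsManifold.subset_maximalAtlas he) (hE' n)
      ((hA.inter (hB n)).inter e.open_source.measurableSet) inter_subset_right
      (inter_subset_left.trans (inter_subset_right.trans (hBE n)))]
    exact measure_mono inter_subset_left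
  have heq : ∀ n, chartMeasure g (E n) (A ∩ B n) = chartMeasure g e (A ∩ B n) := fun n =>
    chartMeasure_eq_of_subset g (hE' n) he (hA.inter (hB n)) (inter_subset_right.trans (hBE n))
      (inter_subset_left.trans hAe)
  refine le_antisymm ?_ ?_
  · refine (hle A).trans ?_
    rw [hm hA, measure_eq_tsum_inter (chartMeasure g e) hB hBd hBu hA]
    exact ENNReal.tsum_le_tsum fun n => (heq n).le
  · rw [measure_eq_tsum_inter (chartMeasure g e) hB hBd hBu hA,
      measure_eq_tsum_inter (riemannianMeasure g) hB hBd hBu hA]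
    refine ENNReal.tsum_le_tsum fun n => ?_
    rw [← heq n]
    exact chartMeasure_le_riemannianMeasure_of_mem_atlas g (hE n) _

theorem isLocallyFiniteMeasure_riemannianMeasure (g : SmoothMetric d M) :
    IsLocallyFiniteMeasure (riemannianMeasure g) := by
  refine ⟨fun x => ?_⟩
  set e := chartAt (Eu d) x
  have he : e ∈ smoothCharts d M := IsManifold.chart_mem_maximalAtlas x
  have hx : x ∈ e.source := mem_chart_source _ x
  have hcont : ContinuousAt (chartDensity g e) (e x) :=
    (continuousOn_chartDensity g he).continuousAt (e.open_target.mem_nhds (e.map_source hx))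
  have hev : ∀ᶠ y in 𝓝 (e x), chartDensity g e y < chartDensity g e (e x) + 1 ∧
      y ∈ Metric.ball (e x) 1 :=
    (hcont.eventually_lt continuousAt_const (lt_add_one _)).and (Metric.ball_mem_nhds _ one_pos)
  obtain ⟨O, hO, hOo, hxO⟩ := eventually_nhds_iff.1 hev
  have hN : IsOpen (e.source ∩ e ⁻¹' O) := e.isOpen_inter_preimage hOo
  refine ⟨e.source ∩ e ⁻¹' O, hN.mem_nhds ⟨hx, hxO⟩, ?_⟩
  rw [riemannianMeasure_apply_of_subset g he hN.measurableSet inter_subset_left,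
    chartMeasure_apply g e hN.measurableSet]
  have hsub : e.target ∩ e.symm ⁻¹' (e.source ∩ e ⁻¹' O) ⊆ O := by
    rintro y ⟨hy, -, hy'⟩
    rwa [mem_preimage, e.right_inv hy] at hy'
  calc ∫⁻ y in e.target ∩ e.symm ⁻¹' (e.source ∩ e ⁻¹' O), ENNReal.ofReal (chartDensity g e y)
      ≤ ∫⁻ y in O, ENNReal.ofReal (chartDensity g e y) := lintegral_mono_set hsub
    _ ≤ ∫⁻ _ in O, ENNReal.ofReal (chartDensity g e (e x) + 1) :=
        setLIntegral_mono' hOo.measurableSet fun y hy => ENNReal.ofReal_le_ofReal (hO y hy).1.le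
    _ = ENNReal.ofReal (chartDensity g e (e x) + 1) * volume O := by
        rw [setLIntegral_const]
    _ < ⊤ := ENNReal.mul_lt_top ENNReal.ofReal_lt_top
        ((measure_mono fun y hy => (hO y hy).2).trans_lt measure_ball_lt_top)

variable {Φ : OpenPartialHomeomorph M M}

/-- In the charts `Φ ≫ₕ e'` and `e'` both sides are integrals over the same kind of coordinate set,
with two positive continuous densities whose quotient is bounded near the given point. -/
theorem exists_nhds_riemannianMeasure_preimage_le (g : SmoothMetric d M)
    (hΦ : ContMDiffOn (𝓡 d) (𝓡 d) ∞ Φ Φ.source)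
    (hΦ' : ContMDiffOn (𝓡 d) (𝓡 d) ∞ Φ.symm Φ.target) {x : M} (hx : x ∈ Φ.source) :
    ∃ N ∈ 𝓝 x, ∃ C : ℝ≥0, ∀ A, MeasurableSet A →
      riemannianMeasure g (N ∩ Φ ⁻¹' A) ≤ C * riemannianMeasure g A := by
  set e' := chartAt (Eu d) (Φ x)
  have he' : e' ∈ smoothCharts d M := IsManifold.chart_mem_maximalAtlas _
  have hx' : Φ x ∈ e'.source := mem_chart_source _ _
  set e := Φ ≫ₕ e' with he_def
  have he : e ∈ smoothCharts d M := trans_mem_smoothCharts hΦ hΦ' he'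
  have hxe : x ∈ e.source := by simp [he_def, hx, hx']
  have htarget : e.target ⊆ e'.target := fun y hy => by
    simp [he_def] at hy
    exact hy.1
  have hsource : e.source ⊆ Φ.source := fun y hy => by
    simp [he_def] at hy
    exact hy.1
  have hy : e x ∈ e.target := e.map_source hxe
  have hpos := chartDensity_pos g he' (htarget hy)
  set c : ℝ := chartDensity g e (e x) / chartDensity g e' (e x) + 1
  have hc : 0 ≤ c := add_nonneg (div_nonneg (Real.sqrt_nonneg _) (Real.sqrt_nonneg _)) zero_le_one
  have hlt : chartDensity g e (e x) < c * chartDensity g e' (e x) := by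
    rw [add_mul, div_mul_cancel₀ _ hpos.ne']
    linarith
  have hev : ∀ᶠ y in 𝓝 (e x), chartDensity g e y < c * chartDensity g e' y :=
    ((continuousOn_chartDensity g he).continuousAt (e.open_target.mem_nhds hy)).eventually_lt
      (continuousAt_const.mul ((continuousOn_chartDensity g he').continuousAt
        (e'.open_target.mem_nhds (htarget hy)))) hlt
  obtain ⟨O, hO, hOo, hxO⟩ := eventually_nhds_iff.1 hev
  have hN : IsOpen (e.source ∩ e ⁻¹' O) := e.isOpen_inter_preimage hOo
  refine ⟨e.source ∩ e ⁻¹' O, hN.mem_nhds ⟨hxe, hxO⟩, ⟨c, hc⟩, fun A hA => ?_⟩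
  have hmeas : MeasurableSet (e.source ∩ e ⁻¹' O ∩ Φ ⁻¹' A) :=
    measurableSet_inter_preimage (Φ.continuousOn.mono (inter_subset_left.trans hsource))
      hN.measurableSet hA
  rw [riemannianMeasure_apply_of_subset g he hmeas (inter_subset_left.trans inter_subset_left),
    chartMeasure_apply g e hmeas]
  have hsub : e.target ∩ e.symm ⁻¹' (e.source ∩ e ⁻¹' O ∩ Φ ⁻¹' A) ⊆
      O ∩ (e'.target ∩ e'.symm ⁻¹' (A ∩ e'.source)) := by
    rintro y ⟨hy, ⟨-, hyO⟩, hyA⟩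
    rw [mem_preimage, e.right_inv hy] at hyO
    have hyt : e'.symm y ∈ Φ.target := by
      simp [he_def] at hy
      exact hy.2
    refine ⟨hyO, htarget hy, ?_, e'.map_target (htarget hy)⟩
    simpa [he_def, Φ.right_inv hyt] using hyA
  have hA' : MeasurableSet (A ∩ e'.source) := hA.inter e'.open_source.measurableSet
  calc ∫⁻ y in e.target ∩ e.symm ⁻¹' (e.source ∩ e ⁻¹' O ∩ Φ ⁻¹' A),
        ENNReal.ofReal (chartDensity g e y)
      ≤ ∫⁻ y in e.target ∩ e.symm ⁻¹' (e.source ∩ e ⁻¹' O ∩ Φ ⁻¹' A),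
        ENNReal.ofReal c * ENNReal.ofReal (chartDensity g e' y) := by
        refine setLIntegral_mono' (measurableSet_target_inter e hmeas) fun y hy => ?_
        rw [← ENNReal.ofReal_mul hc]
        exact ENNReal.ofReal_le_ofReal (hO y (hsub hy).1).le
    _ ≤ ∫⁻ y in e'.target ∩ e'.symm ⁻¹' (A ∩ e'.source),
        ENNReal.ofReal c * ENNReal.ofReal (chartDensity g e' y) :=
        lintegral_mono_set (hsub.trans inter_subset_right)
    _ = ENNReal.ofReal c * riemannianMeasure g (A ∩ e'.source) := by
        rw [lintegral_const_mul' _ _ ENNReal.ofReal_ne_top,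
          riemannianMeasure_apply_of_subset g he' hA' inter_subset_right,
          chartMeasure_apply g e' hA']
    _ ≤ ENNReal.ofReal c * riemannianMeasure g A := by gcongr; exact inter_subset_left
    _ = _ := by
        congr 1
        exact ENNReal.ofReal_eq_coe_nnreal hc

theorem exists_riemannianMeasure_preimage_le (g : SmoothMetric d M)
    (hΦ : ContMDiffOn (𝓡 d) (𝓡 d) ∞ Φ Φ.source)
    (hΦ' : ContMDiffOn (𝓡 d) (𝓡 d) ∞ Φ.symm Φ.target) {K : Set M} (hK : IsCompact K)
    (hKΦ : K ⊆ Φ.source) :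
    ∃ C : ℝ≥0, ∀ A, MeasurableSet A →
      riemannianMeasure g (K ∩ Φ ⁻¹' A) ≤ C * riemannianMeasure g A := by
  refine hK.induction_on (p := fun K => ∃ C : ℝ≥0, ∀ A, MeasurableSet A →
      riemannianMeasure g (K ∩ Φ ⁻¹' A) ≤ C * riemannianMeasure g A)
    ⟨0, fun A _ => by simp⟩ ?_ ?_ ?_
  · rintro s t hst ⟨C, hC⟩
    exact ⟨C, fun A hA => (measure_mono (inter_subset_inter_left _ hst)).trans (hC A hA)⟩
  · rintro s t ⟨C, hC⟩ ⟨C', hC'⟩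
    refine ⟨C + C', fun A hA => ?_⟩
    rw [union_inter_distrib_right, ENNReal.coe_add, add_mul]
    exact (measure_union_le _ _).trans (add_le_add (hC A hA) (hC' A hA))
  · intro x hx
    obtain ⟨N, hN, C, hC⟩ := exists_nhds_riemannianMeasure_preimage_le g hΦ hΦ' (hKΦ hx)
    exact ⟨N, mem_nhdsWithin_of_mem_nhds hN, C, hC⟩

/-- Domination of the push-forward also gives absolute continuity, so that composition with `Φ`
respects almost everywhere equality and measurability. -/
theorem exists_map_restrict_le (g : SmoothMetric d M)
    (hΦ : ContMDiffOn (𝓡 d) (𝓡 d) ∞ Φ Φ.source)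
    (hΦ' : ContMDiffOn (𝓡 d) (𝓡 d) ∞ Φ.symm Φ.target) {K : Set M} (hK : IsCompact K)
    (hKm : MeasurableSet K) (hKΦ : K ⊆ Φ.source) :
    AEMeasurable Φ ((riemannianMeasure g).restrict K) ∧
    ∃ C : ℝ≥0, ((riemannianMeasure g).restrict K).map Φ ≤ C • riemannianMeasure g := by
  have hm : AEMeasurable Φ ((riemannianMeasure g).restrict K) :=
    (Φ.continuousOn.mono hKΦ).aemeasurable hKm
  obtain ⟨C, hC⟩ := exists_riemannianMeasure_preimage_le g hΦ hΦ' hK hKΦ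
  refine ⟨hm, C, Measure.le_iff.2 fun A hA => ?_⟩
  rw [Measure.map_apply_of_aemeasurable hm hA, Measure.restrict_apply₀
    (hm.nullMeasurableSet_preimage hA), inter_comm]
  exact hC A hA

/-- Pull-back by a diffeomorphism is bounded in `L^q` on compact sets. -/
theorem exists_eLpNorm_indicator_comp_le (g : SmoothMetric d M)
    (hΦ : ContMDiffOn (𝓡 d) (𝓡 d) ∞ Φ Φ.source)
    (hΦ' : ContMDiffOn (𝓡 d) (𝓡 d) ∞ Φ.symm Φ.target) {K : Set M} (hK : IsCompact K)
    (hKm : MeasurableSet K) (hKΦ : K ⊆ Φ.source) {q : ℝ≥0∞} (hq : q ≠ ⊤) :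
    ∃ C : ℝ≥0, ∀ F : M → ℝ, AEStronglyMeasurable F (riemannianMeasure g) →
      AEStronglyMeasurable (K.indicator fun x => F (Φ x)) (riemannianMeasure g) ∧
      eLpNorm (K.indicator fun x => F (Φ x)) q (riemannianMeasure g) ≤
        C * eLpNorm F q (riemannianMeasure g) := by
  obtain ⟨hm, C, hC⟩ := exists_map_restrict_le g hΦ hΦ' hK hKm hKΦ
  have hac : ((riemannianMeasure g).restrict K).map Φ ≪ riemannianMeasure g :=
    (Measure.absolutelyContinuous_of_le hC).trans (Measure.smul_absolutelyContinuous)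
  refine ⟨C ^ (1 / q).toReal, fun F hF => ?_⟩
  have hF' : AEStronglyMeasurable F (((riemannianMeasure g).restrict K).map Φ) := hF.mono_ac hac
  refine ⟨(aestronglyMeasurable_indicator_iff hKm).2 (hF'.comp_aemeasurable hm), ?_⟩
  rw [eLpNorm_indicator_eq_eLpNorm_restrict hKm]
  calc eLpNorm (F ∘ Φ) q ((riemannianMeasure g).restrict K)
      = eLpNorm F q (((riemannianMeasure g).restrict K).map Φ) := (eLpNorm_map_measure hF' hm).symm
    _ ≤ eLpNorm F q (C • riemannianMeasure g) := eLpNorm_mono_measure F hC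
    _ = _ := by
      rw [eLpNorm_smul_measure_of_ne_top' hq]
      simp [ENNReal.smul_def]

end Measure

end HestenesSobolev

end

noncomputable section

namespace HestenesSobolev

/-! ### Simple `H`-operators on smooth functions and on `L^q`. -/

section SimpleH

variable {d : ℕ} {M : Type*} [TopologicalSpace M] [ChartedSpace (Eu d) M] (H : SimpleH d M)

namespace SimpleH

theorem apply_of_notMem_tsupport (f : M → ℝ) {x : M} (hx : x ∉ tsupport H.φ) :
    H.apply f x = 0 := by
  unfold apply
  split_ifs
  · rw [image_eq_zero_of_notMem_tsupport hx, zero_mul]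
  · rfl

theorem apply_of_mem_source (f : M → ℝ) {x : M} (hx : x ∈ H.Φ.source) :
    H.apply f x = H.φ x * f (H.Φ x) :=
  if_pos hx

theorem apply_eq_mul_indicator (f : M → ℝ) (x : M) :
    H.apply f x = H.φ x * (tsupport H.φ).indicator (fun x => f (H.Φ x)) x := by
  by_cases hx : x ∈ tsupport H.φ
  · rw [indicator_of_mem hx, H.apply_of_mem_source f (H.supp_φ hx)]
  · rw [H.apply_of_notMem_tsupport f hx, indicator_of_notMem hx, mul_zero]

theorem apply_eventuallyEq_zero (f : M → ℝ) {x : M} (hx : x ∉ tsupport H.φ) :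
    H.apply f =ᶠ[𝓝 x] 0 := by
  filter_upwards [(isClosed_tsupport H.φ).isOpen_compl.mem_nhds hx] with z hz
  exact H.apply_of_notMem_tsupport f hz

theorem apply_add (f f' : M → ℝ) : H.apply (f + f') = H.apply f + H.apply f' := by
  ext x
  simp only [apply, Pi.add_apply]
  split_ifs <;> ring

theorem apply_sub (f f' : M → ℝ) : H.apply (f - f') = H.apply f - H.apply f' := by
  ext x
  simp only [apply, Pi.sub_apply]
  split_ifs <;> ring

theorem apply_const_smul (c : ℝ) (f : M → ℝ) : H.apply (c • f) = c • H.apply f := by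
  ext x
  simp only [apply, Pi.smul_apply, smul_eq_mul]
  split_ifs <;> ring

theorem contMDiff_apply {f : M → ℝ} (hf : ContMDiff (𝓡 d) 𝓘(ℝ) ∞ f) :
    ContMDiff (𝓡 d) 𝓘(ℝ) ∞ (H.apply f) := by
  intro x
  by_cases hx : x ∈ H.Φ.source
  · have h1 : ContMDiffAt (𝓡 d) 𝓘(ℝ) ∞ (fun z => H.φ z * f (H.Φ z)) x :=
      (H.smooth_φ x).mul ((hf _).comp x (H.smooth_Φ.contMDiffAt (H.Φ.open_source.mem_nhds hx)))
    refine h1.congr_of_eventuallyEq ?_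
    filter_upwards [H.Φ.open_source.mem_nhds hx] with z hz
    exact H.apply_of_mem_source f hz
  · exact (contMDiffAt_const (c := (0 : ℝ))).congr_of_eventuallyEq
      (H.apply_eventuallyEq_zero f fun h => hx (H.supp_φ h))

theorem exists_abs_φ_le : ∃ B : ℝ≥0, ∀ x, |H.φ x| ≤ B := by
  obtain ⟨B, hB⟩ := H.compact_φ.exists_bound_of_continuous H.smooth_φ.continuous
  exact ⟨⟨max B 0, le_max_right _ _⟩, fun x => (hB x).trans (le_max_left _ _)⟩

section Multiplication

variable (d M) in
/-- Multiplication by a test function as a simple `H`-operator. -/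
def ofTestFun (η : TestFun d M) : SimpleH d M where
  φ := η.1
  Φ := OpenPartialHomeomorph.refl M
  smooth_φ := η.2.1
  compact_φ := η.2.2
  supp_φ := subset_univ _
  smooth_Φ := contMDiffOn_id
  smooth_symm := contMDiffOn_id

theorem ofTestFun_apply (η : TestFun d M) (f : M → ℝ) :
    (ofTestFun d M η).apply f = fun x => η.1 x * f x := by
  ext x
  exact apply_of_mem_source _ f (mem_univ x)

end Multiplication

end SimpleH

variable [IsManifold (𝓡 d) ∞ M] (g : SmoothMetric d M)

/-- In the chart `e = Φ ≫ₕ e'`, the components of `∇^k (H u)` are covariant derivatives of `φ u` for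
the connection of `e`; these are bounded by the derivatives of `u` for the connection of `e'`, which
are the components of `∇^j u` at `Φ z`. -/
theorem SimpleH.eventually_covNorm_apply_le {x : M} (hx : x ∈ H.Φ.source) (k : ℕ) :
    ∃ C : ℝ, 0 ≤ C ∧ ∀ᶠ z in 𝓝 x, ∀ u : M → ℝ, ContMDiff (𝓡 d) 𝓘(ℝ) ∞ u →
      covNorm g k (H.apply u) z ≤ C * ∑ j ∈ Finset.range (k + 1), covNorm g j u (H.Φ z) := by
  set e' := chartAt (Eu d) (H.Φ x)
  have he' : e' ∈ smoothCharts d M := IsManifold.chart_mem_maximalAtlas _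
  have hx' : H.Φ x ∈ e'.source := mem_chart_source _ _
  set e := H.Φ ≫ₕ e' with he_def
  have he : e ∈ smoothCharts d M := trans_mem_smoothCharts H.smooth_Φ H.smooth_symm he'
  have hxe : x ∈ e.source := by simp [he_def, hx, hx']
  have htarget : e.target ⊆ e'.target := fun y hy => by
    simp [he_def] at hy
    exact hy.1
  -- In these coordinates the diffeomorphism disappears and only multiplication by `φ` is left.
  have hmul : ∀ u : M → ℝ, EqOn (fun y => H.apply u (e.symm y))
      (fun y => H.φ (e.symm y) * u (e'.symm y)) e.target := by
    intro u y hy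
    have hys : e.symm y ∈ H.Φ.source ∧ e'.symm y ∈ H.Φ.target := by
      have := e.map_target hy
      simp [he_def] at this hy ⊢
      exact ⟨this.1, hy.2⟩
    dsimp only
    rw [H.apply_of_mem_source u hys.1]
    congr 2
    simp [he_def, H.Φ.right_inv hys.2]
  have hφ : ContDiffOn ℝ ∞ (fun y => H.φ (e.symm y)) e.target := contDiffOn_comp_symm he H.smooth_φ
  obtain ⟨C₁, hC₁, h₁⟩ := eventually_covNormAt_le g he hxe k
  -- Two connections on the single open set `e.target`: that of the metric at `e.symm y`, and that
  -- of the metric at the image point `e'.symm y`.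
  choose C₂ hC₂ h₂ using fun I : Fin k → Fin d =>
    exists_bound_covD_mul e.open_target (contDiffOn_christoffel g he)
      (fun a i j => (contDiffOn_christoffel g he' a i j).mono htarget) hφ k I (e.map_source hxe)
  choose C₃ hC₃ h₃ using fun (j : ℕ) (J : Fin j → Fin d) =>
    eventually_abs_covDeriv_le g he' hx' j J
  refine ⟨C₁ * ∑ I, C₂ I * ∑ j ∈ Finset.range (k + 1), ∑ J, C₃ j J,
    mul_nonneg hC₁ (Finset.sum_nonneg fun I _ => mul_nonneg (hC₂ I)
      (Finset.sum_nonneg fun j _ => Finset.sum_nonneg fun J _ => hC₃ j J)), ?_⟩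
  have h₂' : ∀ᶠ z in 𝓝 x, ∀ (I : Fin k → Fin d) (h : Eu d → ℝ), ContDiffOn ℝ ∞ h e.target → _ :=
    eventually_all.2 fun I => (e.continuousAt hxe).eventually (h₂ I)
  have h₃' : ∀ᶠ z in 𝓝 x, ∀ j ∈ Finset.range (k + 1), ∀ (J : Fin j → Fin d) (f : M → ℝ),
      |covDeriv g e' f j J (e' (H.Φ z))| ≤ C₃ j J * covNormAt g e' j f (H.Φ z) :=
    (Filter.eventually_all_finset _).2 fun j _ => eventually_all.2 fun J =>
      (H.Φ.continuousAt hx).eventually (h₃ j J)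
  filter_upwards [h₁, h₂', h₃', e.open_source.mem_nhds hxe] with z hz₁ hz₂ hz₃ hz u hu
  have hzΦ : H.Φ z ∈ e'.source := by
    simp [he_def] at hz
    exact hz.2
  have hez : e z = e' (H.Φ z) := rfl
  set S := ∑ j ∈ Finset.range (k + 1), covNorm g j u (H.Φ z)
  have hu' : ContDiffOn ℝ ∞ (fun y => u (e'.symm y)) e.target :=
    (contDiffOn_comp_symm he' hu).mono htarget
  have hterm : ∀ I : Fin k → Fin d, |covDeriv g e (H.apply u) k I (e z)| ≤
      (C₂ I * ∑ j ∈ Finset.range (k + 1), ∑ J, C₃ j J) * S := by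
    intro I
    rw [covDeriv_eq_covD, covD_congr e.open_target (hmul u) k I (e.map_source hz)]
    refine (hz₂ I _ hu').trans ?_
    rw [mul_assoc]
    refine mul_le_mul_of_nonneg_left ?_ (hC₂ I)
    rw [Finset.sum_mul]
    refine Finset.sum_le_sum fun j hj => ?_
    rw [Finset.sum_mul]
    refine Finset.sum_le_sum fun J _ => ?_
    have h4 := hz₃ j hj J u
    rw [covDeriv_eq_covD, ← hez, ← covNorm_eq_of_mem g he' hzΦ hu j] at h4
    refine h4.trans (mul_le_mul_of_nonneg_left ?_ (hC₃ j J))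
    exact Finset.single_le_sum (f := fun j => covNorm g j u (H.Φ z))
      (fun _ _ => covNorm_nonneg g _ _ _) hj
  rw [covNorm_eq_of_mem g he hz (H.contMDiff_apply hu) k]
  refine (hz₁ _).trans ?_
  rw [mul_assoc, Finset.sum_mul]
  exact mul_le_mul_of_nonneg_left (Finset.sum_le_sum fun I _ => hterm I) hC₁

theorem SimpleH.exists_covNorm_apply_le (k : ℕ) :
    ∃ C : ℝ≥0, ∀ x ∈ tsupport H.φ, ∀ u : M → ℝ, ContMDiff (𝓡 d) 𝓘(ℝ) ∞ u →
      covNorm g k (H.apply u) x ≤ C * ∑ j ∈ Finset.range (k + 1), covNorm g j u (H.Φ x) := by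
  have hnn : ∀ (u : M → ℝ) (x : M), 0 ≤ ∑ j ∈ Finset.range (k + 1), covNorm g j u (H.Φ x) :=
    fun u x => Finset.sum_nonneg fun j _ => covNorm_nonneg g _ _ _
  refine IsCompact.induction_on (s := tsupport H.φ) H.compact_φ
    (p := fun K => ∃ C : ℝ≥0, ∀ x ∈ K, ∀ u : M → ℝ, ContMDiff (𝓡 d) 𝓘(ℝ) ∞ u →
      covNorm g k (H.apply u) x ≤ C * ∑ j ∈ Finset.range (k + 1), covNorm g j u (H.Φ x))
    ⟨0, fun x hx => hx.elim⟩ ?_ ?_ ?_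
  · rintro s t hst ⟨C, hC⟩
    exact ⟨C, fun x hx => hC x (hst hx)⟩
  · rintro s t ⟨C, hC⟩ ⟨C', hC'⟩
    refine ⟨C + C', fun x hx u hu => ?_⟩
    rw [NNReal.coe_add, add_mul]
    rcases hx with hx | hx
    · exact (hC x hx u hu).trans (le_add_of_nonneg_right (mul_nonneg C'.2 (hnn u x)))
    · exact (hC' x hx u hu).trans (le_add_of_nonneg_left (mul_nonneg C.2 (hnn u x)))
  · intro x hx
    obtain ⟨C, hC, h⟩ := H.eventually_covNorm_apply_le g (H.supp_φ hx) k
    exact ⟨_, mem_nhdsWithin_of_mem_nhds h, ⟨C, hC⟩, fun z hz u hu => hz u hu⟩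

variable [MeasurableSpace M]

theorem smoothSobolevNorm_const_smul (r : ℕ) (p : ℝ≥0∞) {f : M → ℝ}
    (hf : ContMDiff (𝓡 d) 𝓘(ℝ) ∞ f) (c : ℝ) :
    smoothSobolevNorm g r p (c • f) = ‖c‖ₑ * smoothSobolevNorm g r p f := by
  unfold smoothSobolevNorm
  rw [Finset.mul_sum]
  refine Finset.sum_congr rfl fun k _ => ?_
  have : covNorm g k (c • f) = |c| • covNorm g k f := by
    ext x
    exact covNorm_const_smul g hf c k x
  rw [this, eLpNorm_const_smul]
  simp

variable [BorelSpace M]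

theorem eLpNorm_covNorm_add_le {p : ℝ≥0∞} (hp : 1 ≤ p) {f f' : M → ℝ}
    (hf : ContMDiff (𝓡 d) 𝓘(ℝ) ∞ f) (hf' : ContMDiff (𝓡 d) 𝓘(ℝ) ∞ f') (k : ℕ) :
    eLpNorm (covNorm g k (f + f')) p (riemannianMeasure g) ≤
      eLpNorm (covNorm g k f) p (riemannianMeasure g) +
        eLpNorm (covNorm g k f') p (riemannianMeasure g) := by
  refine le_trans (eLpNorm_mono_real (g := covNorm g k f + covNorm g k f') fun x => ?_)
    (eLpNorm_add_le (continuous_covNorm g hf k).aestronglyMeasurable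
      (continuous_covNorm g hf' k).aestronglyMeasurable hp)
  rw [Real.norm_eq_abs, abs_of_nonneg (covNorm_nonneg g k _ x)]
  exact covNorm_add_le g hf hf' k x

theorem smoothSobolevNorm_add_le (r : ℕ) {p : ℝ≥0∞} (hp : 1 ≤ p) {f f' : M → ℝ}
    (hf : ContMDiff (𝓡 d) 𝓘(ℝ) ∞ f) (hf' : ContMDiff (𝓡 d) 𝓘(ℝ) ∞ f') :
    smoothSobolevNorm g r p (f + f') ≤ smoothSobolevNorm g r p f + smoothSobolevNorm g r p f' := by
  unfold smoothSobolevNorm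
  rw [← Finset.sum_add_distrib]
  exact Finset.sum_le_sum fun k _ => eLpNorm_covNorm_add_le g hp hf hf' k

variable [SecondCountableTopology M]

/-- Simple `H`-operators are bounded in `L^q`. -/
theorem SimpleH.exists_eLpNorm_apply_le {q : ℝ≥0∞} (hq : q ≠ ⊤) :
    ∃ C : ℝ≥0, ∀ F : M → ℝ, AEStronglyMeasurable F (riemannianMeasure g) →
      AEStronglyMeasurable (H.apply F) (riemannianMeasure g) ∧
      eLpNorm (H.apply F) q (riemannianMeasure g) ≤ C * eLpNorm F q (riemannianMeasure g) := by
  obtain ⟨C, hC⟩ := exists_eLpNorm_indicator_comp_le g H.smooth_Φ H.smooth_symm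
    (K := tsupport H.φ) H.compact_φ (isClosed_tsupport _).measurableSet H.supp_φ hq
  obtain ⟨B, hB⟩ := H.exists_abs_φ_le
  refine ⟨B * C, fun F hF => ?_⟩
  obtain ⟨h1, h2⟩ := hC F hF
  have heq : H.apply F = fun x => H.φ x * (tsupport H.φ).indicator (fun x => F (H.Φ x)) x :=
    funext (H.apply_eq_mul_indicator F)
  refine ⟨heq ▸ H.smooth_φ.continuous.aestronglyMeasurable.mul h1, ?_⟩
  calc eLpNorm (H.apply F) q (riemannianMeasure g)
      ≤ B • eLpNorm ((tsupport H.φ).indicator fun x => F (H.Φ x)) q (riemannianMeasure g) := by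
        refine eLpNorm_le_nnreal_smul_eLpNorm_of_ae_le_mul (ae_of_all _ fun x => ?_) q
        rw [heq, nnnorm_mul]
        gcongr
        exact hB x
    _ ≤ B • (C * eLpNorm F q (riemannianMeasure g)) := by gcongr
    _ = _ := by rw [ENNReal.smul_def, smul_eq_mul, ENNReal.coe_mul, mul_assoc]

/-- The `L^1` bound applied to `f - f'`, whose norm is zero; no integrability of `f` or `f'` is
needed. -/
theorem SimpleH.apply_ae_congr {f f' : M → ℝ} (h : f =ᵐ[riemannianMeasure g] f') :
    H.apply f =ᵐ[riemannianMeasure g] H.apply f' := by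
  obtain ⟨C, hC⟩ := H.exists_eLpNorm_apply_le g ENNReal.one_ne_top
  have h0 : f - f' =ᵐ[riemannianMeasure g] 0 := by
    filter_upwards [h] with x hx
    simp [hx]
  obtain ⟨h1, h2⟩ := hC (f - f') (aestronglyMeasurable_zero.congr h0.symm)
  rw [eLpNorm_congr_ae h0, eLpNorm_zero, mul_zero, nonpos_iff_eq_zero,
    eLpNorm_eq_zero_iff h1 one_ne_zero, H.apply_sub] at h2
  filter_upwards [h2] with x hx
  exact sub_eq_zero.1 hx

/-- Simple `H`-operators are bounded for the Sobolev norm of smooth functions. -/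
theorem SimpleH.exists_smoothSobolevNorm_apply_le (r : ℕ) {p : ℝ≥0∞} (hp : 1 ≤ p) (hp' : p ≠ ⊤) :
    ∃ C : ℝ≥0, ∀ u : M → ℝ, ContMDiff (𝓡 d) 𝓘(ℝ) ∞ u →
      smoothSobolevNorm g r p (H.apply u) ≤ C * smoothSobolevNorm g r p u := by
  obtain ⟨C, hC⟩ := exists_eLpNorm_indicator_comp_le g H.smooth_Φ H.smooth_symm
    (K := tsupport H.φ) H.compact_φ (isClosed_tsupport _).measurableSet H.supp_φ hp'
  choose B hB using fun k => H.exists_covNorm_apply_le g k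
  refine ⟨∑ k ∈ Finset.range (r + 1), B k * C, fun u hu => ?_⟩
  unfold smoothSobolevNorm
  rw [ENNReal.ofNNReal_finsetSum, Finset.sum_mul]
  refine Finset.sum_le_sum fun k hk => ?_
  set F : M → ℝ := ∑ j ∈ Finset.range (k + 1), covNorm g j u
  have hF : AEStronglyMeasurable F (riemannianMeasure g) :=
    Finset.aestronglyMeasurable_sum _ fun j _ => (continuous_covNorm g hu j).aestronglyMeasurable
  have hF0 : ∀ x, 0 ≤ F x := fun x => by
    simp only [F, Finset.sum_apply]
    exact Finset.sum_nonneg fun j _ => covNorm_nonneg g _ _ _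
  calc eLpNorm (covNorm g k (H.apply u)) p (riemannianMeasure g)
      ≤ B k • eLpNorm ((tsupport H.φ).indicator fun x => F (H.Φ x)) p (riemannianMeasure g) := by
        refine eLpNorm_le_nnreal_smul_eLpNorm_of_ae_le_mul (ae_of_all _ fun x => ?_) p
        rw [← NNReal.coe_le_coe, NNReal.coe_mul, coe_nnnorm, coe_nnnorm, Real.norm_eq_abs,
          abs_of_nonneg (covNorm_nonneg g _ _ _)]
        by_cases hx : x ∈ tsupport H.φ
        · rw [indicator_of_mem hx, Real.norm_eq_abs, abs_of_nonneg (hF0 _)]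
          simpa [F] using hB k x hx u hu
        -- Off the support of `φ` the function vanishes in a neighbourhood, so all its covariant
        -- derivatives vanish at the point.
        · rw [covNorm_congr g (H.apply_eventuallyEq_zero u hx), covNorm_zero]
          positivity
    _ ≤ B k • (C * eLpNorm F p (riemannianMeasure g)) := by
        gcongr
        exact (hC F hF).2
    _ = (B k * C : ℝ≥0) * eLpNorm F p (riemannianMeasure g) := by
        rw [ENNReal.smul_def, smul_eq_mul, ENNReal.coe_mul, mul_assoc]
    _ ≤ (B k * C : ℝ≥0) * ∑ j ∈ Finset.range (r + 1),
          eLpNorm (covNorm g j u) p (riemannianMeasure g) := by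
        gcongr
        refine (eLpNorm_sum_le (fun j _ => (continuous_covNorm g hu j).aestronglyMeasurable)
          hp).trans ?_
        exact Finset.sum_le_sum_of_subset
          (Finset.range_mono (by have := Finset.mem_range.1 hk; omega))

end SimpleH

end HestenesSobolev

end

noncomputable section

namespace HestenesSobolev

/-! ### The completion `W^r_p` and its norm. -/

section Sobolev

theorem limsup_add_le_add_limsup (a b : ℕ → ℝ≥0∞) :
    limsup (fun n => a n + b n) atTop ≤ limsup a atTop + limsup b atTop := by
  refine ENNReal.le_of_forall_pos_le_add fun ε hε hlt => ?_
  obtain ⟨ha, hb⟩ := ENNReal.add_lt_top.1 hlt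
  have hε' : (ε : ℝ≥0∞) / 2 ≠ 0 := by simpa using hε.ne'
  have h1 := eventually_lt_of_limsup_lt (ENNReal.lt_add_right ha.ne hε')
  have h2 := eventually_lt_of_limsup_lt (ENNReal.lt_add_right hb.ne hε')
  refine limsup_le_of_le (by isBoundedDefault) ?_
  filter_upwards [h1, h2] with n hn1 hn2
  refine (add_le_add hn1.le hn2.le).trans_eq ?_
  rw [add_add_add_comm, ENNReal.add_halves]

variable {d : ℕ} {M : Type*} [TopologicalSpace M] [ChartedSpace (Eu d) M]
  [IsManifold (𝓡 d) ∞ M] [MeasurableSpace M] {g : SmoothMetric d M} {r : ℕ} {p : ℝ≥0∞}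
  {f f' : M → ℝ} {u u' : ℕ → M → ℝ}

theorem IsSobolevApprox.congr_ae (hu : IsSobolevApprox g r p u f)
    (h : f =ᵐ[riemannianMeasure g] f') : IsSobolevApprox g r p u f' where
  mem := hu.mem
  cauchy := hu.cauchy
  tendsto := by
    refine hu.tendsto.congr fun n => eLpNorm_congr_ae ?_
    filter_upwards [h] with x hx
    simp [hx]

theorem MemSobolev.congr_ae (hf : MemSobolev g r p f) (h : f =ᵐ[riemannianMeasure g] f') :
    MemSobolev g r p f' :=
  ⟨hf.1.congr h, hf.2.imp fun _ hu => hu.congr_ae h⟩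

theorem memSobolev_congr_ae (h : f =ᵐ[riemannianMeasure g] f') :
    MemSobolev g r p f ↔ MemSobolev g r p f' :=
  ⟨fun hf => hf.congr_ae h, fun hf => hf.congr_ae h.symm⟩

theorem sobolevNorm_congr_ae (h : f =ᵐ[riemannianMeasure g] f') :
    sobolevNorm g r p f = sobolevNorm g r p f' := by
  unfold sobolevNorm
  exact iInf_congr fun u => iInf_congr_Prop
    ⟨fun hu => hu.congr_ae h, fun hu => hu.congr_ae h.symm⟩ fun _ => rfl

theorem sobolevNorm_le_of_isSobolevApprox (hu : IsSobolevApprox g r p u f) :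
    sobolevNorm g r p f ≤ limsup (fun n => smoothSobolevNorm g r p (u n)) atTop :=
  iInf₂_le u hu

/-- Since the norm is an infimum over approximating sequences, a bound sequence by sequence
suffices, and independence of the sequence is never needed. The conditions on `C` allow division by
it under the infimum. -/
theorem sobolevNorm_le_mul_of_forall {C : ℝ≥0∞} (hC : C ≠ 0) (hC' : C ≠ ⊤)
    (h : ∀ u, IsSobolevApprox g r p u f → ∃ u', IsSobolevApprox g r p u' f' ∧
      ∀ n, smoothSobolevNorm g r p (u' n) ≤ C * smoothSobolevNorm g r p (u n)) :
    sobolevNorm g r p f' ≤ C * sobolevNorm g r p f := by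
  rw [mul_comm, ← ENNReal.div_le_iff hC hC']
  refine le_iInf₂ fun u hu => ?_
  rw [ENNReal.div_le_iff hC hC', mul_comm, ← ENNReal.limsup_const_mul_of_ne_top hC']
  obtain ⟨u', hu', hle⟩ := h u hu
  exact (sobolevNorm_le_of_isSobolevApprox hu').trans
    (limsup_le_limsup (Eventually.of_forall hle))

theorem smoothSobolevNorm_zero : smoothSobolevNorm g r p (0 : M → ℝ) = 0 := by
  have := smoothSobolevNorm_const_smul g r p (f := (0 : M → ℝ)) contMDiff_const 0
  simpa using this

theorem isSobolevApprox_zero : IsSobolevApprox g r p (fun _ => 0) (0 : M → ℝ) where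
  mem n := ⟨contMDiff_const, by rw [smoothSobolevNorm_zero]; exact ENNReal.zero_lt_top⟩
  cauchy ε hε := ⟨0, fun m _ n _ => by rwa [sub_zero, smoothSobolevNorm_zero]⟩
  tendsto := by simp

theorem memSobolev_zero : MemSobolev g r p (0 : M → ℝ) :=
  ⟨aestronglyMeasurable_zero, _, isSobolevApprox_zero⟩

theorem sobolevNorm_zero : sobolevNorm g r p (0 : M → ℝ) = 0 := by
  refine le_antisymm ((sobolevNorm_le_of_isSobolevApprox isSobolevApprox_zero).trans ?_) zero_le
  simp [smoothSobolevNorm_zero]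

theorem IsSobolevApprox.const_smul (hu : IsSobolevApprox g r p u f) (c : ℝ) :
    IsSobolevApprox g r p (fun n => c • u n) (c • f) where
  mem n := by
    refine ⟨contMDiff_const (I := 𝓡 d) (I' := 𝓘(ℝ)) (c := c) |>.smul (hu.mem n).1, ?_⟩
    rw [smoothSobolevNorm_const_smul g r p (hu.mem n).1]
    exact ENNReal.mul_lt_top enorm_lt_top (hu.mem n).2
  cauchy ε hε := by
    -- Adding `1` covers `c = 0`.
    obtain ⟨N, hN⟩ := hu.cauchy (ε / (‖c‖ₑ + 1))
      (ENNReal.div_pos hε.ne' (by simp))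
    refine ⟨N, fun m hm n hn => ?_⟩
    rw [← smul_sub, smoothSobolevNorm_const_smul g r p (f := u m - u n)
      ((hu.mem m).1.sub (hu.mem n).1)]
    rcases eq_or_ne ε ⊤ with rfl | hε'
    · refine ENNReal.mul_lt_top enorm_lt_top ((hN m hm n hn).trans_le le_top)
    · calc ‖c‖ₑ * smoothSobolevNorm g r p (u m - u n)
          ≤ (‖c‖ₑ + 1) * smoothSobolevNorm g r p (u m - u n) := by gcongr; exact le_self_add
        _ < ε := by
          rw [mul_comm]
          exact (ENNReal.lt_div_iff_mul_lt (Or.inl (by simp)) (Or.inl (by simp))).1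
            (hN m hm n hn)
  tendsto := by
    have h1 : ∀ n, eLpNorm (c • u n - c • f) p (riemannianMeasure g) =
        ‖c‖ₑ * eLpNorm (u n - f) p (riemannianMeasure g) := fun n => by
      rw [← smul_sub, eLpNorm_const_smul]
    simp only [h1]
    simpa using ENNReal.Tendsto.const_mul hu.tendsto (Or.inr enorm_ne_top)

theorem MemSobolev.const_smul (hf : MemSobolev g r p f) (c : ℝ) : MemSobolev g r p (c • f) :=
  ⟨hf.1.const_smul c, hf.2.elim fun _ hu => ⟨_, hu.const_smul c⟩⟩

theorem sobolevNorm_const_smul_le (c : ℝ) :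
    sobolevNorm g r p (c • f) ≤ ‖c‖ₑ * sobolevNorm g r p f := by
  rcases eq_or_ne c 0 with rfl | hc
  · rw [zero_smul, sobolevNorm_zero]
    exact zero_le
  · exact sobolevNorm_le_mul_of_forall (by simpa using hc) enorm_ne_top fun u hu =>
      ⟨_, hu.const_smul c, fun n => (smoothSobolevNorm_const_smul g r p (hu.mem n).1 c).le⟩

variable [BorelSpace M]

theorem IsSobolevApprox.add (hp : 1 ≤ p) (hf : AEStronglyMeasurable f (riemannianMeasure g))
    (hf' : AEStronglyMeasurable f' (riemannianMeasure g)) (hu : IsSobolevApprox g r p u f)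
    (hu' : IsSobolevApprox g r p u' f') :
    IsSobolevApprox g r p (fun n => u n + u' n) (f + f') where
  mem n := ⟨(hu.mem n).1.add (hu'.mem n).1,
    (smoothSobolevNorm_add_le g r hp (hu.mem n).1 (hu'.mem n).1).trans_lt
      (ENNReal.add_lt_top.2 ⟨(hu.mem n).2, (hu'.mem n).2⟩)⟩
  cauchy ε hε := by
    obtain ⟨N, hN⟩ := hu.cauchy (ε / 2) (ENNReal.half_pos hε.ne')
    obtain ⟨N', hN'⟩ := hu'.cauchy (ε / 2) (ENNReal.half_pos hε.ne')
    refine ⟨max N N', fun m hm n hn => ?_⟩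
    rw [add_sub_add_comm]
    refine (smoothSobolevNorm_add_le g r hp ((hu.mem m).1.sub (hu.mem n).1)
      ((hu'.mem m).1.sub (hu'.mem n).1)).trans_lt ?_
    rw [← ENNReal.add_halves ε]
    exact ENNReal.add_lt_add
      (hN m ((le_max_left _ _).trans hm) n ((le_max_left _ _).trans hn))
      (hN' m ((le_max_right _ _).trans hm) n ((le_max_right _ _).trans hn))
  tendsto := by
    have h0 := hu.tendsto.add hu'.tendsto
    rw [add_zero] at h0
    refine tendsto_of_tendsto_of_tendsto_of_le_of_le tendsto_const_nhds h0 (fun _ => zero_le)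
      fun n => ?_
    dsimp only
    rw [add_sub_add_comm]
    exact eLpNorm_add_le ((hu.mem n).1.continuous.aestronglyMeasurable.sub hf)
      ((hu'.mem n).1.continuous.aestronglyMeasurable.sub hf') hp

theorem MemSobolev.add (hp : 1 ≤ p) (hf : MemSobolev g r p f) (hf' : MemSobolev g r p f') :
    MemSobolev g r p (f + f') :=
  ⟨hf.1.add hf'.1, hf.2.elim fun _ hu => hf'.2.elim fun _ hu' => ⟨_, hu.add hp hf.1 hf'.1 hu'⟩⟩

theorem memSobolev_sum (hp : 1 ≤ p) {ι : Type*} (s : Finset ι) {F : ι → M → ℝ}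
    (hF : ∀ i ∈ s, MemSobolev g r p (F i)) : MemSobolev g r p (∑ i ∈ s, F i) := by
  classical
  induction s using Finset.induction_on with
  | empty => exact memSobolev_zero
  | insert i s hi ih =>
    rw [Finset.sum_insert hi]
    exact (hF i (Finset.mem_insert_self i s)).add hp
      (ih fun j hj => hF j (Finset.mem_insert_of_mem hj))

theorem sobolevNorm_add_le (hp : 1 ≤ p) (hf : AEStronglyMeasurable f (riemannianMeasure g))
    (hf' : AEStronglyMeasurable f' (riemannianMeasure g)) :
    sobolevNorm g r p (f + f') ≤ sobolevNorm g r p f + sobolevNorm g r p f' := by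
  rw [sobolevNorm.eq_1 g r p f, sobolevNorm.eq_1 g r p f']
  simp only [ENNReal.iInf_add, ENNReal.add_iInf]
  refine le_iInf₂ fun u' hu' => le_iInf₂ fun u hu => ?_
  refine (sobolevNorm_le_of_isSobolevApprox (IsSobolevApprox.add hp hf hf' hu hu')).trans ?_
  refine (limsup_le_limsup (Eventually.of_forall fun n =>
    smoothSobolevNorm_add_le g r hp (hu.mem n).1 (hu'.mem n).1)).trans ?_
  exact limsup_add_le_add_limsup _ _

theorem sobolevNorm_sum_le (hp : 1 ≤ p) {ι : Type*} (s : Finset ι) {F : ι → M → ℝ}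
    (hF : ∀ i ∈ s, AEStronglyMeasurable (F i) (riemannianMeasure g)) :
    sobolevNorm g r p (∑ i ∈ s, F i) ≤ ∑ i ∈ s, sobolevNorm g r p (F i) := by
  classical
  induction s using Finset.induction_on with
  | empty => simp [sobolevNorm_zero]
  | insert i s hi ih =>
    rw [Finset.sum_insert hi, Finset.sum_insert hi]
    have hF' : ∀ j ∈ s, AEStronglyMeasurable (F j) (riemannianMeasure g) :=
      fun j hj => hF j (Finset.mem_insert_of_mem hj)
    refine (sobolevNorm_add_le hp (hF i (Finset.mem_insert_self i s))
      (Finset.aestronglyMeasurable_sum s hF')).trans ?_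
    gcongr
    exact ih hF'

theorem MemSobolev.sobolevNorm_lt_top (hp : 1 ≤ p) (hf : MemSobolev g r p f) :
    sobolevNorm g r p f < ⊤ := by
  obtain ⟨-, u, hu⟩ := hf
  -- From this `N` on, all norms are at most `1` plus the finite norm of `u N`.
  obtain ⟨N, hN⟩ := hu.cauchy 1 one_pos
  refine (sobolevNorm_le_of_isSobolevApprox hu).trans_lt (lt_of_le_of_lt
    (limsup_le_of_le (a := 1 + smoothSobolevNorm g r p (u N)) (by isBoundedDefault) ?_)
    (ENNReal.add_lt_top.2 ⟨ENNReal.one_lt_top, (hu.mem N).2⟩))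
  filter_upwards [eventually_ge_atTop N] with n hn
  have h1 : u n = (u n - u N) + u N := by simp
  calc smoothSobolevNorm g r p (u n) = smoothSobolevNorm g r p ((u n - u N) + u N) := by rw [← h1]
    _ ≤ smoothSobolevNorm g r p (u n - u N) + smoothSobolevNorm g r p (u N) :=
      smoothSobolevNorm_add_le g r hp ((hu.mem n).1.sub (hu.mem N).1) (hu.mem N).1
    _ ≤ _ := by
      gcongr
      exact (hN n hn N le_rfl).le

variable [SecondCountableTopology M] (H : SimpleH d M)

theorem SimpleH.exists_isSobolevApprox_apply (g : SmoothMetric d M) (r : ℕ) (hp : 1 ≤ p)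
    (hp' : p ≠ ⊤) :
    ∃ C : ℝ≥0, C ≠ 0 ∧ ∀ f : M → ℝ, AEStronglyMeasurable f (riemannianMeasure g) →
      ∀ u, IsSobolevApprox g r p u f →
        IsSobolevApprox g r p (fun n => H.apply (u n)) (H.apply f) ∧
        ∀ n, smoothSobolevNorm g r p (H.apply (u n)) ≤ C * smoothSobolevNorm g r p (u n) := by
  obtain ⟨C, hC⟩ := H.exists_smoothSobolevNorm_apply_le g r hp hp'
  obtain ⟨B, hB⟩ := H.exists_eLpNorm_apply_le g hp'
  -- The constant is enlarged to `C + 1` to be nonzero, as required for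
  -- `sobolevNorm_le_mul_of_forall`.
  have hC1 : ∀ u : M → ℝ, ContMDiff (𝓡 d) 𝓘(ℝ) ∞ u →
      smoothSobolevNorm g r p (H.apply u) ≤ (C + 1 : ℝ≥0) * smoothSobolevNorm g r p u :=
    fun u hu => (hC u hu).trans (by gcongr; exact le_self_add)
  refine ⟨C + 1, by positivity, fun f hf u hu => ⟨⟨fun n => ⟨H.contMDiff_apply (hu.mem n).1,
    (hC _ (hu.mem n).1).trans_lt (ENNReal.mul_lt_top ENNReal.coe_lt_top (hu.mem n).2)⟩, ?_, ?_⟩,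
    fun n => hC1 _ (hu.mem n).1⟩⟩
  · intro ε hε
    obtain ⟨N, hN⟩ := hu.cauchy (ε / (C + 1 : ℝ≥0)) (ENNReal.div_pos hε.ne' ENNReal.coe_ne_top)
    refine ⟨N, fun m hm n hn => ?_⟩
    rw [← H.apply_sub]
    refine (hC1 _ ((hu.mem m).1.sub (hu.mem n).1)).trans_lt ?_
    rw [mul_comm]
    exact (ENNReal.lt_div_iff_mul_lt (Or.inl (by simp)) (Or.inl ENNReal.coe_ne_top)).1
      (hN m hm n hn)
  · have h0 : Tendsto (fun n => B * eLpNorm (u n - f) p (riemannianMeasure g)) atTop (𝓝 0) := by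
      simpa using ENNReal.Tendsto.const_mul hu.tendsto (Or.inr ENNReal.coe_ne_top)
    refine tendsto_of_tendsto_of_tendsto_of_le_of_le tendsto_const_nhds h0 (fun _ => zero_le)
      fun n => ?_
    dsimp only
    rw [← H.apply_sub]
    exact (hB _ ((hu.mem n).1.continuous.aestronglyMeasurable.sub hf)).2

/-- Simple `H`-operators are bounded on `W^r_p`. -/
theorem SimpleH.exists_sobolevNorm_apply_le (g : SmoothMetric d M) (r : ℕ) (hp : 1 ≤ p)
    (hp' : p ≠ ⊤) :
    ∃ C : ℝ≥0, ∀ f : M → ℝ, MemSobolev g r p f → MemSobolev g r p (H.apply f) ∧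
      sobolevNorm g r p (H.apply f) ≤ C * sobolevNorm g r p f := by
  obtain ⟨C, hC0, hC⟩ := H.exists_isSobolevApprox_apply g r hp hp'
  obtain ⟨B, hB⟩ := H.exists_eLpNorm_apply_le g hp'
  refine ⟨C, fun f hf => ⟨⟨(hB f hf.1).1, hf.2.elim fun u hu => ⟨_, (hC f hf.1 u hu).1⟩⟩, ?_⟩⟩
  exact sobolevNorm_le_mul_of_forall (by simpa using hC0) ENNReal.coe_ne_top fun u hu =>
    ⟨_, hC f hf.1 u hu⟩

end Sobolev

end HestenesSobolev

end

noncomputable section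

namespace HestenesSobolev

/-! ### Extensions of `H`-operators to `L^q` and their action on `L^1_loc`. -/

section Extension

/-- Continuous linear maps on `L^q` which agree on `C_c` are equal. -/
theorem Lp_clm_ext_of_hasCompactSupport {X E : Type*} [TopologicalSpace X] [R1Space X]
    [NormalSpace X] [WeaklyLocallyCompactSpace X] [MeasurableSpace X] [BorelSpace X] {μ : Measure X} [μ.Regular]
    [NormedAddCommGroup E] [NormedSpace ℝ E] {q : ℝ≥0∞} [Fact (1 ≤ q)] (hq : q ≠ ⊤)
    (A B : Lp ℝ q μ →L[ℝ] E)
    (h : ∀ f : X → ℝ, Continuous f → HasCompactSupport f → ∀ u : Lp ℝ q μ, u =ᵐ[μ] f → A u = B u) :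
    A = B := by
  have hclosed : IsClosed {u | A u = B u} := isClosed_eq A.continuous B.continuous
  ext1 u
  suffices u ∈ closure {u | A u = B u} by rwa [hclosed.closure_eq] at this
  refine Metric.mem_closure_iff.2 fun ε hε => ?_
  obtain ⟨f, hf, hle, hfc, hfm⟩ := (Lp.memLp u).exists_hasCompactSupport_eLpNorm_sub_le hq
    (ε := ENNReal.ofReal (ε / 2)) (by simpa using hε)
  refine ⟨hfm.toLp f, h f hfc hf _ hfm.coeFn_toLp, ?_⟩
  have hu : edist u (hfm.toLp f) ≤ ENNReal.ofReal (ε / 2) := by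
    rw [Lp.edist_def]
    refine (eLpNorm_congr_ae ?_).trans_le hle
    exact EventuallyEq.rfl.sub hfm.coeFn_toLp
  calc dist u (hfm.toLp f) ≤ (ENNReal.ofReal (ε / 2)).toReal := by
        rw [dist_edist]
        exact ENNReal.toReal_mono ENNReal.ofReal_ne_top hu
    _ = ε / 2 := ENNReal.toReal_ofReal (by positivity)
    _ < ε := by linarith

variable {d : ℕ} {M : Type*} [TopologicalSpace M] [ChartedSpace (Eu d) M] {n : ℕ}
  (H : Fin n → SimpleH d M)

/-- A sum of simple `H`-operators. -/
def sumH (f : M → ℝ) : M → ℝ := ∑ i, (H i).apply f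

theorem sumH_apply (f : M → ℝ) (x : M) : sumH H f x = ∑ i, (H i).apply f x :=
  Finset.sum_apply x _ _

theorem sumH_add (f f' : M → ℝ) : sumH H (f + f') = sumH H f + sumH H f' := by
  simp only [sumH, SimpleH.apply_add, Finset.sum_add_distrib]

theorem sumH_const_smul (c : ℝ) (f : M → ℝ) : sumH H (c • f) = c • sumH H f := by
  simp only [sumH, SimpleH.apply_const_smul, Finset.smul_sum]

variable {H} in
-- A localized operator only reads values on `U`. This justifies every cutoff below: by the
-- indicator of `U`, by a compact set, or by a test function equal to `1` on `U`.
theorem sumH_congr_of_eqOn {U : Set M} (hU : ∀ i, (H i).Φ.target ⊆ U) {f f' : M → ℝ}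
    (h : EqOn f f' U) : sumH H f = sumH H f' := by
  refine Finset.sum_congr rfl fun i _ => ?_
  ext x
  simp only [SimpleH.apply]
  split_ifs with hx
  · rw [h (hU i ((H i).Φ.map_source hx))]
  · rfl

variable {H} in
theorem sumH_of_notMem {U : Set M} (hU : ∀ i, (H i).Φ.source ⊆ U) (f : M → ℝ) {x : M}
    (hx : x ∉ U) : sumH H f x = 0 := by
  rw [sumH_apply]
  exact Finset.sum_eq_zero fun i _ => if_neg fun h => hx (hU i h)

variable [IsManifold (𝓡 d) ∞ M] [MeasurableSpace M] [BorelSpace M]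
  [SecondCountableTopology M] (g : SmoothMetric d M)

theorem exists_eLpNorm_sumH_le {q : ℝ≥0∞} (hq1 : 1 ≤ q) (hq : q ≠ ⊤) :
    ∃ C : ℝ≥0, ∀ F : M → ℝ, AEStronglyMeasurable F (riemannianMeasure g) →
      AEStronglyMeasurable (sumH H F) (riemannianMeasure g) ∧
      eLpNorm (sumH H F) q (riemannianMeasure g) ≤ C * eLpNorm F q (riemannianMeasure g) := by
  choose C hC using fun i => (H i).exists_eLpNorm_apply_le g hq
  refine ⟨∑ i, C i, fun F hF =>
    ⟨Finset.aestronglyMeasurable_sum _ fun i _ => (hC i F hF).1, ?_⟩⟩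
  rw [ENNReal.ofNNReal_finsetSum, Finset.sum_mul]
  exact (eLpNorm_sum_le (fun i _ => (hC i F hF).1) hq1).trans
    (Finset.sum_le_sum fun i _ => (hC i F hF).2)

theorem sumH_ae_congr {f f' : M → ℝ} (h : f =ᵐ[riemannianMeasure g] f') :
    sumH H f =ᵐ[riemannianMeasure g] sumH H f' := by
  filter_upwards [ae_all_iff.2 fun i => (H i).apply_ae_congr g h] with x hx
  rw [sumH_apply, sumH_apply]
  exact Finset.sum_congr rfl fun i _ => hx i

/-- The pointwise formula respects almost everywhere equality and is bounded, so it descends to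
`L^q`; this supplies the extension whose existence `lpExtension` presupposes. -/
theorem exists_clm_ae_eq_sumH (q : ℝ≥0∞) [hq1 : Fact (1 ≤ q)] (hq : q ≠ ⊤) :
    ∃ A : Lp ℝ q (riemannianMeasure g) →L[ℝ] Lp ℝ q (riemannianMeasure g),
      ∀ u, A u =ᵐ[riemannianMeasure g] sumH H u := by
  obtain ⟨C, hC⟩ := exists_eLpNorm_sumH_le H g hq1.1 hq
  have hmem : ∀ u : Lp ℝ q (riemannianMeasure g), MemLp (sumH H u) q (riemannianMeasure g) :=
    fun u => ⟨(hC u (Lp.aestronglyMeasurable u)).1,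
      (hC u (Lp.aestronglyMeasurable u)).2.trans_lt
        (ENNReal.mul_lt_top ENNReal.coe_lt_top (Lp.eLpNorm_lt_top u))⟩
  let L : Lp ℝ q (riemannianMeasure g) →ₗ[ℝ] Lp ℝ q (riemannianMeasure g) :=
    { toFun := fun u => (hmem u).toLp _
      map_add' := fun u v => by
        rw [← MemLp.toLp_add]
        refine MemLp.toLp_congr _ _ ?_
        rw [← sumH_add]
        exact sumH_ae_congr H g (Lp.coeFn_add u v)
      map_smul' := fun c u => by
        rw [RingHom.id_apply, ← MemLp.toLp_const_smul]
        refine MemLp.toLp_congr _ _ ?_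
        rw [← sumH_const_smul]
        exact sumH_ae_congr H g (Lp.coeFn_smul c u) }
  refine ⟨L.mkContinuous C fun u => ?_, fun u => (hmem u).coeFn_toLp⟩
  change ‖(hmem u).toLp _‖ ≤ _
  rw [Lp.norm_toLp, Lp.norm_def, ← ENNReal.coe_toReal, ← ENNReal.toReal_mul]
  exact ENNReal.toReal_mono (ENNReal.mul_ne_top ENNReal.coe_ne_top (Lp.eLpNorm_ne_top u))
    (hC u (Lp.aestronglyMeasurable u)).2

variable [T2Space M]

theorem regular_riemannianMeasure : (riemannianMeasure g).Regular := by
  have := ChartedSpace.locallyCompactSpace (Eu d) M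
  have := isLocallyFiniteMeasure_riemannianMeasure g
  infer_instance

/-- The extension of an `H`-operator to `L^q` is given by the same formula. -/
theorem lpExtension_ae_eq_sumH (q : ℝ≥0∞) [Fact (1 ≤ q)] (hq : q ≠ ⊤)
    {T : C₀(M, ℝ) →L[ℝ] C₀(M, ℝ)} (hT : ∀ f x, T f x = ∑ i, (H i).apply f x)
    (u : Lp ℝ q (riemannianMeasure g)) :
    lpExtension (riemannianMeasure g) q T u =ᵐ[riemannianMeasure g] sumH H u := by
  have := ChartedSpace.locallyCompactSpace (Eu d) M
  have := regular_riemannianMeasure g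
  obtain ⟨A, hA⟩ := exists_clm_ae_eq_sumH H g q hq
  have hTf : ∀ f : C₀(M, ℝ), sumH H f = T f := fun f => funext fun x => by
    rw [sumH_apply, hT]
  have hext : IsLpExtension (riemannianMeasure g) q T A := fun f u _ hu =>
    (hA u).trans ((sumH_ae_congr H g hu).trans (hTf f).eventuallyEq)
  have hex : ∃ A, IsLpExtension (riemannianMeasure g) q T A := ⟨A, hext⟩
  have heq : lpExtension (riemannianMeasure g) q T = A := by
    rw [lpExtension, dif_pos hex]
    -- The extension chosen in the definition is arbitrary, but density of `C_c` leaves only one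
    -- possibility.
    refine Lp_clm_ext_of_hasCompactSupport hq _ _ fun f hf hfc u hu => ?_
    let F : C₀(M, ℝ) := ⟨⟨f, hf⟩, hfc.is_zero_at_infty⟩
    exact Lp.ext ((hex.choose_spec F u hfc hu).trans (hext F u hfc hu).symm)
  rw [heq]
  exact hA u

variable {H} in
/-- The action of a localized `H`-operator on locally integrable functions. -/
theorem applyLoc_ae_eq_sumH {U : Set M} (hUo : IsOpen U) (hU : IsCompact (closure U))
    {T : C₀(M, ℝ) →L[ℝ] C₀(M, ℝ)} (hT : ∀ f x, T f x = ∑ i, (H i).apply f x)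
    (hHU : ∀ i, (H i).Φ.target ⊆ U) {f : M → ℝ} (hf : LocallyIntegrable f (riemannianMeasure g)) :
    applyLoc (riemannianMeasure g) U T f =ᵐ[riemannianMeasure g] sumH H f := by
  have hmem : MemLp (U.indicator f) 1 (riemannianMeasure g) :=
    memLp_one_iff_integrable.2 (((hf.integrableOn_isCompact hU).mono_set
      subset_closure).integrable_indicator hUo.measurableSet)
  rw [applyLoc, dif_pos hmem]
  refine (lpExtension_ae_eq_sumH H g 1 ENNReal.one_ne_top hT _).trans ?_
  refine (sumH_ae_congr H g hmem.coeFn_toLp).trans (Eq.eventuallyEq ?_)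
  exact sumH_congr_of_eqOn hHU fun x hx => indicator_of_mem hx f

end Extension

/-! ### The decomposition of identity as a finite sum on compact sets. -/

section Decomposition

variable {d : ℕ} {M : Type*} [TopologicalSpace M] [ChartedSpace (Eu d) M]
  [IsManifold (𝓡 d) ∞ M] [MeasurableSpace M] [BorelSpace M]
  [SecondCountableTopology M] [T2Space M] {g : SmoothMetric d M}
  {𝒰 : Set (Set M)} {q : ℝ≥0∞} [hq1 : Fact (1 ≤ q)] {P : 𝒰 → C₀(M, ℝ) →L[ℝ] C₀(M, ℝ)}
  {n : 𝒰 → ℕ} {H : (U : 𝒰) → Fin (n U) → SimpleH d M}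

/-- On a compact set, a decomposition of identity is a finite sum. -/
theorem IsSmoothDecomposition.ae_eq_sum_lp (hP : IsSmoothDecomposition g 𝒰 q P) (hq : q ≠ ⊤)
    (hH : ∀ U i, (H U i).Φ.source ⊆ U.1 ∧ (H U i).Φ.target ⊆ U.1)
    (hT : ∀ U f x, P U f x = ∑ i, (H U i).apply f x) {K : Set M} (hK : IsCompact K)
    (f : Lp ℝ q (riemannianMeasure g)) :
    f =ᵐ[(riemannianMeasure g).restrict K]
      ∑ U ∈ (hP.locallyFinite K hK).toFinset, sumH (H U) f := by
  set R := LpToLpRestrictCLM M ℝ ℝ (riemannianMeasure g) q K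
  set F := (hP.locallyFinite K hK).toFinset with hF
  set A := fun U => lpExtension (riemannianMeasure g) q (P U)
  have hA : ∀ U, A U f =ᵐ[riemannianMeasure g] sumH (H U) f := fun U =>
    lpExtension_ae_eq_sumH (H U) g q hq (hT U) f
  -- There are two reasons for a term to vanish on `K`: either `P U = 0`, or `U` misses `K` and the
  -- image of `P U` is supported in `U`.
  have hzero : ∀ U ∉ F, R (A U f) = 0 := by
    intro U hU
    have hU' : (U.1 ∩ K).Nonempty → P U = 0 := by
      simpa [hF] using hU
    refine Lp.ext ?_
    refine (LpToLpRestrictCLM_coeFn ℝ K (A U f)).trans (EventuallyEq.trans ?_ (Lp.coeFn_zero _ _ _).symm)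
    by_cases hUK : (U.1 ∩ K).Nonempty
    · have h0 := lpExtension_ae_eq_sumH (Fin.elim0 : Fin 0 → SimpleH d M) g q hq (T := P U)
        (by simp [hU' hUK]) f
      refine h0.restrict.trans (Eq.eventuallyEq ?_)
      simp [sumH]
    · have hKm : MeasurableSet K := hK.isClosed.measurableSet
      filter_upwards [ae_restrict_of_ae (hA U), ae_restrict_mem hKm] with x hx hxK
      rw [hx, sumH_of_notMem (fun i => (hH U i).1) _ fun hxU => hUK ⟨x, hxU, hxK⟩]
      rfl
  have h1 : HasSum (fun U => R (A U f)) (R f) := (hP.hasSum f).mapL R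
  have h2 : R f = R (∑ U ∈ F, A U f) := by
    rw [map_sum]
    exact h1.unique (hasSum_sum_of_ne_finset_zero hzero)
  have h3 : (∑ U ∈ F, A U f : Lp ℝ q (riemannianMeasure g)) =ᵐ[riemannianMeasure g] ∑ U ∈ F, sumH (H U) f := by
    have h4 := Lp.coeFn_finsetSum F (fun U => A U f)
    refine h4.trans ?_
    filter_upwards [(eventually_countable_ball F.countable_toSet).2 fun U _ => hA U] with x hx
    rw [Finset.sum_apply, Finset.sum_apply]
    exact Finset.sum_congr rfl fun U hU => hx U hU
  refine (LpToLpRestrictCLM_coeFn ℝ K f).symm.trans ?_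
  change (R f : M → ℝ) =ᵐ[_] _
  rw [h2]
  exact (LpToLpRestrictCLM_coeFn ℝ K _).trans h3.restrict

/-- The decomposition is only known in `L^q`, while `f` is only in `L^1_loc`. The passage goes
through `C_c`, which lies in `L^q` and is dense in `L^1`. -/
theorem IsSmoothDecomposition.ae_eq_sum (hP : IsSmoothDecomposition g 𝒰 q P)
    (h𝒰 : IsOpenPrecompactCover 𝒰) (hq : q ≠ ⊤)
    (hH : ∀ U i, (H U i).Φ.source ⊆ U.1 ∧ (H U i).Φ.target ⊆ U.1)
    (hT : ∀ U f x, P U f x = ∑ i, (H U i).apply f x) {K : Set M} (hK : IsCompact K)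
    {f : M → ℝ} (hf : LocallyIntegrable f (riemannianMeasure g)) :
    f =ᵐ[(riemannianMeasure g).restrict K]
      ∑ U ∈ (hP.locallyFinite K hK).toFinset, sumH (H U) f := by
  have := ChartedSpace.locallyCompactSpace (Eu d) M
  have := regular_riemannianMeasure g
  have := isLocallyFiniteMeasure_riemannianMeasure g
  set F := (hP.locallyFinite K hK).toFinset
  choose A hA using fun U => exists_clm_ae_eq_sumH (H U) g 1 ENNReal.one_ne_top
  set R := LpToLpRestrictCLM M ℝ ℝ (riemannianMeasure g) 1 K
  have hsum : ∀ u : Lp ℝ 1 (riemannianMeasure g), (∑ U ∈ F, A U) u =ᵐ[riemannianMeasure g] ∑ U ∈ F, sumH (H U) u := by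
    intro u
    rw [sum_apply]
    have h4 := Lp.coeFn_finsetSum F (fun U => A U u)
    refine h4.trans ?_
    filter_upwards [(eventually_countable_ball F.countable_toSet).2 fun U _ => hA U u] with x hx
    rw [Finset.sum_apply, Finset.sum_apply]
    exact Finset.sum_congr rfl fun U hU => hx U hU
  have hcongr : ∀ u v : M → ℝ, u =ᵐ[riemannianMeasure g] v →
      ∑ U ∈ F, sumH (H U) u =ᵐ[riemannianMeasure g] ∑ U ∈ F, sumH (H U) v := by
    intro u v huv
    filter_upwards [(eventually_countable_ball F.countable_toSet).2 fun U _ =>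
      sumH_ae_congr (H U) g huv] with x hx
    rw [Finset.sum_apply, Finset.sum_apply]
    exact Finset.sum_congr rfl fun U hU => hx U hU
  -- The identity of continuous operators from `L^1(M)` to `L^1(K)`; on `C_c` it is the statement
  -- for `L^q`.
  have hR : R = R.comp (∑ U ∈ F, A U) := by
    refine Lp_clm_ext_of_hasCompactSupport ENNReal.one_ne_top _ _ fun f hfc hfs u hu => ?_
    have hfq : MemLp f q (riemannianMeasure g) := hfc.memLp_of_hasCompactSupport hfs
    have h1 := hP.ae_eq_sum_lp hq hH hT hK (hfq.toLp f)
    have h2 : (hfq.toLp f : M → ℝ) =ᵐ[riemannianMeasure g] u := hfq.coeFn_toLp.trans hu.symm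
    refine Lp.ext ?_
    refine (LpToLpRestrictCLM_coeFn ℝ K u).trans ?_
    refine EventuallyEq.trans ?_ (LpToLpRestrictCLM_coeFn ℝ K ((∑ U ∈ F, A U) u)).symm
    refine h2.symm.restrict.trans (h1.trans ?_)
    exact EventuallyEq.restrict ((hcongr _ _ h2).trans (hsum u).symm)
  -- Cutting `f` off outside `V` changes neither its values on `K` nor any of the finitely many
  -- terms.
  set V : Set M := K ∪ ⋃ U ∈ F, closure U.1
  have hV : IsCompact V :=
    hK.union (F.isCompact_biUnion fun U _ => h𝒰.precompact U.1 U.2)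
  have hmem : MemLp (V.indicator f) 1 (riemannianMeasure g) :=
    memLp_one_iff_integrable.2 ((hf.integrableOn_isCompact hV).integrable_indicator
      hV.isClosed.measurableSet)
  set u := hmem.toLp (V.indicator f)
  have hu : u =ᵐ[riemannianMeasure g] V.indicator f := hmem.coeFn_toLp
  have h1 : ∑ U ∈ F, sumH (H U) (V.indicator f) = ∑ U ∈ F, sumH (H U) f := by
    refine Finset.sum_congr rfl fun U hU => ?_
    refine sumH_congr_of_eqOn (fun i => (hH U i).2) fun x hx => indicator_of_mem ?_ f
    exact Or.inr (mem_biUnion hU (subset_closure hx))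
  have h2 : f =ᵐ[(riemannianMeasure g).restrict K] V.indicator f := by
    filter_upwards [ae_restrict_mem hK.isClosed.measurableSet] with x hx
    exact (indicator_of_mem (show x ∈ V from Or.inl hx) f).symm
  rw [← h1]
  refine h2.trans (hu.symm.restrict.trans ?_)
  refine (LpToLpRestrictCLM_coeFn ℝ K u).symm.trans ?_
  change (R u : M → ℝ) =ᵐ[_] _
  rw [hR]
  refine (LpToLpRestrictCLM_coeFn ℝ K ((∑ U ∈ F, A U) u)).trans ?_
  exact EventuallyEq.restrict ((hsum u).trans (hcongr _ _ hu))

end Decomposition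

end HestenesSobolev

end

noncomputable section

namespace HestenesSobolev

/-! ### Cutoff by test functions. -/

section TestFunctions

variable {d : ℕ} {M : Type*} [TopologicalSpace M] [ChartedSpace (Eu d) M]

theorem sumH_testFun_mul {n : ℕ} {H : Fin n → SimpleH d M} {U : Set M}
    (hU : ∀ i, (H i).Φ.target ⊆ U) {η : TestFun d M} (hη : ∀ x ∈ closure U, η.1 x = 1)
    (f : M → ℝ) : sumH H (fun x => η.1 x * f x) = sumH H f :=
  sumH_congr_of_eqOn hU fun x hx => by rw [hη x (subset_closure hx), one_mul]

/-- Test functions equal to one on a given compact set. -/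
theorem exists_testFun_eq_one (d : ℕ) {M : Type*} [TopologicalSpace M]
    [ChartedSpace (Eu d) M] [IsManifold (𝓡 d) ∞ M] [SecondCountableTopology M] [T2Space M]
    {K : Set M} (hK : IsCompact K) :
    ∃ η : TestFun d M, ∀ x ∈ K, η.1 x = 1 := by
  have := ChartedSpace.locallyCompactSpace (Eu d) M
  obtain ⟨L, hL, hKL⟩ := exists_compact_superset hK
  obtain ⟨η, h0, h1, -⟩ := exists_contMDiffMap_zero_one_of_isClosed (𝓡 d) (n := ⊤)
    isOpen_interior.isClosed_compl hK.isClosed (s := (interior L)ᶜ) (t := K)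
    (disjoint_compl_left_iff_subset.2 hKL)
  refine ⟨⟨η, η.contMDiff, HasCompactSupport.intro hL fun x hx => h0 ?_⟩, fun x hx => h1 hx⟩
  exact fun h => hx (interior_subset h)

end TestFunctions

/-! ### The local Sobolev space, its seminorms, and bounds for finite sums of `H`-operators. -/

section Local

variable {d : ℕ} {M : Type*} [TopologicalSpace M] [ChartedSpace (Eu d) M]
  [IsManifold (𝓡 d) ∞ M] [MeasurableSpace M] {g : SmoothMetric d M} {r : ℕ} {p : ℝ≥0∞}

theorem MemSobolevLoc.congr_ae {f f' : M → ℝ} (hf : MemSobolevLoc g r p f)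
    (h : f =ᵐ[riemannianMeasure g] f') : MemSobolevLoc g r p f' :=
  ⟨hf.1.congr h, fun η => (hf.2 η).congr_ae (EventuallyEq.rfl.mul h)⟩

theorem MemSobolevLoc.const_smul {f : M → ℝ} (hf : MemSobolevLoc g r p f) (c : ℝ) :
    MemSobolevLoc g r p (c • f) := by
  refine ⟨hf.1.smul c, fun η => ?_⟩
  convert (hf.2 η).const_smul c using 1
  ext x
  exact mul_left_comm _ _ _

theorem memSobolevLoc_zero : MemSobolevLoc g r p (0 : M → ℝ) := by
  refine ⟨locallyIntegrable_zero, fun η => ?_⟩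
  convert memSobolev_zero (g := g) (r := r) (p := p) using 1
  ext x
  exact mul_zero _

variable [BorelSpace M]

theorem MemSobolevLoc.add (hp : 1 ≤ p) {f f' : M → ℝ} (hf : MemSobolevLoc g r p f)
    (hf' : MemSobolevLoc g r p f') : MemSobolevLoc g r p (f + f') := by
  refine ⟨hf.1.add hf'.1, fun η => ?_⟩
  convert (hf.2 η).add hp (hf'.2 η) using 1
  ext x
  exact mul_add _ _ _

variable (g r) in
/-- The vector space of classes of functions in the local Sobolev space. -/
def sobolevLoc (hp : 1 ≤ p) : Submodule ℝ (M →ₘ[riemannianMeasure g] ℝ) where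
  carrier := {f | MemSobolevLoc g r p f}
  add_mem' {f f'} hf hf' :=
    (MemSobolevLoc.add hp hf hf').congr_ae (AEEqFun.coeFn_add f f').symm
  zero_mem' := memSobolevLoc_zero.congr_ae AEEqFun.coeFn_zero.symm
  smul_mem' c f hf := (MemSobolevLoc.const_smul hf c).congr_ae (AEEqFun.coeFn_smul c f).symm

/-- The seminorm obtained by composing a linear map into the Sobolev space with its norm. -/
def sobolevSeminorm (hp : 1 ≤ p) {W : Type*} [AddCommGroup W] [Module ℝ W] (S : W → M → ℝ)
    (hadd : ∀ f f', S (f + f') =ᵐ[riemannianMeasure g] S f + S f')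
    (hsmul : ∀ (c : ℝ) f, S (c • f) =ᵐ[riemannianMeasure g] c • S f)
    (hS : ∀ f, MemSobolev g r p (S f)) : Seminorm ℝ W :=
  Seminorm.ofSMulLE (fun f => (sobolevNorm g r p (S f)).toReal)
    (by
      have h := hsmul 0 0
      rw [zero_smul, zero_smul] at h
      rw [sobolevNorm_congr_ae h, sobolevNorm_zero, ENNReal.toReal_zero])
    (fun f f' => by
      rw [sobolevNorm_congr_ae (hadd f f'), ← ENNReal.toReal_add
        ((hS f).sobolevNorm_lt_top hp).ne ((hS f').sobolevNorm_lt_top hp).ne]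
      exact ENNReal.toReal_mono (ENNReal.add_lt_top.2
        ⟨(hS f).sobolevNorm_lt_top hp, (hS f').sobolevNorm_lt_top hp⟩).ne
        (sobolevNorm_add_le hp (hS f).1 (hS f').1))
    (fun c f => by
      rw [sobolevNorm_congr_ae (hsmul c f), ← toReal_enorm, ← ENNReal.toReal_mul]
      exact ENNReal.toReal_mono (ENNReal.mul_ne_top enorm_ne_top
        ((hS f).sobolevNorm_lt_top hp).ne) (sobolevNorm_const_smul_le c))

theorem ofReal_sobolevSeminorm (hp : 1 ≤ p) {W : Type*} [AddCommGroup W] [Module ℝ W]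
    (S : W → M → ℝ)
    (hadd : ∀ f f', S (f + f') =ᵐ[riemannianMeasure g] S f + S f')
    (hsmul : ∀ (c : ℝ) f, S (c • f) =ᵐ[riemannianMeasure g] c • S f)
    (hS : ∀ f, MemSobolev g r p (S f)) (f : W) :
    ENNReal.ofReal (sobolevSeminorm hp S hadd hsmul hS f) = sobolevNorm g r p (S f) :=
  ENNReal.ofReal_toReal ((hS f).sobolevNorm_lt_top hp).ne

variable [SecondCountableTopology M]

theorem exists_sobolevNorm_sumH_le {n : ℕ} (H : Fin n → SimpleH d M) (g : SmoothMetric d M)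
    (r : ℕ) (hp : 1 ≤ p) (hp' : p ≠ ⊤) :
    ∃ C : ℝ≥0, ∀ f, MemSobolev g r p f →
      MemSobolev g r p (sumH H f) ∧ sobolevNorm g r p (sumH H f) ≤ C * sobolevNorm g r p f := by
  choose C hC using fun i => (H i).exists_sobolevNorm_apply_le g r hp hp'
  refine ⟨∑ i, C i, fun f hf => ⟨memSobolev_sum hp _ fun i _ => (hC i f hf).1, ?_⟩⟩
  rw [ENNReal.ofNNReal_finsetSum, Finset.sum_mul]
  exact (sobolevNorm_sum_le hp _ fun i _ => (hC i f hf).1.1).trans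
    (Finset.sum_le_sum fun i _ => (hC i f hf).2)

theorem exists_sobolevNorm_testFun_mul_le (η : TestFun d M) (g : SmoothMetric d M)
    (r : ℕ) (hp : 1 ≤ p) (hp' : p ≠ ⊤) :
    ∃ C : ℝ≥0, ∀ f, MemSobolev g r p f →
      MemSobolev g r p (fun x => η.1 x * f x) ∧
        sobolevNorm g r p (fun x => η.1 x * f x) ≤ C * sobolevNorm g r p f := by
  simpa only [SimpleH.ofTestFun_apply] using
    (SimpleH.ofTestFun d M η).exists_sobolevNorm_apply_le g r hp hp'

end Local

/-! ### Comparison of the two families of seminorms. -/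

section Decomposition

variable {d : ℕ} {M : Type*} [TopologicalSpace M] [ChartedSpace (Eu d) M]
  [IsManifold (𝓡 d) ∞ M] [MeasurableSpace M] [BorelSpace M]
  [SecondCountableTopology M] [T2Space M] {g : SmoothMetric d M}
  {𝒰 : Set (Set M)} {q : ℝ≥0∞} [hq1 : Fact (1 ≤ q)] {P : 𝒰 → C₀(M, ℝ) →L[ℝ] C₀(M, ℝ)}
  {n : 𝒰 → ℕ} {H : (U : 𝒰) → Fin (n U) → SimpleH d M} {r : ℕ} {p : ℝ≥0∞}

theorem IsSmoothDecomposition.testFun_mul_ae_eq_sum (hP : IsSmoothDecomposition g 𝒰 q P)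
    (h𝒰 : IsOpenPrecompactCover 𝒰) (hq : q ≠ ⊤)
    (hH : ∀ U i, (H U i).Φ.source ⊆ U.1 ∧ (H U i).Φ.target ⊆ U.1)
    (hT : ∀ U f x, P U f x = ∑ i, (H U i).apply f x) (η : TestFun d M)
    {f : M → ℝ} (hf : LocallyIntegrable f (riemannianMeasure g)) :
    (fun x => η.1 x * f x) =ᵐ[riemannianMeasure g]
      ∑ U ∈ (hP.locallyFinite _ η.2.2).toFinset, fun x => η.1 x * sumH (H U) f x := by
  have h := hP.ae_eq_sum h𝒰 hq hH hT η.2.2 hf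
  filter_upwards [(ae_restrict_iff' (isClosed_tsupport η.1).measurableSet).1 h] with x hx
  rw [Finset.sum_apply, ← Finset.mul_sum]
  by_cases hxη : x ∈ tsupport η.1
  · rw [hx hxη, Finset.sum_apply]
  · rw [image_eq_zero_of_notMem_tsupport hxη, zero_mul, zero_mul]

/-- One direction applies `P_U` to `η f` with `η = 1` on the closure of `U`; the other one expands
`η f` into finitely many functions `η P_U f`. -/
theorem IsSmoothDecomposition.memSobolevLoc_iff (hP : IsSmoothDecomposition g 𝒰 q P)
    (h𝒰 : IsOpenPrecompactCover 𝒰) (hq : q ≠ ⊤)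
    (hH : ∀ U i, (H U i).Φ.source ⊆ U.1 ∧ (H U i).Φ.target ⊆ U.1)
    (hT : ∀ U f x, P U f x = ∑ i, (H U i).apply f x) (hp : 1 ≤ p) (hp' : p ≠ ⊤)
    {f : M → ℝ} (hf : LocallyIntegrable f (riemannianMeasure g)) :
    MemSobolevLoc g r p f ↔ ∀ U, MemSobolev g r p (sumH (H U) f) := by
  refine ⟨fun h U => ?_, fun h => ⟨hf, fun η => ?_⟩⟩
  · obtain ⟨η, hη⟩ := exists_testFun_eq_one d (h𝒰.precompact U.1 U.2)
    rw [← sumH_testFun_mul (fun i => (hH U i).2) hη]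
    obtain ⟨C, hC⟩ := exists_sobolevNorm_sumH_le (H U) g r hp hp'
    exact (hC _ (h.2 η)).1
  · refine MemSobolev.congr_ae ?_ (hP.testFun_mul_ae_eq_sum h𝒰 hq hH hT η hf).symm
    obtain ⟨C, hC⟩ := exists_sobolevNorm_testFun_mul_le η g r hp hp'
    exact memSobolev_sum hp _ fun U _ => (hC _ (h U)).1

theorem IsSmoothDecomposition.exists_sobolevNorm_testFun_mul_le
    (hP : IsSmoothDecomposition g 𝒰 q P)
    (h𝒰 : IsOpenPrecompactCover 𝒰) (hq : q ≠ ⊤)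
    (hH : ∀ U i, (H U i).Φ.source ⊆ U.1 ∧ (H U i).Φ.target ⊆ U.1)
    (hT : ∀ U f x, P U f x = ∑ i, (H U i).apply f x) (hp : 1 ≤ p) (hp' : p ≠ ⊤)
    (η : TestFun d M) :
    ∃ C : ℝ≥0, ∀ f, MemSobolevLoc g r p f → sobolevNorm g r p (fun x => η.1 x * f x) ≤
      C * ∑ U ∈ (hP.locallyFinite _ η.2.2).toFinset, sobolevNorm g r p (sumH (H U) f) := by
  obtain ⟨C, hC⟩ := HestenesSobolev.exists_sobolevNorm_testFun_mul_le η g r hp hp'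
  refine ⟨C, fun f hf => ?_⟩
  have h := (hP.memSobolevLoc_iff h𝒰 hq hH hT hp hp' hf.1).1 hf
  rw [sobolevNorm_congr_ae (hP.testFun_mul_ae_eq_sum h𝒰 hq hH hT η hf.1), Finset.mul_sum]
  exact (sobolevNorm_sum_le hp _ fun U _ => (hC _ (h U)).1.1).trans
    (Finset.sum_le_sum fun U _ => (hC _ (h U)).2)

end Decomposition

end HestenesSobolev

end

/-! ### The main theorem. -/

theorem mainTheorem9 {d : ℕ} {M : Type*} [TopologicalSpace M] [T2Space M]
    [SecondCountableTopology M] [ConnectedSpace M] [ChartedSpace (Eu d) M]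
    [IsManifold (𝓡 d) ∞ M] [MeasurableSpace M] [BorelSpace M]
    (g : SmoothMetric d M)
    (𝒰 : Set (Set M)) (h𝒰 : IsOpenPrecompactCover 𝒰)
    (q : ℝ≥0∞) [Fact (1 ≤ q)] (hq : q ≠ ⊤)
    (P : 𝒰 → C₀(M, ℝ) →L[ℝ] C₀(M, ℝ)) (hP : IsSmoothDecomposition g 𝒰 q P)
    (p : ℝ≥0∞) (hp : 1 ≤ p) (hp' : p ≠ ⊤) (r : ℕ) :
    (∀ f : M → ℝ, LocallyIntegrable f (riemannianMeasure g) →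
      (MemSobolevLoc g r p f ↔
        ∀ U : 𝒰, MemSobolev g r p (applyLoc (riemannianMeasure g) U.1 (P U) f))) ∧
    -- the vector space `W^r_{p,loc}(M)` of classes of functions, with the seminorms `‖η f‖` that
    -- define its topology and the seminorms `‖P_U f‖`
    ∃ (W : Submodule ℝ (M →ₘ[riemannianMeasure g] ℝ))
      (ρ : TestFun d M → Seminorm ℝ W) (κ : 𝒰 → Seminorm ℝ W),
      (∀ f : M →ₘ[riemannianMeasure g] ℝ, f ∈ W ↔ MemSobolevLoc g r p f) ∧
      (∀ (η : TestFun d M) (f : W),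
        ENNReal.ofReal (ρ η f) =
          sobolevNorm g r p (fun x => η.1 x * (f : M →ₘ[riemannianMeasure g] ℝ) x)) ∧
      (∀ (U : 𝒰) (f : W),
        ENNReal.ofReal (κ U f) =
          sobolevNorm g r p
            (applyLoc (riemannianMeasure g) U.1 (P U) (f : M →ₘ[riemannianMeasure g] ℝ))) ∧
      ∃ τ : TopologicalSpace W, WithSeminorms (topology := τ) ρ ∧ WithSeminorms (topology := τ) κ := by
  choose n H hH hT using hP.localized
  have hloc : ∀ (U : 𝒰) (f : M → ℝ), LocallyIntegrable f (riemannianMeasure g) →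
      applyLoc (riemannianMeasure g) U.1 (P U) f =ᵐ[riemannianMeasure g] sumH (H U) f :=
    fun U f hf => applyLoc_ae_eq_sumH g (h𝒰.isOpen U.1 U.2) (h𝒰.precompact U.1 U.2) (hT U)
      (fun i => (hH U i).2) hf
  refine ⟨fun f hf => ?_, ?_⟩
  · rw [hP.memSobolevLoc_iff h𝒰 hq hH hT hp hp' hf]
    exact forall_congr' fun U => (memSobolev_congr_ae (hloc U f hf)).symm
  let W := sobolevLoc g r hp
  have hW : ∀ f : W, MemSobolevLoc g r p (f : M →ₘ[riemannianMeasure g] ℝ) := fun f => f.2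
  have hadd : ∀ f f' : W, ((f + f' : W) : M →ₘ[riemannianMeasure g] ℝ)
      =ᵐ[riemannianMeasure g] (f : M → ℝ) + (f' : M → ℝ) := fun f f' => AEEqFun.coeFn_add _ _
  have hsmul : ∀ (c : ℝ) (f : W), ((c • f : W) : M →ₘ[riemannianMeasure g] ℝ)
      =ᵐ[riemannianMeasure g] c • (f : M → ℝ) := fun c f => AEEqFun.coeFn_smul _ _
  let ρ : TestFun d M → Seminorm ℝ W := fun η =>
    sobolevSeminorm (g := g) (r := r) hp
      (fun (f : W) x => η.1 x * (f : M →ₘ[riemannianMeasure g] ℝ) x)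
      (fun f f' => by
        filter_upwards [hadd f f'] with x hx
        rw [hx]
        exact mul_add _ _ _)
      (fun c f => by
        filter_upwards [hsmul c f] with x hx
        rw [hx]
        exact mul_left_comm _ _ _)
      (fun f => (hW f).2 η)
  have hρ : ∀ η (f : W), ENNReal.ofReal (ρ η f) = sobolevNorm g r p
      (fun x => η.1 x * (f : M →ₘ[riemannianMeasure g] ℝ) x) := fun η f =>
    ofReal_sobolevSeminorm hp _ _ _ _ f
  -- The seminorms are built from `sumH`, whose linearity holds pointwise; `hloc` identifies them
  -- with those of `applyLoc` afterwards.
  let κ : 𝒰 → Seminorm ℝ W := fun U =>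
    sobolevSeminorm (g := g) (r := r) hp
      (fun f : W => sumH (H U) (f : M →ₘ[riemannianMeasure g] ℝ))
      (fun f f' => (sumH_ae_congr (H U) g (hadd f f')).trans (sumH_add _ _ _).eventuallyEq)
      (fun c f => (sumH_ae_congr (H U) g (hsmul c f)).trans (sumH_const_smul _ _ _).eventuallyEq)
      (fun f => (hP.memSobolevLoc_iff h𝒰 hq hH hT hp hp' (hW f).1).1 (hW f) U)
  have hκ : ∀ U (f : W), ENNReal.ofReal (κ U f) = sobolevNorm g r p
      (sumH (H U) (f : M →ₘ[riemannianMeasure g] ℝ)) := fun U f =>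
    ofReal_sobolevSeminorm hp _ _ _ _ f
  refine ⟨W, ρ, κ, fun f => Iff.rfl, hρ, fun U f => ?_, ?_⟩
  · rw [hκ, sobolevNorm_congr_ae (hloc U _ (hW f).1)]
  let τ : TopologicalSpace W := SeminormFamily.moduleFilterBasis ρ |>.topology
  have hτ : WithSeminorms ρ := ⟨rfl⟩
  -- The topology is generated by `ρ`; it is also generated by `κ` once each seminorm of one family
  -- is bounded by a multiple of a finite supremum from the other.
  refine ⟨τ, hτ, hτ.congr (fun U => ?_) fun η => ?_⟩
  · obtain ⟨η, hη⟩ := exists_testFun_eq_one d (h𝒰.precompact U.1 U.2)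
    obtain ⟨C, hC⟩ := exists_sobolevNorm_sumH_le (H U) g r hp hp'
    refine ⟨{η}, C, fun f => ?_⟩
    rw [Finset.sup_singleton]
    change κ U f ≤ C * ρ η f
    rw [← ENNReal.ofReal_le_ofReal_iff (by positivity), ENNReal.ofReal_mul (NNReal.coe_nonneg _),
      ENNReal.ofReal_coe_nnreal, hκ, hρ, ← sumH_testFun_mul (fun i => (hH U i).2) hη]
    exact (hC _ ((hW f).2 η)).2
  · obtain ⟨C, hC⟩ := hP.exists_sobolevNorm_testFun_mul_le (r := r) h𝒰 hq hH hT hp hp' η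
    set F := (hP.locallyFinite _ η.2.2).toFinset
    -- The factor `F.card` converts the sum over `F` into a supremum.
    refine ⟨F, C * F.card, fun f => ?_⟩
    change ρ η f ≤ (C * F.card : ℝ≥0) * F.sup κ f
    rw [← ENNReal.ofReal_le_ofReal_iff (by positivity), ENNReal.ofReal_mul (NNReal.coe_nonneg _),
      ENNReal.ofReal_coe_nnreal, hρ, ENNReal.coe_mul, mul_assoc]
    refine (hC _ (hW f)).trans (mul_le_mul_right ?_ _)
    rw [ENNReal.coe_natCast, ← nsmul_eq_mul]
    refine Finset.sum_le_card_nsmul _ _ _ fun U hU => ?_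
    rw [← hκ]
    exact ENNReal.ofReal_le_ofReal (Seminorm.le_finset_sup_apply hU)
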